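/- **Setting.** Let $n\in\mathbb N_0$, $T>0$ and $\hbar>0$, and let $V\ge 0$ be a function on $\hbar\mathbb Z^n$ with $V(k)\to\infty$ as $|k|\to\infty$. Let $v_1,\dots,v_n$ be the standard basis of $\mathbb Z^n$ and $$\mathcal H u(k)=-\hbar^{-2}\Big(\sum_{j=1}^n\big(u(k+\hbar v_j)+u(k-\hbar v_j)\big)-2n\,u(k)\Big)+V(k)u(k),\qquad k\in\hbar\mathbb Z^n .$$ There is an orthonormal basis $(u_\xi)_\xi$ of $\ell^2(\hbar\mathbb Z^n)$ with $\mathcal H u_\xi=\lambda_\xi u_\xi$, $\lambda_\xi\ge 0$. Let $\mathrm H^\infty$ be the space of all $\varphi$ with $(I+\mathcal H)^j\varphi\in\ell^2(\hbar\mathbb Z^n)$ for every $j\ge0$, with the norms $\max_{j\le m}\|(I+\mathcal H)^j\varphi\|_{\ell^2}$, and let $\mathrm H^{-\infty}$ be the space of continuous conjugate-linear functionals $w$ on $\mathrm H^\infty$. Write $(w,\varphi)=w(\varphi)$, $w(k)=(w,\delta_k)$ and $(\mathcal Hw,\varphi)=(w,\mathcal H\varphi)$. For $s\in\mathbb R$,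 $$\mathrm H^s=\Big\{w\in\mathrm H^{-\infty}:\ \|w\|_{\mathrm H^s}^2=\|(I+\mathcal H)^{s/2}w\|_{\ell^2}^2=\sum_\xi(1+\lambda_\xi)^s|(w,u_\xi)|^2<\infty\Big\}.$$ **Moderate nets.** A net $(g_\varepsilon)_{\varepsilon\in(0,1]}$ of real functions on $\mathbb R$ is $L^\infty_m$-moderate if each $g_\varepsilon$ is $m$ times differentiable with $g_\varepsilon,\dots,g_\varepsilon^{(m)}\in L^\infty(\mathbb R)$, and for every compact $K\subset\mathbb R$ there are $N\in\mathbb N_0$, $c>0$ with $\|g_\varepsilon^{(j)}\|_{L^\infty(K)}\le c\,\varepsilon^{-N-j}$ for all $j\le m$, $\varepsilon\in(0,1]$. A net $(w_\varepsilon)$ in $L^2([0,T];\mathrm H^s)$ is $L^2([0,T];\mathrm H^s)$-moderate if there are $N\in\mathbb N_0$, $c>0$ with $\|w_\varepsilon\|_{L^2([0,T];\mathrm H^s)}\le c\,\varepsilon^{-N}$ for all $\varepsilon\in(0,1]$. **Regularisations.** A regularisation of a distribution $A$ on $\mathbb R$ is a net $A_\varepsilon=A*\psi_{\omega(\varepsilon)}$,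 $\varepsilon\in(0,1]$, where $\psi\in C_0^\infty(\mathbb R)$, $\psi\ge 0$, $\int\psi=1$, $\psi_\omega(t)=\omega^{-1}\psi(t/\omega)$, $\omega(\varepsilon)>0$ and $\omega(\varepsilon)\to0$ as $\varepsilon\to0$. For a family $f=(f(\cdot,k))_{k\in\hbar\mathbb Z^n}$ of complex distributions on $\mathbb R$, an $L^2([0,T];\mathrm H^s)$-moderate regularisation of $f$ is an $L^2([0,T];\mathrm H^s)$-moderate net $(f_\varepsilon)$ such that, for each $k$, the net $(f_\varepsilon(\cdot,k))_\varepsilon$ is a regularisation of $f(\cdot,k)$ ($\psi$ and $\omega$ may depend on $k$). **Very weak solutions.** Consider the Cauchy problem $$\partial_t^2u+a(t)\mathcal Hu+q(t)u=f\ \text{ on }(0,T]\times\hbar\mathbb Z^n,\qquad u(0)=u_0,\quad \partial_tu(0)=u_1. \tag{1}$$ A net $(u_\varepsilon)_{\varepsilon\in(0,1]}$ is a very weak solution of order $s$ of (1) if it is $L^2([0,T];\mathrm H^{1+s})$-moderate and there are an $L^\infty_1$-moderate regularisation $(a_\varepsilon)$ of $a$, an $L^\infty$-moderate regularisation $(q_\varepsilon)$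 of $q$ (that is, $m=0$) and an $L^2([0,T];\mathrm H^s)$-moderate regularisation $(f_\varepsilon)$ of $f$ such that, for every $\varepsilon\in(0,1]$, $u_\varepsilon$ solves (1) with $a,q,f$ replaced by $a_\varepsilon,q_\varepsilon,f_\varepsilon$. This means: $u_\varepsilon$ is differentiable in $t\in[0,T]$ as an $\mathrm H^{-\infty}$-valued function (tested against each $\varphi\in\mathrm H^\infty$), $u_\varepsilon(0)=u_0$ and $\partial_tu_\varepsilon(0)=u_1$ in $\mathrm H^{-\infty}$, the equation holds classically at every $(t,k)\in(0,T]\times\hbar\mathbb Z^n$, and for all $\varphi\in\mathrm H^\infty$, $t\in[0,T]$, $$(\partial_tu_\varepsilon(t),\varphi)=(u_1,\varphi)+\int_0^t\big((f_\varepsilon,\varphi)-a_\varepsilon(u_\varepsilon,\mathcal H\varphi)-q_\varepsilon(u_\varepsilon,\varphi)\big)\,d\tau .$$ **Theorem (Existence).** Let $a$ and $q$ be real distributions on $\mathbb R$ with supports contained in $[0,T]$, and let $a\ge a_0$ on $[0,T]$ for some constant $a_0>0$, in the sense that $\langle a,\phi\rangle\ge a_0\int_0^T\phi(t)\,dt$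 for all $\phi\in C_0^\infty(\mathbb R)$ with $\phi\ge0$. For each $k\in\hbar\mathbb Z^n$ let $f(\cdot,k)$ be a complex distribution on $\mathbb R$ with support contained in $[0,T]$. Let $s\in\mathbb R$ and $(u_0,u_1)\in\mathrm H^{1+s}\times\mathrm H^s$. Then the Cauchy problem (1) has a very weak solution of order $s$. Moreover, for every $L^2([0,T];\mathrm H^s)$-moderate regularisation $(f_\varepsilon)$ of $f$ there is a very weak solution of order $s$ whose regularised source is $(f_\varepsilon)$. -/

import Mathlib

open scoped InnerProductSpace Distributions ENNReal

namespace LatticeWave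

/-- The Hilbert space `ℓ²(ħℤⁿ)`. The lattice point `ħ k` is indexed by `k : Fin n → ℤ`; this indexing
is used for all functions on the lattice. -/
abbrev Ell2 (n : ℕ) : Type := lp (fun _ : Fin n → ℤ => ℂ) 2

/-! ### Orthonormal eigenbases (auxiliary facts)

The discrete Schrödinger operator with confining potential has an orthonormal basis of
eigenfunctions; the fractional powers in the Sobolev norms are defined through such a basis. -/

theorem exists_eigenbasis_of_compact {E : Type} [NormedAddCommGroup E] [InnerProductSpace ℂ E]
    [CompleteSpace E] (T : E →L[ℂ] E) (hT : IsCompactOperator T) (hT' : T.IsSymmetric) :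
    ∃ (ι : Type) (b : HilbertBasis ι ℂ E) (μ : ι → ℂ), ∀ i, T (b i) = μ i • b i := by
  classical
  have hc : ∀ μ : ℂ, CompleteSpace (Module.End.eigenspace (T : Module.End ℂ E) μ) := fun μ => by
    have : IsClosed ((Module.End.eigenspace (T : Module.End ℂ E) μ : Submodule ℂ E) : Set E) := by
      have h : ((Module.End.eigenspace (T : Module.End ℂ E) μ : Submodule ℂ E) : Set E)
          = {x | T x = μ • x} := by
        ext x; simp
      rw [h]
      exact isClosed_eq T.continuous (continuous_const_smul μ)
    exact this.completeSpace_coe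
  choose w b hb using fun μ : ℂ =>
    exists_hilbertBasis ℂ (Module.End.eigenspace (T : Module.End ℂ E) μ)
  have hon := (LinearMap.IsSymmetric.orthogonalFamily_eigenspaces hT').orthonormal_sigma_orthonormal
    (fun μ => (b μ).orthonormal)
  have hsp : (Submodule.span ℂ (Set.range fun a : Σ μ, w μ =>
      (Module.End.eigenspace (T : Module.End ℂ E) a.1).subtypeₗᵢ (b a.1 a.2)))ᗮ = ⊥ := by
    rw [eq_bot_iff, ← ContinuousLinearMap.orthogonalComplement_iSup_eigenspaces_eq_bot hT hT']
    intro x hx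
    rw [← Submodule.iInf_orthogonal, Submodule.mem_iInf]
    intro μ
    rw [Submodule.mem_orthogonal]
    intro u hu
    have hd := (b μ).dense_span
    have key : ∀ y : Module.End.eigenspace (T : Module.End ℂ E) μ, ⟪(y : E), x⟫_ℂ = 0 := by
      intro y
      have hy : y ∈ (Submodule.span ℂ (Set.range (b μ))).topologicalClosure := by
        rw [hd]; trivial
      have hcl : IsClosed {y : Module.End.eigenspace (T : Module.End ℂ E) μ | ⟪(y : E), x⟫_ℂ = 0} :=
        isClosed_eq (by fun_prop) continuous_const
      refine closure_minimal ?_ hcl hy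
      intro z hz
      induction hz using Submodule.span_induction with
      | mem z hz =>
        obtain ⟨i, rfl⟩ := hz
        exact (Submodule.mem_orthogonal _ _).1 hx _ (Submodule.subset_span ⟨⟨μ, i⟩, rfl⟩)
      | zero => simp
      | add y z _ _ hy hz => simp_all
      | smul c y _ hy => simp_all
    exact key ⟨u, hu⟩
  refine ⟨Σ μ, w μ, HilbertBasis.mkOfOrthogonalEqBot hon hsp, fun a => a.1, fun a => ?_⟩
  rw [HilbertBasis.coe_mkOfOrthogonalEqBot]
  exact Module.End.mem_eigenspace_iff.1 (b a.1 a.2).2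

variable {n : ℕ}

theorem memlp_comp (e : (Fin n → ℤ) ≃ (Fin n → ℤ)) (f : Ell2 n) :
    Memℓp (fun k => f (e k)) 2 := by
  have h := (memℓp_gen_iff (p := 2) (by norm_num)).1 f.2
  exact memℓp_gen ((e.summable_iff (f := fun k => ‖f k‖ ^ (2 : ENNReal).toReal)).2 h)

/-- The isometry of `ℓ²` given by a permutation of the lattice. -/
noncomputable def reindexOp (e : (Fin n → ℤ) ≃ (Fin n → ℤ)) : Ell2 n →L[ℂ] Ell2 n :=
  LinearMap.mkContinuous
    { toFun := fun f => ⟨fun k => f (e k), memlp_comp e f⟩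
      map_add' := fun f g => by ext k; rfl
      map_smul' := fun c f => by ext k; rfl } 1 (fun f => by
    rw [one_mul]
    refine le_of_eq ?_
    rw [lp.norm_eq_tsum_rpow (by norm_num), lp.norm_eq_tsum_rpow (by norm_num)]
    congr 1
    exact e.tsum_eq (fun k => ‖f k‖ ^ (2 : ENNReal).toReal))

@[simp] theorem reindexOp_apply (e : (Fin n → ℤ) ≃ (Fin n → ℤ)) (f : Ell2 n) (k : Fin n → ℤ) :
    reindexOp e f k = f (e k) := rfl

theorem inner_reindexOp (e : (Fin n → ℤ) ≃ (Fin n → ℤ)) (f g : Ell2 n) :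
    ⟪reindexOp e f, g⟫_ℂ = ⟪f, reindexOp e.symm g⟫_ℂ := by
  rw [lp.inner_eq_tsum, lp.inner_eq_tsum,
    ← e.tsum_eq (fun k => ⟪f k, reindexOp e.symm g k⟫_ℂ)]
  simp

theorem norm_reindexOp_le (e : (Fin n → ℤ) ≃ (Fin n → ℤ)) (f : Ell2 n) :
    ‖reindexOp e f‖ ≤ ‖f‖ := by
  have := (reindexOp e).le_of_opNorm_le (LinearMap.mkContinuous_norm_le _ zero_le_one _) f
  simpa using this

theorem memlp_mul {m : (Fin n → ℤ) → ℝ} {C : ℝ} (hm : ∀ k, |m k| ≤ C) (f : Ell2 n) :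
    Memℓp (fun k => (m k : ℂ) * f k) 2 ∧
      ∀ h : Memℓp (fun k => (m k : ℂ) * f k) 2, ‖(⟨_, h⟩ : Ell2 n)‖ ≤ C * ‖f‖ := by
  have hC : 0 ≤ C := (abs_nonneg _).trans (hm 0)
  have h1 : ∀ k, ‖(m k : ℂ) * f k‖ ≤ ‖((C : ℂ) • f : Ell2 n) k‖ := fun k => by
    rw [lp.coeFn_smul, Pi.smul_apply, smul_eq_mul, norm_mul, norm_mul, Complex.norm_real,
      Complex.norm_real, Real.norm_eq_abs, Real.norm_eq_abs, abs_of_nonneg hC]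
    exact mul_le_mul_of_nonneg_right (hm k) (norm_nonneg _)
  have h2 : Memℓp (fun k => (m k : ℂ) * f k) 2 := by
    have h := (memℓp_gen_iff (p := 2) (by norm_num)).1 ((C : ℂ) • f : Ell2 n).2
    refine memℓp_gen (Summable.of_nonneg_of_le (fun k => by positivity) (fun k => ?_) h)
    exact Real.rpow_le_rpow (norm_nonneg _) (h1 k) (by norm_num)
  refine ⟨h2, fun h => ?_⟩
  have : ‖(⟨_, h⟩ : Ell2 n)‖ ≤ ‖((C : ℂ) • f : Ell2 n)‖ := by
    rw [lp.norm_eq_tsum_rpow (by norm_num), lp.norm_eq_tsum_rpow (by norm_num)]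
    refine Real.rpow_le_rpow (tsum_nonneg fun k => by positivity) ?_ (by norm_num)
    refine Summable.tsum_le_tsum (fun k => Real.rpow_le_rpow (norm_nonneg _) (h1 k) (by norm_num))
      ((memℓp_gen_iff (p := 2) (by norm_num)).1 h)
      ((memℓp_gen_iff (p := 2) (by norm_num)).1 ((C : ℂ) • f : Ell2 n).2)
  rwa [norm_smul, Complex.norm_real, Real.norm_eq_abs, abs_of_nonneg hC] at this

/-- The operator of multiplication by a bounded function on `ℓ²`. -/
noncomputable def mulOp (m : (Fin n → ℤ) → ℝ) (C : ℝ) (hm : ∀ k, |m k| ≤ C) :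
    Ell2 n →L[ℂ] Ell2 n :=
  LinearMap.mkContinuous
    { toFun := fun f => ⟨fun k => (m k : ℂ) * f k, (memlp_mul hm f).1⟩
      map_add' := fun f g => by ext k; exact mul_add _ _ _
      map_smul' := fun c f => by ext k; exact mul_left_comm _ _ _ } C
    (fun f => (memlp_mul hm f).2 _)

@[simp] theorem mulOp_apply {m : (Fin n → ℤ) → ℝ} {C : ℝ} (hm : ∀ k, |m k| ≤ C) (f : Ell2 n)
    (k : Fin n → ℤ) : mulOp m C hm f k = (m k : ℂ) * f k := rfl

theorem norm_mulOp_le {m : (Fin n → ℤ) → ℝ} {C : ℝ} (hm : ∀ k, |m k| ≤ C) :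
    ‖mulOp m C hm‖ ≤ C :=
  LinearMap.mkContinuous_norm_le _ ((abs_nonneg _).trans (hm 0)) _

theorem inner_mulOp {m : (Fin n → ℤ) → ℝ} {C : ℝ} (hm : ∀ k, |m k| ≤ C) (f g : Ell2 n) :
    ⟪mulOp m C hm f, g⟫_ℂ = ⟪f, mulOp m C hm g⟫_ℂ := by
  rw [lp.inner_eq_tsum, lp.inner_eq_tsum]
  refine tsum_congr fun k => ?_
  simp
  ring

theorem isCompactOperator_mulOp {m : (Fin n → ℤ) → ℝ} {C : ℝ} (hm : ∀ k, |m k| ≤ C)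
    (h0 : Filter.Tendsto m Filter.cofinite (nhds 0)) : IsCompactOperator (mulOp m C hm) := by
  classical
  set F : Finset (Fin n → ℤ) → (Ell2 n →L[ℂ] Ell2 n) := fun s =>
    ∑ k ∈ s, (m k : ℂ) • (lp.singleContinuousLinearMap ℂ (fun _ : Fin n → ℤ => ℂ) 2 k).comp
      (lp.evalCLM ℂ (fun _ : Fin n → ℤ => ℂ) 2 k) with hF
  have hFk : ∀ s f k, F s f k = if k ∈ s then (m k : ℂ) * f k else 0 := by
    intro s f k
    have h1 : F s f = ∑ j ∈ s, lp.single 2 j ((m j : ℂ) * f j) := by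
      simp only [hF, sum_apply]
      refine Finset.sum_congr rfl fun j _ => ?_
      rw [← smul_eq_mul, lp.single_smul]
      rfl
    rw [h1, lp.coeFn_sum, Finset.sum_apply]
    simp [lp.single_apply, Pi.single_apply]
  have hFc : ∀ s, IsCompactOperator (F s) := by
    intro s
    induction s using Finset.induction_on with
    | empty => simpa [hF] using isCompactOperator_zero
    | insert k s hk ih =>
      have : F (insert k s) = (m k : ℂ) • (lp.singleContinuousLinearMap ℂ (fun _ : Fin n → ℤ => ℂ) 2 k).comp
        (lp.evalCLM ℂ (fun _ : Fin n → ℤ => ℂ) 2 k) + F s := by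
        simp only [hF]; rw [Finset.sum_insert hk]
      rw [this]
      refine IsCompactOperator.add ?_ ih
      have h1 : IsCompactOperator (lp.evalCLM ℂ (fun _ : Fin n → ℤ => ℂ) 2 k) :=
        isCompactOperator_of_locallyCompactSpace_dom
          (lp.evalCLM ℂ (fun _ : Fin n → ℤ => ℂ) 2 k)
      exact (h1.clm_comp (lp.singleContinuousLinearMap ℂ (fun _ : Fin n → ℤ => ℂ) 2 k)).smul
        (m k : ℂ)
  refine isCompactOperator_of_tendsto (l := Filter.atTop) (F := F) ?_ (Filter.Eventually.of_forall hFc)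
  rw [tendsto_iff_norm_sub_tendsto_zero, Metric.tendsto_nhds]
  intro ε hε
  have hfin : {k | ¬ |m k| < ε / 2}.Finite := by
    have := (Metric.tendsto_nhds.1 h0) (ε / 2) (by positivity)
    simpa [Filter.eventually_cofinite] using this
  filter_upwards [Filter.eventually_ge_atTop hfin.toFinset] with s hs
  have hb : ∀ k, |if k ∈ s then 0 else m k| ≤ ε / 2 := by
    intro k
    split_ifs with h
    · simp; positivity
    · by_contra hk
      exact h (hs (by simpa using le_of_lt (not_le.1 hk)))
  have : F s - mulOp m C hm = - mulOp _ _ hb := by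
    ext f k
    change F s f k - mulOp m C hm f k = - mulOp _ _ hb f k
    rw [hFk, mulOp_apply, mulOp_apply]
    split_ifs <;> simp
  rw [this, dist_zero_right, norm_norm, norm_neg]
  linarith [norm_mulOp_le hb]


/-! ### The discrete Schrödinger operator -/

/-- A discretisation parameter `ħ > 0` and a potential `V ≥ 0` on `ħℤⁿ` with `V(k) → ∞` as
`|k| → ∞`. The value `V k` is the value at the lattice point `ħ k`; on `ℤⁿ`, the filter of
complements of finite sets is the filter of `|k| → ∞`. -/
structure ConfiningSchrodinger (n : ℕ) where
  hbar : ℝ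
  hbar_pos : 0 < hbar
  V : (Fin n → ℤ) → ℝ
  V_nonneg : ∀ k, 0 ≤ V k
  V_tendsto : Filter.Tendsto V Filter.cofinite Filter.atTop

/-- The operator `-ħ⁻² L + V` on functions on the lattice, where
`(L u)(k) = ∑ⱼ (u(k + ħ vⱼ) + u(k - ħ vⱼ)) - 2 n u(k)`. -/
noncomputable def hamiltonian (S : ConfiningSchrodinger n) :
    ((Fin n → ℤ) → ℂ) →ₗ[ℂ] ((Fin n → ℤ) → ℂ) where
  toFun u k := -((S.hbar : ℂ) ^ 2)⁻¹ *
      (∑ j : Fin n, (u (k + Pi.single j 1) + u (k - Pi.single j 1)) - 2 * (n : ℂ) * u k)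
    + (S.V k : ℂ) * u k
  map_add' u v := by
    ext k
    simp only [Pi.add_apply, Finset.sum_add_distrib]
    ring
  map_smul' c u := by
    ext k
    simp only [Pi.smul_apply, smul_eq_mul, RingHom.id_apply, Finset.sum_add_distrib,
      ← Finset.mul_sum]
    ring

/-- There is an orthonormal basis of `ℓ²` consisting of eigenfunctions, with eigenvalues `≥ 0`. -/
theorem exists_eigenbasis (S : ConfiningSchrodinger n) :
    ∃ (ι : Type) (b : HilbertBasis ι ℂ (Ell2 n)) (ev : ι → ℝ), (∀ i, 0 ≤ ev i) ∧
      ∀ i, hamiltonian S (b i) = (ev i : ℂ) • (b i : (Fin n → ℤ) → ℂ) := by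
  classical
  -- the square root of the resolvent of the potential
  set d : (Fin n → ℤ) → ℝ := fun k => (Real.sqrt (1 + S.V k))⁻¹ with hd
  have hs1 : ∀ k, 1 ≤ Real.sqrt (1 + S.V k) := fun k => by
    rw [Real.one_le_sqrt]; linarith [S.V_nonneg k]
  have hd0 : ∀ k, 0 < d k := fun k => inv_pos.2 (by linarith [hs1 k])
  have hd1 : ∀ k, |d k| ≤ 1 := fun k => by
    rw [abs_of_pos (hd0 k)]; exact inv_le_one_of_one_le₀ (hs1 k)
  have hdV : ∀ k, d k * d k * (1 + S.V k) = 1 := fun k => by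
    have : 0 < 1 + S.V k := by linarith [S.V_nonneg k]
    simp only [hd]
    rw [← mul_inv, Real.mul_self_sqrt this.le, inv_mul_cancel₀ this.ne']
  have hdt : Filter.Tendsto d Filter.cofinite (nhds 0) := by
    refine Filter.Tendsto.inv_tendsto_atTop ?_
    exact Real.tendsto_sqrt_atTop.comp (Filter.tendsto_atTop_add_const_left _ 1 S.V_tendsto)
  set D := mulOp d 1 hd1 with hD
  have hDc : IsCompactOperator D := isCompactOperator_mulOp hd1 hdt
  -- the kinetic part
  set U : Fin n → Ell2 n →L[ℂ] Ell2 n := fun j => reindexOp (Equiv.addRight (Pi.single j 1))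
  set U' : Fin n → Ell2 n →L[ℂ] Ell2 n := fun j => reindexOp (Equiv.addRight (Pi.single j 1)).symm
  set c : ℝ := (S.hbar ^ 2)⁻¹ with hc
  have hc0 : 0 ≤ c := by positivity
  set K : Ell2 n →L[ℂ] Ell2 n := (c : ℂ) • ∑ j, ((2 : ℂ) • ContinuousLinearMap.id ℂ (Ell2 n)
    - U j - U' j) with hK
  have hKs : ∀ f g, ⟪K f, g⟫_ℂ = ⟪f, K g⟫_ℂ := by
    intro f g
    simp only [hK, smul_apply, sum_apply,
      sub_apply, ContinuousLinearMap.id_apply, inner_smul_left,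
      inner_smul_right, sum_inner, inner_sum, inner_sub_left, inner_sub_right]
    rw [Complex.conj_ofReal]
    congr 1
    refine Finset.sum_congr rfl fun j _ => ?_
    have h1 : ⟪U j f, g⟫_ℂ = ⟪f, U' j g⟫_ℂ := inner_reindexOp _ f g
    have h2 : ⟪U' j f, g⟫_ℂ = ⟪f, U j g⟫_ℂ := inner_reindexOp _ f g
    rw [h1, h2, Complex.conj_ofNat]
    ring
  have hKp : ∀ f, 0 ≤ (⟪K f, f⟫_ℂ).re := by
    intro f
    simp only [hK, smul_apply, sum_apply,
      sub_apply, ContinuousLinearMap.id_apply, inner_smul_left,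
      sum_inner, inner_sub_left]
    rw [Complex.conj_ofReal, Complex.re_ofReal_mul, Complex.re_sum]
    refine mul_nonneg hc0 (Finset.sum_nonneg fun j _ => ?_)
    rw [Complex.conj_ofNat, Complex.sub_re, Complex.sub_re, inner_self_eq_norm_sq_to_K]
    have h0 : ((2 : ℂ) * ((‖f‖ : ℝ) : ℂ) ^ 2).re = 2 * ‖f‖ ^ 2 := by
      have h : (2 : ℂ) * ((‖f‖ : ℝ) : ℂ) ^ 2 = ((2 * ‖f‖ ^ 2 : ℝ) : ℂ) := by push_cast; rfl
      rw [h]; exact Complex.ofReal_re _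
    have h1 : (⟪U j f, f⟫_ℂ).re ≤ ‖f‖ ^ 2 :=
      (Complex.re_le_norm _).trans ((norm_inner_le_norm _ _).trans (by
        rw [pow_two]; exact mul_le_mul_of_nonneg_right (norm_reindexOp_le _ f) (norm_nonneg _)))
    have h2 : (⟪U' j f, f⟫_ℂ).re ≤ ‖f‖ ^ 2 :=
      (Complex.re_le_norm _).trans ((norm_inner_le_norm _ _).trans (by
        rw [pow_two]; exact mul_le_mul_of_nonneg_right (norm_reindexOp_le _ f) (norm_nonneg _)))
    have h3 := h0
    erw [h3]
    linarith
  have hKk : ∀ f k, K f k = (c : ℂ) * (2 * (n : ℂ) * f k -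
      ∑ j : Fin n, (f (k + Pi.single j 1) + f (k - Pi.single j 1))) := by
    intro f k
    have h1 : K f k = (c : ℂ) * ∑ j, ((2 : ℂ) * f k - f (k + Pi.single j 1)
        - f (k - Pi.single j 1)) := by
      simp only [hK, smul_apply, sum_apply,
        lp.coeFn_smul, lp.coeFn_sum, Pi.smul_apply, Finset.sum_apply, smul_eq_mul]
      rfl
    rw [h1]
    congr 1
    simp only [Finset.sum_sub_distrib, Finset.sum_add_distrib, Finset.sum_const, Finset.card_univ,
      Fintype.card_fin, nsmul_eq_mul]
    ring
  -- the bounded, boundedly invertible operator `1 + D K D`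
  set M : Ell2 n →L[ℂ] Ell2 n := ContinuousLinearMap.id ℂ (Ell2 n) + D * K * D with hM
  have hDs : ∀ f g, ⟪D f, g⟫_ℂ = ⟪f, D g⟫_ℂ := inner_mulOp hd1
  have hMa : ∀ f, M f = f + D (K (D f)) := fun f => rfl
  have hMs : ∀ f g, ⟪M f, g⟫_ℂ = ⟪f, M g⟫_ℂ := by
    intro f g
    rw [hMa, hMa, inner_add_left, inner_add_right, hDs, hKs, hDs]
  have hMp : ∀ f, ‖f‖ ^ 2 ≤ (⟪M f, f⟫_ℂ).re := by
    intro f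
    rw [hMa, inner_add_left, hDs, Complex.add_re]
    have h1 : (⟪f, f⟫_ℂ).re = ‖f‖ ^ 2 := by
      rw [inner_self_eq_norm_sq_to_K]
      exact (congrArg Complex.re (Complex.ofReal_pow _ _).symm).trans (Complex.ofReal_re _)
    linarith [hKp (D f)]
  have hMu : IsUnit M := by
    refine ContinuousLinearMap.isUnit_of_forall_le_norm_inner_map M (c := 1) one_pos fun f => ?_
    simpa using (hMp f).trans (Complex.re_le_norm _)
  obtain ⟨N, hMN, hNM⟩ : ∃ N : Ell2 n →L[ℂ] Ell2 n, M * N = 1 ∧ N * M = 1 :=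
    ⟨_, hMu.mul_val_inv, hMu.val_inv_mul⟩
  have hMN' : ∀ f, M (N f) = f := fun f => congrArg (fun A : Ell2 n →L[ℂ] Ell2 n => A f) hMN
  have hNs : ∀ f g, ⟪N f, g⟫_ℂ = ⟪f, N g⟫_ℂ := by
    intro f g
    conv_lhs => rw [← hMN' g]
    rw [← hMs, hMN']
  set R : Ell2 n →L[ℂ] Ell2 n := D * N * D with hR
  have hRa : ∀ f, R f = D (N (D f)) := fun f => rfl
  have hRc : IsCompactOperator R := by
    have : (R : Ell2 n → Ell2 n) = D ∘ (N * D : Ell2 n →L[ℂ] Ell2 n) := rfl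
    rw [this]
    exact hDc.comp_clm _
  have hRs : (R : Ell2 n →ₗ[ℂ] Ell2 n).IsSymmetric := by
    intro f g
    change ⟪R f, g⟫_ℂ = ⟪f, R g⟫_ℂ
    rw [hRa, hRa, hDs, hNs, hDs]
  obtain ⟨ι, b, μ, hb⟩ := exists_eigenbasis_of_compact R hRc hRs
  have hb1 : ∀ i, ‖b i‖ = 1 := fun i => b.orthonormal.1 i
  have key : ∀ i, ∃ r : ℝ, μ i = (r : ℂ) ∧ 0 < r ∧ r ≤ 1 := by
    intro i
    set f := b i with hf
    set g := N (D f) with hg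
    have hfD : M g = D f := hMN' _
    have hDg : D g = μ i • f := hb i
    have e1 : (starRingEnd ℂ) (μ i) = ⟪g, M g⟫_ℂ := by
      rw [hfD, ← hDs, hDg, inner_smul_left, inner_self_eq_norm_sq_to_K, hb1]
      simp
    have e2 : ⟪g, M g⟫_ℂ = ⟪M g, g⟫_ℂ := (hMs g g).symm
    have e3 : (starRingEnd ℂ) ⟪M g, g⟫_ℂ = ⟪g, M g⟫_ℂ := inner_conj_symm _ _
    obtain ⟨r, hr⟩ := Complex.conj_eq_iff_real.1 (e3.trans e2)
    have hμ : μ i = (r : ℂ) := by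
      have := congrArg (starRingEnd ℂ) e1
      rwa [Complex.conj_conj, e2, hr, Complex.conj_ofReal] at this
    have hr1 : ‖g‖ ^ 2 ≤ r := by have := hMp g; rwa [hr, Complex.ofReal_re] at this
    have hr2 : ‖D g‖ ≤ ‖g‖ := by
      have := D.le_of_opNorm_le (norm_mulOp_le hd1) g
      simpa using this
    have hr3 : ‖D g‖ = |r| := by rw [hDg, norm_smul, hb1, hμ]; simp
    have hg0 : g ≠ 0 := by
      intro h0
      have h1 : D f = 0 := by rw [← hfD, h0, map_zero]
      have h2 : f = 0 := by
        ext k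
        have h3 : D f k = 0 := by rw [h1]; rfl
        rw [hD, mulOp_apply] at h3
        rcases mul_eq_zero.1 h3 with h | h
        · exact absurd (Complex.ofReal_eq_zero.1 h) (hd0 k).ne'
        · simpa using h
      have := hb1 i
      rw [← hf, h2, norm_zero] at this
      exact zero_ne_one this
    have hr0 : 0 < r := lt_of_lt_of_le (by positivity) hr1
    refine ⟨r, hμ, hr0, ?_⟩
    rw [hr3, abs_of_pos hr0] at hr2
    nlinarith [norm_nonneg g]
  choose r hr hr0 hr1 using key
  refine ⟨ι, b, fun i => (r i)⁻¹ - 1, fun i => ?_, fun i => ?_⟩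
  · have := (one_le_inv₀ (hr0 i)).2 (hr1 i)
    linarith
  · set f := b i with hf
    set g := N (D f) with hg
    have hfD : g + D (K (D g)) = D f := hMN' _
    have hDg : D g = (r i : ℂ) • f := (hb i).trans (by rw [hr])
    funext k
    have hk : g k + (d k : ℂ) * ((r i : ℂ) * K f k) = (d k : ℂ) * f k := by
      have h1 := congrArg (fun x : Ell2 n => x k) hfD
      rw [hDg, map_smul] at h1
      exact h1
    have hgk : (d k : ℂ) * g k = (r i : ℂ) * f k := congrArg (fun x : Ell2 n => x k) hDg
    have hdk : (d k : ℂ) ≠ 0 := Complex.ofReal_ne_zero.2 (hd0 k).ne'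
    have hrk : (r i : ℂ) ≠ 0 := Complex.ofReal_ne_zero.2 (hr0 i).ne'
    have hdV' : (d k : ℂ) * d k * (1 + S.V k) = 1 := by exact_mod_cast hdV k
    have hH : hamiltonian S (f : (Fin n → ℤ) → ℂ) k = K f k + (S.V k : ℂ) * f k := by
      rw [hKk]
      change -((S.hbar : ℂ) ^ 2)⁻¹ * _ + _ = _
      simp only [hc, Complex.ofReal_inv, Complex.ofReal_pow]
      ring
    rw [hH, Pi.smul_apply, smul_eq_mul]
    push_cast
    have h2 : (d k : ℂ) * d k * (r i * (K f k + (1 + S.V k) * f k)) = d k * d k * f k := by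
      linear_combination (d k : ℂ) * hk - hgk + r i * f k * hdV'
    have h3 := mul_left_cancel₀ (mul_ne_zero hdk hdk) h2
    field_simp
    linear_combination h3

/-- The index set of the eigenfunctions. -/
def EigenIndex (S : ConfiningSchrodinger n) : Type := (exists_eigenbasis S).choose

/-- An orthonormal basis of eigenfunctions of the Schrödinger operator. -/
noncomputable def eigenbasis (S : ConfiningSchrodinger n) :
    HilbertBasis (EigenIndex S) ℂ (Ell2 n) := (exists_eigenbasis S).choose_spec.choose

/-- The eigenvalues, repeated according to multiplicity. -/
noncomputable def eigenvalue (S : ConfiningSchrodinger n) : EigenIndex S → ℝ :=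
  (exists_eigenbasis S).choose_spec.choose_spec.choose

theorem eigenvalue_nonneg (S : ConfiningSchrodinger n) (i : EigenIndex S) : 0 ≤ eigenvalue S i :=
  (exists_eigenbasis S).choose_spec.choose_spec.choose_spec.1 i

theorem hamiltonian_eigenbasis (S : ConfiningSchrodinger n) (i : EigenIndex S) :
    hamiltonian S (eigenbasis S i) =
      (eigenvalue S i : ℂ) • (eigenbasis S i : (Fin n → ℤ) → ℂ) :=
  (exists_eigenbasis S).choose_spec.choose_spec.choose_spec.2 i

/-! ### Test functions and distributions of the Schrödinger operator -/

/-- The space of test functions: all `φ` with `(I + H)^j φ ∈ ℓ²` for every `j ≥ 0`. -/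
noncomputable def testSpace (S : ConfiningSchrodinger n) : Submodule ℂ ((Fin n → ℤ) → ℂ) where
  carrier := {φ | ∀ j : ℕ, Memℓp (((1 + hamiltonian S) ^ j) φ) 2}
  add_mem' := fun {φ χ} hφ hχ j => by
    rw [map_add]; exact (hφ j).add (hχ j)
  zero_mem' := fun j => by rw [map_zero]; exact zero_memℓp
  smul_mem' := fun c φ hφ j => by rw [map_smul]; exact (hφ j).const_smul c

/-- The norms `max_{j ≤ m} ‖(I + H)^j φ‖_{ℓ²}` that define the topology of the test functions. -/
noncomputable def testNorm (S : ConfiningSchrodinger n) (m : ℕ) (φ : testSpace S) : ℝ :=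
  ⨆ j : Fin (m + 1),
    ‖(⟨((1 + hamiltonian S) ^ (j : ℕ)) (φ : (Fin n → ℤ) → ℂ), φ.2 j⟩ : Ell2 n)‖

/-- Distributions of the Schrödinger operator: continuous functionals on the test functions. As the
pairing is `w(φ) = ∑ₖ w(k) * conj (φ(k))`, they are conjugate-linear. -/
structure HDistribution (S : ConfiningSchrodinger n) where
  toFun : testSpace S →ₛₗ[starRingEnd ℂ] ℂ
  bound : ∃ (C : ℝ) (m : ℕ), ∀ φ, ‖toFun φ‖ ≤ C * testNorm S m φ

noncomputable instance (S : ConfiningSchrodinger n) : CoeFun (HDistribution S) (fun _ => testSpace S → ℂ) where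
  coe w := w.toFun

theorem hamiltonian_finite (S : ConfiningSchrodinger n) {φ : (Fin n → ℤ) → ℂ}
    (h : φ.support.Finite) : (hamiltonian S φ).support.Finite := by
  have h1 : ∀ v : Fin n → ℤ, {k | φ (k + v) ≠ 0}.Finite := fun v =>
    h.preimage (Function.Injective.injOn (add_left_injective v))
  have h2 : ∀ v : Fin n → ℤ, {k | φ (k - v) ≠ 0}.Finite := fun v =>
    h.preimage (Function.Injective.injOn (sub_left_injective (b := v)))
  refine (h.union ((Set.finite_iUnion fun j : Fin n => h1 (Pi.single j 1)).union
    (Set.finite_iUnion fun j : Fin n => h2 (Pi.single j 1)))).subset fun k hk => ?_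
  by_contra hn
  simp only [Set.mem_union, Set.mem_iUnion, not_or, not_exists, Set.mem_ofPred_eq, not_not,
    Function.mem_support] at hn
  exact hk (by simp [hamiltonian, hn.1, hn.2.1, hn.2.2])

theorem mem_testSpace_of_finite (S : ConfiningSchrodinger n) {φ : (Fin n → ℤ) → ℂ}
    (h : φ.support.Finite) : φ ∈ testSpace S := by
  intro j
  have key : ((((1 + hamiltonian S) ^ j) φ).support).Finite := by
    induction j with
    | zero => simpa using h
    | succ j ih =>
      rw [pow_succ']
      refine (ih.union (hamiltonian_finite S ih)).subset ?_
      exact Function.support_add _ _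
  exact (memℓp_zero key).of_exponent_ge zero_le

/-- The function that is `1` at the lattice point `k` and `0` elsewhere, as a test function. -/
noncomputable def delta (S : ConfiningSchrodinger n) (k : Fin n → ℤ) : testSpace S :=
  ⟨Pi.single k 1, mem_testSpace_of_finite S
    ((Set.finite_singleton k).subset Pi.support_single_subset)⟩

/-- The value `w(k)` of a distribution at a lattice point. -/
noncomputable def HDistribution.value {S : ConfiningSchrodinger n} (w : HDistribution S)
    (k : Fin n → ℤ) : ℂ := w (delta S k)

/-- An eigenfunction as a test function. -/
noncomputable def eigenTest (S : ConfiningSchrodinger n) (i : EigenIndex S) : testSpace S :=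
  ⟨eigenbasis S i, fun j => by
    have key : ((1 + hamiltonian S) ^ j) (eigenbasis S i : (Fin n → ℤ) → ℂ) =
        ((1 + eigenvalue S i : ℂ) ^ j) • (eigenbasis S i : (Fin n → ℤ) → ℂ) := by
      induction j with
      | zero => simp
      | succ j ih =>
        rw [pow_succ', Module.End.mul_apply, ih, map_smul, LinearMap.add_apply,
          hamiltonian_eigenbasis, Module.End.one_apply, pow_succ]
        module
    rw [key]
    exact (eigenbasis S i).2.const_smul _⟩

/-- The Schrödinger operator on test functions. It acts on distributions by `(H w)(φ) = w(H φ)`. -/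
noncomputable def hamiltonianTest (S : ConfiningSchrodinger n) (φ : testSpace S) : testSpace S :=
  ⟨hamiltonian S φ, fun j => by
    have key : ((1 + hamiltonian S) ^ j) (hamiltonian S φ) =
        ((1 + hamiltonian S) ^ (j + 1)) (φ : (Fin n → ℤ) → ℂ)
          - ((1 + hamiltonian S) ^ j) (φ : (Fin n → ℤ) → ℂ) := by
      rw [pow_succ, Module.End.mul_apply, ← map_sub]
      simp
    rw [key]
    exact (φ.2 (j + 1)).sub (φ.2 j)⟩

/-! ### Sobolev spaces -/

/-- The Sobolev norm `‖(I + H)^{s/2} w‖_{ℓ²} = (∑_ξ (1 + λ_ξ)^s |ŵ(ξ)|²)^{1/2}`, where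
`ŵ(ξ) = (w, u_ξ)`, as an extended real; `w` belongs to the Sobolev space of order `s` if and only
if it is finite. -/
noncomputable def sobolevNorm {S : ConfiningSchrodinger n} (s : ℝ) (w : HDistribution S) : ℝ≥0∞ :=
  (∑' i, ENNReal.ofReal ((1 + eigenvalue S i) ^ s) * ‖w (eigenTest S i)‖ₑ ^ 2) ^ (1 / 2 : ℝ)

/-- `w ∈ H^s` -/
def MemSobolev {S : ConfiningSchrodinger n} (s : ℝ) (w : HDistribution S) : Prop :=
  sobolevNorm s w < ∞

/-- The norm of `L²([0, T]; H^s)`. -/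
noncomputable def l2SobolevNorm {S : ConfiningSchrodinger n} (T s : ℝ) (u : ℝ → HDistribution S) :
    ℝ≥0∞ :=
  (∫⁻ t in Set.Icc 0 T, sobolevNorm s (u t) ^ 2) ^ (1 / 2 : ℝ)

/-- `u ∈ L²([0, T]; H^s)`. Measurability is weak measurability, which is the same as strong
measurability because `H^s` is separable. -/
def MemL2Sobolev {S : ConfiningSchrodinger n} (T s : ℝ) (u : ℝ → HDistribution S) : Prop :=
  (∀ φ : testSpace S, MeasureTheory.AEStronglyMeasurable (fun t => u t φ)
    (MeasureTheory.volume.restrict (Set.Icc 0 T))) ∧ l2SobolevNorm T s u < ∞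

/-! ### Moderate nets

A net is a function of `ε : ℝ` of which only the values for `ε ∈ (0, 1]` matter. -/

/-- `L²([0, T]; H^s)`-moderate nets. -/
def IsL2Moderate {S : ConfiningSchrodinger n} (T s : ℝ) (u : ℝ → ℝ → HDistribution S) : Prop :=
  (∀ ε ∈ Set.Ioc (0 : ℝ) 1, MemL2Sobolev T s (u ε)) ∧
    ∃ (N : ℕ) (c : ℝ), 0 < c ∧ ∀ ε ∈ Set.Ioc (0 : ℝ) 1,
      l2SobolevNorm T s (u ε) ≤ ENNReal.ofReal (c * (ε ^ N)⁻¹)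

/-- `g ∈ L^∞_m(ℝ)`: `g` is `m` times differentiable and `g, g', …, g^{(m)}` are in `L^∞`. -/
def MemLinfty (m : ℕ) (g : ℝ → ℝ) : Prop :=
  (∀ j < m, Differentiable ℝ (iteratedDeriv j g)) ∧
    ∀ j ≤ m, MeasureTheory.MemLp (iteratedDeriv j g) ∞ MeasureTheory.volume

/-- `L^∞_m`-moderate nets. -/
def IsLinftyModerate (m : ℕ) (g : ℝ → ℝ → ℝ) : Prop :=
  (∀ ε ∈ Set.Ioc (0 : ℝ) 1, MemLinfty m (g ε)) ∧
    ∀ K : Set ℝ, IsCompact K → ∃ (N : ℕ) (c : ℝ), 0 < c ∧ ∀ j ≤ m, ∀ ε ∈ Set.Ioc (0 : ℝ) 1,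
      MeasureTheory.eLpNorm (iteratedDeriv j (g ε)) ∞ (MeasureTheory.volume.restrict K)
        ≤ ENNReal.ofReal (c * (ε ^ (N + j))⁻¹)

/-! ### Regularisation of distributions on the real line by mollification -/

/-- The function `τ ↦ ψ_ω(t - τ)`, where `ψ_ω(x) = ω⁻¹ ψ(x / ω)`, as a test function. -/
noncomputable def mollifierAt (ψ : 𝓓((⊤ : TopologicalSpace.Opens ℝ), ℝ)) (ω t : ℝ) :
    𝓓((⊤ : TopologicalSpace.Opens ℝ), ℝ) where
  toFun τ := ω⁻¹ * ψ ((t - τ) / ω)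
  contDiff' := by
    have h := ψ.contDiff
    exact contDiff_const.mul (h.comp ((contDiff_const.sub contDiff_id).div_const ω))
  hasCompactSupport' := by
    by_cases hω : ω = 0
    · have h : (fun τ : ℝ => ω⁻¹ * ψ ((t - τ) / ω)) = 0 := by
        funext τ
        simp [hω]
      rw [h]
      exact HasCompactSupport.zero
    · refine HasCompactSupport.mul_left ?_
      have h := ψ.hasCompactSupport.comp_homeomorph
        ((Homeomorph.subLeft t).trans (Homeomorph.mulRight₀ ω⁻¹ (inv_ne_zero hω)))
      simpa [Function.comp_def, div_eq_mul_inv] using h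
  tsupport_subset' := Set.subset_univ _

/-- `(A * ψ_ω)(t) = ⟨A, ψ_ω(t - ·)⟩` -/
noncomputable def mollify {F : Type} [NormedAddCommGroup F] [NormedSpace ℝ F]
    (A : 𝓓'((⊤ : TopologicalSpace.Opens ℝ), F)) (ψ : 𝓓((⊤ : TopologicalSpace.Opens ℝ), ℝ))
    (ω t : ℝ) : F := A (mollifierAt ψ ω t)

/-- The net `g` is a regularisation of the distribution `A`: `g_ε = A * ψ_{ω(ε)}` for a Friedrichs
mollifier `ψ` and a scale `ω(ε) > 0` with `ω(ε) → 0` as `ε → 0`. -/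
def IsRegularisation {F : Type} [NormedAddCommGroup F] [NormedSpace ℝ F]
    (A : 𝓓'((⊤ : TopologicalSpace.Opens ℝ), F)) (g : ℝ → ℝ → F) : Prop :=
  ∃ ψ : 𝓓((⊤ : TopologicalSpace.Opens ℝ), ℝ), (∀ x, 0 ≤ ψ x) ∧ ∫ x, ψ x = 1 ∧
    ∃ ω : ℝ → ℝ, (∀ ε ∈ Set.Ioc (0 : ℝ) 1, 0 < ω ε) ∧
      Filter.Tendsto ω (nhdsWithin 0 (Set.Ioi 0)) (nhds 0) ∧
      ∀ ε ∈ Set.Ioc (0 : ℝ) 1, ∀ t, g ε t = mollify A ψ (ω ε) t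

/-- The net `fε` is an `L²([0, T]; H^s)`-moderate regularisation of the source `f`: it is moderate,
and at every lattice point `k` it is a regularisation of the distribution `f(·, k)`. -/
def IsModerateSourceRegularisation {S : ConfiningSchrodinger n} (T s : ℝ)
    (f : (Fin n → ℤ) → 𝓓'((⊤ : TopologicalSpace.Opens ℝ), ℂ))
    (fε : ℝ → ℝ → HDistribution S) : Prop :=
  (∀ k, IsRegularisation (f k) fun ε t => (fε ε t).value k) ∧ IsL2Moderate T s fε

/-! ### The Cauchy problem and its very weak solutions -/

/-- `u` solves `∂ₜ²u + a(t) H u + q(t) u = f`, `u(0) = u₀`, `∂ₜu(0) = u₁` on `[0, T]`. Here `v` is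
`∂ₜu`. The equation holds at every lattice point, in the classical sense, and, integrated in time,
when it is tested against an arbitrary test function. -/
def IsSolution {S : ConfiningSchrodinger n} (T : ℝ) (a q : ℝ → ℝ) (f : ℝ → HDistribution S)
    (u₀ u₁ : HDistribution S) (u : ℝ → HDistribution S) : Prop :=
  u 0 = u₀ ∧ ∃ v : ℝ → HDistribution S, v 0 = u₁ ∧
    (∀ φ : testSpace S, ∀ t ∈ Set.Icc 0 T,
      HasDerivWithinAt (fun τ => u τ φ) (v t φ) (Set.Icc 0 T) t) ∧
    (∀ k, ∀ t ∈ Set.Ioc 0 T,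
      HasDerivWithinAt (fun τ => (v τ).value k)
        ((f t).value k - a t * hamiltonian S (u t).value k - q t * (u t).value k)
        (Set.Icc 0 T) t) ∧
    ∀ φ : testSpace S, ∀ t ∈ Set.Icc 0 T,
      v t φ = u₁ φ + ∫ τ in (0 : ℝ)..t, (f τ φ - a τ * u τ (hamiltonianTest S φ) - q τ * u τ φ)

/-- `u` is a very weak solution of order `s`, with the net `fε` as the regularised source. -/
def IsVeryWeakSolutionWith {S : ConfiningSchrodinger n} (T s : ℝ)
    (a q : 𝓓'((⊤ : TopologicalSpace.Opens ℝ), ℝ)) (fε : ℝ → ℝ → HDistribution S)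
    (u₀ u₁ : HDistribution S) (u : ℝ → ℝ → HDistribution S) : Prop :=
  ∃ aε qε : ℝ → ℝ → ℝ,
    (IsRegularisation a aε ∧ IsLinftyModerate 1 aε) ∧
    (IsRegularisation q qε ∧ IsLinftyModerate 0 qε) ∧
    (∀ ε ∈ Set.Ioc (0 : ℝ) 1, IsSolution T (aε ε) (qε ε) (fε ε) u₀ u₁ (u ε)) ∧
    IsL2Moderate T (1 + s) u

/-- `u` is a very weak solution of order `s` of the Cauchy problem with distributional coefficients
`a`, `q` and distributional source `f`. -/
def IsVeryWeakSolution {S : ConfiningSchrodinger n} (T s : ℝ)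
    (a q : 𝓓'((⊤ : TopologicalSpace.Opens ℝ), ℝ))
    (f : (Fin n → ℤ) → 𝓓'((⊤ : TopologicalSpace.Opens ℝ), ℂ))
    (u₀ u₁ : HDistribution S) (u : ℝ → ℝ → HDistribution S) : Prop :=
  ∃ fε : ℝ → ℝ → HDistribution S, IsModerateSourceRegularisation T s f fε ∧
    IsVeryWeakSolutionWith T s a q fε u₀ u₁ u

end LatticeWave

/-!
Very weak solutions exist because the energy estimate for a regular coefficient `a_ε` loses only a
factor `exp (C (1 + ‖a_ε‖ + ‖a_ε'‖ + ‖q_ε‖))`. If the coefficients are mollified at a scale so slow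
that these norms grow like `log (1 / ε)`, this factor is bounded by a power of `ε⁻¹`.

* A distribution with support in `[0, T]` is of finite order, so its mollification at scale `ω`
  grows at most like a power of `ω⁻¹` (`exists_bound_mollify`), and the scale can be chosen to make
  the growth logarithmic (`exists_coefficient_regularisation`). An even mollifier preserves the
  positivity of `a` up to the end points of `[0, T]` with half of the constant (`half_le_mollify`).
* For fixed `ε` the Cauchy problem decouples in the eigenbasis of the Schrödinger operator. Each
  mode solves `y'' + (a λ + q) y = g`, and the energy `|y'|² + a (1 + λ) |y|²` is estimated uniformly
  in `λ` (`exists_mode`). The modes sum to a solution in `H^(1 + s)` (`exists_solution`), since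
  coefficients with a finite norm in some `H^s` are those of exactly one distribution, whose action
  on a test function is given by the eigenfunction expansion (`exists_distribution_of_coeff`,
  `hasSum_eigenTest`).
* A moderate regularisation of an arbitrary source exists (`exists_source_regularisation`), although
  the orders of the distributions `f(·, k)` need not be bounded in `k`: the scale of mollification
  may depend on `k`, and can be chosen to make the regularised source as small as desired at
  infinity, uniformly in `t` and up to a factor `ε⁻¹`.
-/

namespace LatticeWave

open MeasureTheory Set Distribution

/-! ### The Cauchy problem for a single mode -/

/-- The equation `z' = -c y`, `y' = z + G` with continuous coefficients has a solution on all of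
`[0, T]`. The Picard–Lindelöf theorem is applied to the vector field truncated at the a priori bound
that Grönwall's inequality gives; the truncation is then inactive. -/
theorem exists_forced_oscillator {T : ℝ} (hT : 0 < T) {c G : ℝ → ℝ}
    (hc : ContinuousOn c (Icc 0 T)) (hG : ContinuousOn G (Icc 0 T)) (y₀ z₀ : ℝ) :
    ∃ y z : ℝ → ℝ, y 0 = y₀ ∧ z 0 = z₀ ∧
      (∀ t ∈ Icc 0 T, HasDerivWithinAt y (z t + G t) (Icc 0 T) t) ∧
      ∀ t ∈ Icc 0 T, HasDerivWithinAt z (-(c t * y t)) (Icc 0 T) t := by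
  obtain ⟨M, hM⟩ := isCompact_Icc.exists_bound_of_continuousOn hc
  obtain ⟨g, hg⟩ := isCompact_Icc.exists_bound_of_continuousOn hG
  have h0 : (0 : ℝ) ∈ Icc 0 T := ⟨le_rfl, hT.le⟩
  have hM0 : 0 ≤ M := (norm_nonneg _).trans (hM 0 h0)
  have hg0 : 0 ≤ g := (norm_nonneg _).trans (hg 0 h0)
  set K : ℝ := 1 + M with hK
  have hK0 : 0 ≤ K := by positivity
  set R : ℝ := gronwallBound ‖(y₀, z₀)‖ K g T with hR
  have hRmono := gronwallBound_mono (norm_nonneg (y₀, z₀)) hg0 hK0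
  have hR0 : 0 ≤ R := by
    have h := hRmono hT.le
    rw [gronwallBound_x0] at h
    exact (norm_nonneg _).trans h
  -- truncating the unknowns at the a priori bound `R` makes the vector field bounded
  set ρ : ℝ → ℝ := fun x => max (-R) (min R x) with hρ
  have hρl : LipschitzWith 1 ρ := (LipschitzWith.id.const_min R).const_max (-R)
  have hρR : ∀ x, |ρ x| ≤ R := fun x => by
    rw [abs_le]
    exact ⟨le_max_left _ _, max_le (by linarith) (min_le_left _ _)⟩
  have hρx : ∀ x, |ρ x| ≤ |x| := fun x => by
    have := hρl.dist_le_mul x 0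
    have h00 : ρ 0 = 0 := by simp [hρ, hR0]
    simpa [h00, Real.dist_eq] using this
  have hρe : ∀ x, |x| ≤ R → ρ x = x := fun x hx => by
    rw [abs_le] at hx
    simp [hρ, hx.1, hx.2]
  set f : ℝ → ℝ × ℝ → ℝ × ℝ := fun t x => (ρ x.2 + G t, -(c t * ρ x.1)) with hf
  have hfb : ∀ t ∈ Icc 0 T, ∀ x, ‖f t x‖ ≤ K * R + g := by
    intro t ht x
    rw [hf, Prod.norm_def]
    refine max_le ?_ ?_
    · refine (norm_add_le _ _).trans ?_
      have h1 := hρR x.2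
      have h2 := hg t ht
      rw [Real.norm_eq_abs]
      nlinarith
    · have h1 := hρR x.1
      have h2 := hM t ht
      rw [norm_neg, norm_mul, Real.norm_eq_abs (ρ _)]
      nlinarith [mul_le_mul h2 h1 (abs_nonneg _) hM0]
  have hPL : IsPicardLindelof f (tmin := 0) (tmax := T) ⟨0, h0⟩ (y₀, z₀)
      ((K * R + g) * T).toNNReal 0 (K * R + g).toNNReal K.toNNReal := by
    refine ⟨fun t ht => ?_, fun x _ => ?_, fun t ht x _ => ?_, ?_⟩
    · refine LipschitzOnWith.of_dist_le_mul fun x _ x' _ => ?_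
      rw [Real.coe_toNNReal _ hK0]
      have h1 := hρl.dist_le_mul x.1 x'.1
      have h2 := hρl.dist_le_mul x.2 x'.2
      have h3 : dist x.1 x'.1 ≤ dist x x' := le_max_left _ _
      have h4 : dist x.2 x'.2 ≤ dist x x' := le_max_right _ _
      have h5 := hM t ht
      have h6 : 0 ≤ dist x x' := dist_nonneg
      simp only [NNReal.coe_one, one_mul] at h1 h2
      refine max_le ?_ ?_
      · simp only [hf, dist_add_right]
        nlinarith
      · simp only [hf, dist_neg_neg]
        rw [dist_eq_norm, ← mul_sub, norm_mul, ← dist_eq_norm]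
        have := mul_le_mul h5 (h1.trans h3) dist_nonneg hM0
        nlinarith
    · simp only [hf]
      fun_prop
    · rw [Real.coe_toNNReal _ (by positivity)]
      exact hfb t ht x
    · rw [Real.coe_toNNReal _ (by positivity), Real.coe_toNNReal _ (by positivity)]
      simp [hT.le]
  obtain ⟨x, hx0, hx⟩ := hPL.exists_eq_forall_mem_Icc_hasDerivWithinAt₀
  have hx0' : x 0 = (y₀, z₀) := hx0
  have hfx : ∀ t ∈ Icc 0 T, ∀ x, ‖f t x‖ ≤ K * ‖x‖ + g := by
    intro t ht x
    rw [hf, Prod.norm_def]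
    have h3 : |x.1| ≤ ‖x‖ := norm_fst_le x
    have h4 : |x.2| ≤ ‖x‖ := norm_snd_le x
    refine max_le ?_ ?_
    · refine (norm_add_le _ _).trans ?_
      have h1 := hρx x.2
      have h2 := hg t ht
      rw [Real.norm_eq_abs]
      nlinarith [norm_nonneg x]
    · have h1 := hρx x.1
      have h2 := hM t ht
      rw [norm_neg, norm_mul, Real.norm_eq_abs (ρ _)]
      nlinarith [mul_le_mul h2 (h1.trans h3) (abs_nonneg _) hM0, norm_nonneg x]
  have hxR : ∀ t ∈ Icc 0 T, ‖x t‖ ≤ R := by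
    intro t ht
    have h := norm_le_gronwallBound_of_norm_deriv_right_le (f := x) (f' := fun t => f t (x t))
      (δ := ‖(y₀, z₀)‖) (K := K) (ε := g) (a := 0) (b := T)
      (fun t ht => (hx t ht).continuousWithinAt)
      (fun t ht => ((hx t ⟨ht.1, ht.2.le⟩).mono_of_mem_nhdsWithin
        (Icc_mem_nhdsGE_of_mem ht))) (by rw [hx0'])
      (fun t ht => hfx t ⟨ht.1, ht.2.le⟩ _) t ht
    rw [sub_zero] at h
    exact h.trans (hRmono ht.2)
  refine ⟨fun t => (x t).1, fun t => (x t).2, by simp [hx0'], by simp [hx0'], fun t ht => ?_,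
    fun t ht => ?_⟩
  · have h := (hasFDerivAt_fst (𝕜 := ℝ) (p := x t)).comp_hasDerivWithinAt t (hx t ht)
    have h2 : ρ (x t).2 = (x t).2 := hρe _ ((norm_snd_le _).trans (hxR t ht))
    simpa [hf, h2, Function.comp_def] using h
  · have h := (hasFDerivAt_snd (𝕜 := ℝ) (p := x t)).comp_hasDerivWithinAt t (hx t ht)
    have h2 : ρ (x t).1 = (x t).1 := hρe _ ((norm_fst_le _).trans (hxR t ht))
    simpa [hf, h2, Function.comp_def] using h

theorem absolutelyContinuousOnInterval_of_hasDerivWithinAt {T C : ℝ} (hT : 0 ≤ T) {f f' : ℝ → ℝ}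
    (h : ∀ t ∈ Icc 0 T, HasDerivWithinAt f (f' t) (Icc 0 T) t) (hb : ∀ t ∈ Icc 0 T, |f' t| ≤ C) :
    AbsolutelyContinuousOnInterval f 0 T := by
  have hC : 0 ≤ C := (abs_nonneg _).trans (hb 0 ⟨le_rfl, hT⟩)
  refine LipschitzOnWith.absolutelyContinuousOnInterval (K := C.toNNReal) ?_
  rw [uIcc_of_le hT]
  refine (convex_Icc 0 T).lipschitzOnWith_of_nnnorm_hasDerivWithin_le h fun t ht => ?_
  rw [← NNReal.coe_le_coe, Real.coe_toNNReal _ hC]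
  exact hb t ht

/-- The Cauchy problem `y'' + (a λ + q) y = g` for one real mode, with the energy estimate for
`|y'|² + a (1 + λ) |y|²`. The constant does not depend on `λ`, because in the derivative of the
energy `λ` occurs only in `a' (1 + λ) |y|²`, which the energy controls. As `g` is only square
integrable, `y'` is an absolutely continuous function that satisfies the integrated equation. -/
theorem exists_mode_of_real {T α M lam : ℝ} (hT : 0 < T) (hα : 0 < α) (hlam : 0 ≤ lam)
    {a a' q g : ℝ → ℝ} (ha : ∀ t, HasDerivAt a (a' t) t) (hq : Continuous q)
    (haα : ∀ t ∈ Icc 0 T, α ≤ a t) (haq : ∀ t ∈ Icc 0 T, |a t - q t| ≤ M)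
    (ha' : ∀ t ∈ Icc 0 T, |a' t| ≤ M)
    (hg : IntervalIntegrable g volume 0 T) (hg2 : IntervalIntegrable (fun t => g t ^ 2) volume 0 T)
    (y₀ v₀ : ℝ) :
    ∃ y v : ℝ → ℝ, y 0 = y₀ ∧ v 0 = v₀ ∧ ContinuousOn v (Icc 0 T) ∧
      (∀ t ∈ Icc 0 T, HasDerivWithinAt y (v t) (Icc 0 T) t) ∧
      (∀ t ∈ Icc 0 T, v t = v₀ + ∫ τ in (0 : ℝ)..t, (g τ - (a τ * lam + q τ) * y τ)) ∧
      ∀ t ∈ Icc 0 T, v t ^ 2 + a t * (1 + lam) * y t ^ 2 ≤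
        Real.exp ((1 + M + 2 * M / α) * T) *
          (v₀ ^ 2 + a 0 * (1 + lam) * y₀ ^ 2 + ∫ τ in (0 : ℝ)..T, g τ ^ 2) := by
  have h0 : (0 : ℝ) ∈ Icc 0 T := ⟨le_rfl, hT.le⟩
  have hM : 0 ≤ M := (abs_nonneg _).trans (ha' 0 h0)
  have hac : Continuous a := continuous_iff_continuousAt.2 fun t => (ha t).continuousAt
  set G : ℝ → ℝ := fun t => ∫ τ in (0 : ℝ)..t, g τ with hGdef
  have hGac : AbsolutelyContinuousOnInterval G 0 T :=
    hg.absolutelyContinuousOnInterval_intervalIntegral (by simp [hT.le])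
  have hG : ContinuousOn G (Icc 0 T) := by
    have := hGac.continuousOn
    rwa [uIcc_of_le hT.le] at this
  set c : ℝ → ℝ := fun t => a t * lam + q t with hcdef
  have hc : Continuous c := by fun_prop
  -- with `v = z + G` the equation for `z` has continuous coefficients
  obtain ⟨y, z, hy0, hz0, hy, hz⟩ := exists_forced_oscillator hT hc.continuousOn hG y₀ v₀
  have hyc : ContinuousOn y (Icc 0 T) := fun t ht => (hy t ht).continuousWithinAt
  have hzc : ContinuousOn z (Icc 0 T) := fun t ht => (hz t ht).continuousWithinAt
  set v : ℝ → ℝ := fun t => z t + G t with hv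
  have hvc : ContinuousOn v (Icc 0 T) := hzc.add hG
  have hv0 : v 0 = v₀ := by simp [hv, hz0, hGdef]
  obtain ⟨Cv, hCv⟩ := isCompact_Icc.exists_bound_of_continuousOn hvc
  obtain ⟨Cz, hCz⟩ := isCompact_Icc.exists_bound_of_continuousOn
    (hc.continuousOn.mul hyc).neg
  have hyac := absolutelyContinuousOnInterval_of_hasDerivWithinAt hT.le hy hCv
  have hzac := absolutelyContinuousOnInterval_of_hasDerivWithinAt hT.le hz hCz
  have haac := absolutelyContinuousOnInterval_of_hasDerivWithinAt hT.le
    (fun t _ => (ha t).hasDerivWithinAt) ha'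
  set B : ℝ := 1 + M + 2 * M / α with hB
  have hB0 : 0 ≤ B := by positivity
  have hexp : ∀ t, HasDerivAt (fun t => Real.exp (-(B * t))) (-B * Real.exp (-(B * t))) t := by
    intro t
    have := (((hasDerivAt_id t).const_mul B).neg).exp
    simpa [mul_comm] using this
  have hexp1 : ∀ t ∈ Icc 0 T, Real.exp (-(B * t)) ≤ 1 := fun t ht =>
    Real.exp_le_one_iff.2 (neg_nonpos.2 (mul_nonneg hB0 ht.1))
  have heac : AbsolutelyContinuousOnInterval (fun t => Real.exp (-(B * t))) 0 T := by
    refine absolutelyContinuousOnInterval_of_hasDerivWithinAt hT.le (C := B)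
      (fun t _ => (hexp t).hasDerivWithinAt) fun t ht => ?_
    rw [abs_mul, abs_neg, abs_of_nonneg hB0, abs_of_pos (Real.exp_pos _)]
    exact mul_le_of_le_one_right hB0 (hexp1 t ht)
  have hvac : AbsolutelyContinuousOnInterval v 0 T := hzac.add hGac
  -- the energy, damped so that its derivative is at most `g ^ 2`
  set P : ℝ → ℝ := fun t =>
    Real.exp (-(B * t)) * (v t * v t + (1 + lam) * (a t * (y t * y t))) with hP
  have hPac : AbsolutelyContinuousOnInterval P 0 T :=
    heac.fun_mul ((hvac.fun_mul hvac).fun_add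
      ((haac.fun_mul (hyac.fun_mul hyac)).const_mul (1 + lam)))
  have hkey : ∀ᵐ t, t ∈ Ioo 0 T → deriv P t ≤ g t ^ 2 := by
    filter_upwards [hg.ae_hasDerivAt_integral] with t hgt ht
    have htI : t ∈ Icc 0 T := Ioo_subset_Icc_self ht
    have hn : Icc 0 T ∈ nhds t := Icc_mem_nhds ht.1 ht.2
    have hGt := hgt (by rwa [uIcc_of_le hT.le]) 0 (by simp [hT.le])
    have hyt : HasDerivAt y (v t) t := (hy t htI).hasDerivAt hn
    have hvt : HasDerivAt v (-(c t * y t) + g t) t := ((hz t htI).hasDerivAt hn).add hGt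
    have hPt := (hexp t).mul ((hvt.mul hvt).add
      (((ha t).mul (hyt.mul hyt)).const_mul (1 + lam)))
    have hPt' : HasDerivAt P _ t := hPt
    rw [hPt'.deriv]
    have h1 : |a' t| * α ≤ M * a t := mul_le_mul (ha' t htI) (haα t htI) hα.le hM
    set Y := y t
    set W := v t
    have e2 := haα t htI
    have hY : Y * Y ≤ a t * (1 + lam) * (Y * Y) / α := by
      rw [le_div_iff₀ hα]
      have : α ≤ a t * (1 + lam) := by nlinarith
      nlinarith [mul_self_nonneg Y]
    have e3 : a' t * (1 + lam) * (Y * Y) ≤ M / α * (a t * (1 + lam) * (Y * Y)) := by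
      have : a' t ≤ M / α * a t := by
        rw [div_mul_eq_mul_div, le_div_iff₀ hα]
        exact (mul_le_mul_of_nonneg_right (le_abs_self _) hα.le).trans h1
      have h3 : 0 ≤ (1 + lam) * (Y * Y) := mul_nonneg (by linarith) (mul_self_nonneg _)
      nlinarith
    have e4 : 2 * (a t - q t) * Y * W ≤ M * (Y * Y + W * W) := by
      have h5 := haq t htI
      rw [abs_le] at h5
      nlinarith [sq_nonneg (Y + W), sq_nonneg (Y - W)]
    have e5 : M * (Y * Y) ≤ M / α * (a t * (1 + lam) * (Y * Y)) := by
      have := mul_le_mul_of_nonneg_left hY hM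
      calc _ ≤ _ := this
        _ = _ := by ring
    have e6 : 2 * W * g t ≤ W * W + g t ^ 2 := by nlinarith [sq_nonneg (W - g t)]
    have e7 : 0 ≤ M * (a t * (1 + lam) * (Y * Y)) :=
      mul_nonneg hM (mul_nonneg (mul_nonneg (hα.le.trans e2) (by linarith)) (mul_self_nonneg _))
    have e8 : 0 ≤ M / α * (W * W) := mul_nonneg (by positivity) (mul_self_nonneg W)
    have e9 : 0 ≤ a t * (1 + lam) * (Y * Y) :=
      mul_nonneg (mul_nonneg (hα.le.trans e2) (by linarith)) (mul_self_nonneg _)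
    have hmain : -B * (W * W + (1 + lam) * (a t * (Y * Y))) + ((-(c t * Y) + g t) * W +
        W * (-(c t * Y) + g t) + (1 + lam) * (a' t * (Y * Y) + a t * (W * Y + Y * W)))
          ≤ g t ^ 2 := by
      have hBe : B = 1 + M + 2 * (M / α) := by rw [hB]; ring
      rw [hBe]
      simp only [hcdef]
      nlinarith
    calc _ = Real.exp (-(B * t)) * (-B * (W * W + (1 + lam) * (a t * (Y * Y))) +
          ((-(c t * Y) + g t) * W + W * (-(c t * Y) + g t) +
            (1 + lam) * (a' t * (Y * Y) + a t * (W * Y + Y * W)))) := by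
          simp only [Pi.mul_apply, Pi.add_apply]; ring
      _ ≤ Real.exp (-(B * t)) * g t ^ 2 := mul_le_mul_of_nonneg_left hmain (Real.exp_pos _).le
      _ ≤ g t ^ 2 := mul_le_of_le_one_left (sq_nonneg _) (hexp1 t htI)
  have hPle : ∀ t ∈ Icc 0 T, P t ≤ P 0 + ∫ τ in (0 : ℝ)..T, g τ ^ 2 := by
    intro t ht
    have hsub : uIcc 0 t ⊆ uIcc 0 T := by
      rw [uIcc_of_le hT.le, uIcc_of_le ht.1]; exact Icc_subset_Icc_right ht.2
    have hPt := hPac.mono hsub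
    have h1 := hPt.integral_deriv_eq_sub
    have h2 : ∫ τ in (0 : ℝ)..t, deriv P τ ≤ ∫ τ in (0 : ℝ)..t, g τ ^ 2 := by
      refine intervalIntegral.integral_mono_ae_restrict ht.1 hPt.intervalIntegrable_deriv
        (hg2.mono_set hsub) ?_
      have h3 : ∀ᵐ τ : ℝ, τ ≠ 0 ∧ τ ≠ t := by
        have h0' : ∀ᵐ τ : ℝ, τ ≠ 0 := by simp [ae_iff, measure_singleton]
        have ht' : ∀ᵐ τ : ℝ, τ ≠ t := by simp [ae_iff, measure_singleton]
        exact h0'.and ht'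
      rw [Filter.EventuallyLE, ae_restrict_iff' measurableSet_Icc]
      filter_upwards [hkey, h3] with τ hτ hτ' hτI
      exact hτ ⟨lt_of_le_of_ne hτI.1 hτ'.1.symm, (lt_of_le_of_ne hτI.2 hτ'.2).trans_le ht.2⟩
    have h4 : ∫ τ in (0 : ℝ)..t, g τ ^ 2 ≤ ∫ τ in (0 : ℝ)..T, g τ ^ 2 :=
      intervalIntegral.integral_mono_interval le_rfl ht.1 ht.2
        (Filter.Eventually.of_forall fun τ => sq_nonneg _) hg2
    linarith
  refine ⟨y, v, hy0, hv0, hvc, hy, fun t ht => ?_, fun t ht => ?_⟩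
  · have hsub : uIcc 0 t ⊆ uIcc 0 T := by
      rw [uIcc_of_le hT.le, uIcc_of_le ht.1]; exact Icc_subset_Icc_right ht.2
    have hint : IntervalIntegrable (fun τ => -(c τ * y τ)) volume 0 t := by
      refine ContinuousOn.intervalIntegrable ?_
      rw [uIcc_of_le ht.1]
      exact (hc.continuousOn.mul (hyc.mono (Icc_subset_Icc_right ht.2))).neg
    have h1 : ∫ τ in (0 : ℝ)..t, -(c τ * y τ) = z t - z 0 := by
      refine intervalIntegral.integral_eq_sub_of_hasDerivAt_of_le ht.1
        (hzc.mono (Icc_subset_Icc_right ht.2)) (fun τ hτ => ?_) hint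
      exact (hz τ ⟨hτ.1.le, hτ.2.le.trans ht.2⟩).hasDerivAt
        (Icc_mem_nhds hτ.1 (hτ.2.trans_le ht.2))
    have h2 : ∫ τ in (0 : ℝ)..t, (g τ - (a τ * lam + q τ) * y τ) =
        G t + ∫ τ in (0 : ℝ)..t, -(c τ * y τ) := by
      rw [hGdef, ← intervalIntegral.integral_add (hg.mono_set hsub) hint]
      refine intervalIntegral.integral_congr fun τ _ => ?_
      simp only [hcdef]; ring
    rw [h2, h1, hz0]
    simp only [hv]; ring
  · have h1 := hPle t ht
    have h2 : v t ^ 2 + a t * (1 + lam) * y t ^ 2 = Real.exp (B * t) * P t := by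
      simp only [hP]
      rw [← mul_assoc, ← Real.exp_add]
      simp; ring
    have h3 : P 0 = v₀ ^ 2 + a 0 * (1 + lam) * y₀ ^ 2 := by
      simp only [hP, hv0, hy0]; simp; ring
    rw [h2, ← h3]
    have h4 : 0 ≤ P 0 + ∫ τ in (0 : ℝ)..T, g τ ^ 2 := by
      rw [h3]
      have : 0 ≤ ∫ τ in (0 : ℝ)..T, g τ ^ 2 :=
        intervalIntegral.integral_nonneg hT.le fun τ _ => sq_nonneg _
      have := hα.le.trans (haα 0 h0)
      positivity
    exact (mul_le_mul_of_nonneg_left h1 (Real.exp_pos _).le).trans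
      (mul_le_mul_of_nonneg_right (Real.exp_le_exp.2 (mul_le_mul_of_nonneg_left ht.2 hB0)) h4)

theorem intervalIntegrable_of_memLp_two {E : Type*} [NormedAddCommGroup E] {T : ℝ} (hT : 0 ≤ T)
    {g : ℝ → E} (hg : MemLp g 2 (volume.restrict (Icc 0 T))) :
    IntervalIntegrable g volume 0 T ∧ IntervalIntegrable (fun t => ‖g t‖ ^ 2) volume 0 T := by
  constructor
  · rw [intervalIntegrable_iff_integrableOn_Icc_of_le hT]
    exact hg.integrable one_le_two
  · rw [intervalIntegrable_iff_integrableOn_Icc_of_le hT]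
    exact hg.integrable_norm_pow two_ne_zero

/-- The complex version of `exists_mode_of_real`, applied to real and imaginary parts. -/
theorem exists_mode {T α M lam : ℝ} (hT : 0 < T) (hα : 0 < α) (hlam : 0 ≤ lam)
    {a a' q : ℝ → ℝ} {g : ℝ → ℂ} (ha : ∀ t, HasDerivAt a (a' t) t) (hq : Continuous q)
    (haα : ∀ t ∈ Icc 0 T, α ≤ a t) (haq : ∀ t ∈ Icc 0 T, |a t - q t| ≤ M)
    (ha' : ∀ t ∈ Icc 0 T, |a' t| ≤ M) (hg : MemLp g 2 (volume.restrict (Icc 0 T))) (y₀ v₀ : ℂ) :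
    ∃ y v : ℝ → ℂ, y 0 = y₀ ∧ v 0 = v₀ ∧ ContinuousOn v (Icc 0 T) ∧
      (∀ t ∈ Icc 0 T, HasDerivWithinAt y (v t) (Icc 0 T) t) ∧
      (∀ t ∈ Icc 0 T, v t = v₀ + ∫ τ in (0 : ℝ)..t, (g τ - (a τ * lam + q τ) * y τ)) ∧
      ∀ t ∈ Icc 0 T, ‖v t‖ ^ 2 + a t * (1 + lam) * ‖y t‖ ^ 2 ≤
        Real.exp ((1 + M + 2 * M / α) * T) *
          (‖v₀‖ ^ 2 + a 0 * (1 + lam) * ‖y₀‖ ^ 2 + ∫ τ in (0 : ℝ)..T, ‖g τ‖ ^ 2) := by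
  have hgi := (intervalIntegrable_of_memLp_two hT.le hg).1
  have hr := intervalIntegrable_of_memLp_two hT.le hg.re
  have hi := intervalIntegrable_of_memLp_two hT.le hg.im
  simp only [RCLike.re_to_complex, RCLike.im_to_complex, Real.norm_eq_abs, sq_abs] at hr hi
  have hac : Continuous a := continuous_iff_continuousAt.2 fun t => (ha t).continuousAt
  obtain ⟨y1, v1, hy1, hv1, hc1, hd1, hi1, he1⟩ := exists_mode_of_real hT hα hlam ha hq haα haq ha'
    hr.1 hr.2 y₀.re v₀.re
  obtain ⟨y2, v2, hy2, hv2, hc2, hd2, hi2, he2⟩ := exists_mode_of_real hT hα hlam ha hq haα haq ha'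
    hi.1 hi.2 y₀.im v₀.im
  have hnorm : ∀ x y : ℝ, ‖(⟨x, y⟩ : ℂ)‖ ^ 2 = x ^ 2 + y ^ 2 := fun x y => by
    rw [Complex.sq_norm, Complex.normSq_mk]; ring
  have hnorm' : ∀ z : ℂ, ‖z‖ ^ 2 = z.re ^ 2 + z.im ^ 2 := fun z => hnorm z.re z.im
  have hy1c : ContinuousOn y1 (Icc 0 T) := fun t ht => (hd1 t ht).continuousWithinAt
  have hy2c : ContinuousOn y2 (Icc 0 T) := fun t ht => (hd2 t ht).continuousWithinAt
  refine ⟨fun t => ⟨y1 t, y2 t⟩, fun t => ⟨v1 t, v2 t⟩, by simp [hy1, hy2], by simp [hv1, hv2],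
    ?_, fun t ht => ?_, fun t ht => ?_, fun t ht => ?_⟩
  · have : ContinuousOn (fun t => ((v1 t : ℂ) + v2 t * Complex.I)) (Icc 0 T) :=
      (Complex.continuous_ofReal.comp_continuousOn hc1).add
        ((Complex.continuous_ofReal.comp_continuousOn hc2).mul continuousOn_const)
    simpa only [← Complex.mk_eq_add_mul_I] using this
  · have := ((hd1 t ht).ofReal_comp).add (((hd2 t ht).ofReal_comp).mul_const Complex.I)
    simp only [Complex.mk_eq_add_mul_I]
    exact this
  · have hsub : uIcc 0 t ⊆ uIcc 0 T := by
      rw [uIcc_of_le hT.le, uIcc_of_le ht.1]; exact Icc_subset_Icc_right ht.2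
    set F : ℝ → ℂ := fun τ => g τ - (a τ * lam + q τ) * (⟨y1 τ, y2 τ⟩ : ℂ) with hF
    have hFi : IntervalIntegrable F volume 0 t := by
      refine (hgi.mono_set hsub).sub (ContinuousOn.intervalIntegrable ?_)
      rw [uIcc_of_le ht.1]
      simp only [Complex.mk_eq_add_mul_I]
      have h1 := Complex.continuous_ofReal.comp_continuousOn (hy1c.mono (Icc_subset_Icc_right ht.2))
      have h2 := Complex.continuous_ofReal.comp_continuousOn (hy2c.mono (Icc_subset_Icc_right ht.2))
      refine ContinuousOn.mul (Continuous.continuousOn (by fun_prop))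
        (h1.add (h2.mul continuousOn_const))
    have hre : (∫ τ in (0 : ℝ)..t, F τ).re = ∫ τ in (0 : ℝ)..t, (F τ).re :=
      (Complex.reCLM.intervalIntegral_comp_comm hFi).symm
    have him : (∫ τ in (0 : ℝ)..t, F τ).im = ∫ τ in (0 : ℝ)..t, (F τ).im :=
      (Complex.imCLM.intervalIntegral_comp_comm hFi).symm
    apply Complex.ext
    · rw [Complex.add_re, hre]
      refine (hi1 t ht).trans ?_
      congr 1
      refine intervalIntegral.integral_congr fun τ _ => ?_
      simp [hF]
    · rw [Complex.add_im, him]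
      refine (hi2 t ht).trans ?_
      congr 1
      refine intervalIntegral.integral_congr fun τ _ => ?_
      simp [hF]
  · have h1 := he1 t ht
    have h2 := he2 t ht
    have h3 : ∫ τ in (0 : ℝ)..T, ‖g τ‖ ^ 2 =
        (∫ τ in (0 : ℝ)..T, (g τ).re ^ 2) + ∫ τ in (0 : ℝ)..T, (g τ).im ^ 2 := by
      rw [← intervalIntegral.integral_add hr.2 hi.2]
      exact intervalIntegral.integral_congr fun τ _ => hnorm' _
    rw [hnorm, hnorm, hnorm' v₀, hnorm' y₀, h3]
    linarith

section Mollification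

variable {F : Type} [NormedAddCommGroup F] [NormedSpace ℝ F]

/-! ### Distributions with compact support on the line -/

/-- The real-valued test functions on the line. -/
abbrev LineTest : Type := 𝓓((⊤ : TopologicalSpace.Opens ℝ), ℝ)

/-- The product of a smooth function and a test function, as a test function. -/
noncomputable def mulTest (χ : ℝ → ℝ) (hχ : ContDiff ℝ ((⊤ : ℕ∞) : WithTop ℕ∞) χ) (φ : LineTest) :
    LineTest where
  toFun x := χ x * φ x
  contDiff' := hχ.mul φ.contDiff
  hasCompactSupport' := φ.hasCompactSupport.mul_left
  tsupport_subset' := subset_univ _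

@[simp] theorem mulTest_apply (χ : ℝ → ℝ) (hχ : ContDiff ℝ ((⊤ : ℕ∞) : WithTop ℕ∞) χ) (φ : LineTest)
    (x : ℝ) : mulTest χ hχ φ x = χ x * φ x := rfl

open scoped Manifold ContDiff in
/-- A distribution vanishes on the complement of its support: a smooth partition of unity splits a
test function supported there into test functions supported in open sets on which the distribution
vanishes. -/
theorem isVanishingOn_compl_dsupport (A : 𝓓'((⊤ : TopologicalSpace.Opens ℝ), F)) :
    IsVanishingOn A (dsupport A)ᶜ := by
  intro φ hφ
  rw [dsupport_compl_eq] at hφ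
  obtain ⟨S, hS, hSfin, hcov⟩ := φ.hasCompactSupport.elim_finite_subcover_image
    (b := {a | IsVanishingOn A a ∧ IsOpen a}) (c := id) (fun a ha => ha.2)
    (by rwa [sUnion_eq_biUnion] at hφ)
  have : Finite S := hSfin
  have : Fintype S := Fintype.ofFinite S
  obtain ⟨ρ, hρ⟩ := SmoothPartitionOfUnity.exists_isSubordinate 𝓘(ℝ, ℝ) (s := tsupport φ)
    (isClosed_tsupport _) (fun a : S => (a : Set ℝ)) (fun a => (hS a.2).2)
    (by rwa [biUnion_eq_iUnion] at hcov)
  have hsum : φ = ∑ a : S, mulTest (ρ a) (ρ a).contMDiff.contDiff φ := by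
    ext x
    rw [sum_apply]
    simp only [mulTest_apply]
    rw [← Finset.sum_mul]
    by_cases hx : x ∈ tsupport φ
    · have := ρ.sum_eq_one hx
      rw [finsum_eq_sum_of_fintype] at this
      rw [this, one_mul]
    · rw [image_eq_zero_of_notMem_tsupport hx, mul_zero]
  rw [hsum, map_sum]
  refine Finset.sum_eq_zero fun a _ => ?_
  exact (hS a.2).1 _ ((tsupport_mul_subset_left (f := ρ a) (g := φ)).trans (hρ a))

theorem exists_bound_iteratedFDeriv {χ : ℝ → ℝ} (hχ : ContDiff ℝ ((⊤ : ℕ∞) : WithTop ℕ∞) χ)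
    (hc : HasCompactSupport χ) (N : ℕ) :
    ∃ C, 0 ≤ C ∧ ∀ j ≤ N, ∀ x, ‖iteratedFDeriv ℝ j χ x‖ ≤ C := by
  have h : ∀ j : ℕ, ∃ C, ∀ x, ‖iteratedFDeriv ℝ j χ x‖ ≤ C := fun j =>
    (hχ.continuous_iteratedFDeriv (by exact_mod_cast le_top)).bounded_above_of_compact_support
      (hc.iteratedFDeriv j)
  choose C hC using h
  have hC0 : ∀ j, 0 ≤ C j := fun j => (norm_nonneg _).trans (hC j 0)
  refine ⟨∑ j ∈ Finset.range (N + 1), C j, Finset.sum_nonneg fun j _ => hC0 j, fun j hj x => ?_⟩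
  exact (hC j x).trans (Finset.single_le_sum (fun j _ => hC0 j)
    (Finset.mem_range.2 (Nat.lt_succ_of_le hj)))

/-- A distribution with support in `[0, T]` is of finite order, with an estimate that does not refer
to the support of the test function, which may be cut off outside a neighbourhood of `[0, T]`. -/
theorem exists_bound_of_dsupport_subset {T : ℝ}
    {A : 𝓓'((⊤ : TopologicalSpace.Opens ℝ), F)} (hA : dsupport A ⊆ Icc 0 T) :
    ∃ (C : ℝ) (N : ℕ), 0 ≤ C ∧ ∀ (φ : LineTest) (P : ℝ),
      (∀ j ≤ N, ∀ x, |iteratedDeriv j φ x| ≤ P) → ‖A φ‖ ≤ C * P := by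
  let χ : ContDiffBump (T / 2) := ⟨|T| + 1, |T| + 2, by positivity, by linarith⟩
  have hχs : ContDiff ℝ ((⊤ : ℕ∞) : WithTop ℕ∞) χ := χ.contDiff
  let K : TopologicalSpace.Compacts ℝ := ⟨tsupport χ, χ.hasCompactSupport⟩
  have hK : (K : Set ℝ) ⊆ ((⊤ : TopologicalSpace.Opens ℝ) : Set ℝ) := subset_univ _
  let ι : 𝓓^{⊤}_{K}(ℝ, ℝ) →L[ℝ] LineTest := TestFunction.ofSupportedInCLM ℝ hK
  have hAc : Continuous fun φ => ‖A (ι φ)‖ := ((map_continuous A).comp ι.continuous).norm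
  -- the continuity of `A` on the functions supported in `K`
  obtain ⟨s, C₁, -, hs⟩ := Seminorm.bound_of_continuous
    (ContDiffMapSupportedIn.withSeminorms ℝ ℝ ℝ ⊤ K)
    ((normSeminorm ℝ F).comp ((A : LineTest →L[ℝ] F).toLinearMap.comp ι.toLinearMap)) hAc
  set N := s.sup id with hN
  obtain ⟨C₂, hC₂, hb⟩ := exists_bound_iteratedFDeriv hχs χ.hasCompactSupport N
  refine ⟨C₁ * (2 ^ N * C₂), N, by positivity, fun φ P hφ => ?_⟩
  have hP : 0 ≤ P := (abs_nonneg _).trans (hφ 0 (Nat.zero_le _) 0)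
  have hcut : A φ = A (mulTest χ hχs φ) := by
    rw [← sub_eq_zero, ← map_sub]
    refine isVanishingOn_compl_dsupport A _ ?_
    have h1 : tsupport (φ - mulTest χ hχs φ : LineTest) ⊆ (Metric.ball (T / 2) (|T| + 1))ᶜ := by
      refine closure_minimal (fun x hx hxb => hx ?_) Metric.isOpen_ball.isClosed_compl
      have : χ x = 1 := χ.one_of_mem_closedBall (Metric.ball_subset_closedBall hxb)
      simp [this]
    refine h1.trans (compl_subset_compl.2 (hA.trans fun x hx => ?_))
    rw [Metric.mem_ball, Real.dist_eq]
    have h0 : 0 ≤ T := hx.1.trans hx.2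
    rw [abs_of_nonneg h0, abs_lt]
    constructor <;> linarith [hx.1, hx.2]
  let φK : 𝓓^{⊤}_{K}(ℝ, ℝ) := ContDiffMapSupportedIn.of_support_subset
    (f := mulTest χ hχs φ) (mulTest χ hχs φ).contDiff
    ((subset_tsupport _).trans (tsupport_mul_subset_left (f := χ) (g := φ)))
  have h2 := hs φK
  have h3 : ‖A φ‖ ≤ C₁ * (s.sup (ContDiffMapSupportedIn.seminorm ℝ ℝ ℝ ⊤ K)) φK := by
    rw [hcut]; exact h2
  rw [mul_assoc]
  refine h3.trans (mul_le_mul_of_nonneg_left ?_ C₁.2)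
  refine Seminorm.finset_sup_apply_le (by positivity) fun j hj => ?_
  have hjN : j ≤ N := Finset.le_sup (f := id) hj
  rw [ContDiffMapSupportedIn.seminorm_top_le_iff ℝ (by positivity)]
  intro x _
  have h4 := norm_iteratedFDeriv_mul_le hχs φ.contDiff x (n := j) (by exact_mod_cast le_top)
  have h5 : ∀ i ∈ Finset.range (j + 1), (j.choose i : ℝ) * ‖iteratedFDeriv ℝ i χ x‖ *
      ‖iteratedFDeriv ℝ (j - i) φ x‖ ≤ (j.choose i : ℝ) * (C₂ * P) := by
    intro i hi
    rw [mul_assoc]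
    have hi' : i ≤ j := Nat.lt_succ_iff.1 (Finset.mem_range.1 hi)
    refine mul_le_mul_of_nonneg_left ?_ (Nat.cast_nonneg _)
    refine mul_le_mul (hb i (hi'.trans hjN) x) ?_ (norm_nonneg _) hC₂
    rw [norm_iteratedFDeriv_eq_norm_iteratedDeriv]
    exact hφ _ ((Nat.sub_le _ _).trans hjN) x
  have h6 : ∑ i ∈ Finset.range (j + 1), (j.choose i : ℝ) = 2 ^ j := by
    exact_mod_cast Nat.sum_range_choose j
  refine h4.trans ((Finset.sum_le_sum h5).trans ?_)
  rw [← Finset.sum_mul, h6, mul_assoc]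
  exact mul_le_mul_of_nonneg_right (pow_le_pow_right₀ one_le_two hjN) (by positivity)

/-! ### Mollification -/

/-- The derivative of a test function, as a test function. -/
noncomputable def derivTest (ψ : LineTest) : LineTest where
  toFun := deriv ψ
  contDiff' := (contDiff_infty_iff_deriv.1 ψ.contDiff).2
  hasCompactSupport' := ψ.hasCompactSupport.deriv
  tsupport_subset' := subset_univ _

/-- The translate `x ↦ ψ(x + h)` of a test function. -/
noncomputable def translateTest (h : ℝ) (ψ : LineTest) : LineTest where
  toFun x := ψ (x + h)
  contDiff' := ψ.contDiff.comp (contDiff_id.add contDiff_const)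
  hasCompactSupport' := ψ.hasCompactSupport.comp_homeomorph (Homeomorph.addRight h)
  tsupport_subset' := subset_univ _

theorem mollifierAt_apply (ψ : LineTest) (ω t τ : ℝ) :
    mollifierAt ψ ω t τ = ω⁻¹ * ψ ((t - τ) / ω) := rfl

@[simp] theorem derivTest_apply (ψ : LineTest) (x : ℝ) : derivTest ψ x = deriv ψ x := rfl

@[simp] theorem translateTest_apply (h : ℝ) (ψ : LineTest) (x : ℝ) :
    translateTest h ψ x = ψ (x + h) := rfl

theorem abs_iteratedDeriv_mollifierAt (ψ : LineTest) {ω : ℝ} (hω : 0 < ω) (t : ℝ) (j : ℕ) (τ : ℝ) :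
    |iteratedDeriv j (mollifierAt ψ ω t) τ| =
      (ω⁻¹) ^ (j + 1) * |iteratedDeriv j ψ ((t - τ) / ω)| := by
  have h1 : (mollifierAt ψ ω t : ℝ → ℝ) = fun τ => ω⁻¹ * (fun x => ψ (ω⁻¹ * (t - x))) τ := by
    funext x
    rw [mollifierAt_apply, div_eq_inv_mul]
  rw [h1, iteratedDeriv_const_mul_field]
  have h2 := congrFun (iteratedDeriv_comp_const_sub (𝕜 := ℝ) j (fun z => ψ (ω⁻¹ * z)) t) τ
  rw [h2, iteratedDeriv_comp_const_mul (ψ.contDiff.of_le (by exact_mod_cast le_top))]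
  simp only [smul_eq_mul, abs_mul, abs_pow, abs_neg, abs_one, one_pow, one_mul]
  rw [abs_of_pos (inv_pos.2 hω), pow_succ', div_eq_inv_mul, mul_assoc]

theorem pow_succ_le_add_pow_succ {x : ℝ} (hx : 0 ≤ x) {j N : ℕ} (hj : j ≤ N) :
    x ^ (j + 1) ≤ x + x ^ (N + 1) := by
  rcases le_total x 1 with h | h
  · have := pow_le_of_le_one hx h (n := j + 1) (Nat.succ_ne_zero _)
    have := pow_nonneg hx (N + 1)
    linarith
  · have : x ^ (j + 1) ≤ x ^ (N + 1) := pow_le_pow_right₀ h (Nat.succ_le_succ hj)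
    linarith

/-- The mollification at scale `ω` of a distribution of order `N` with support in `[0, T]` grows at
most like `ω⁻¹ + ω⁻¹ ^ (N + 1)`, with a constant that depends on the mollifier only through its
derivatives up to order `N`. As `θ` is arbitrary, the estimate also applies to differences of
mollifiers, and gives the differentiability of the mollification. -/
theorem exists_bound_mollify {T : ℝ}
    {A : 𝓓'((⊤ : TopologicalSpace.Opens ℝ), F)} (hA : dsupport A ⊆ Icc 0 T) :
    ∃ (C : ℝ) (N : ℕ), 0 ≤ C ∧ ∀ (θ : LineTest) (P ω t : ℝ), 0 < ω →
      (∀ j ≤ N, ∀ x, |iteratedDeriv j θ x| ≤ P) →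
        ‖mollify A θ ω t‖ ≤ C * P * (ω⁻¹ + (ω⁻¹) ^ (N + 1)) := by
  obtain ⟨C, N, hC, h⟩ := exists_bound_of_dsupport_subset hA
  refine ⟨C, N, hC, fun θ P ω t hω hθ => ?_⟩
  have hω' : 0 < ω⁻¹ := inv_pos.2 hω
  refine (h (mollifierAt θ ω t) ((ω⁻¹ + (ω⁻¹) ^ (N + 1)) * P) fun j hj τ => ?_).trans_eq (by ring)
  rw [abs_iteratedDeriv_mollifierAt θ hω]
  exact mul_le_mul (pow_succ_le_add_pow_succ hω'.le hj) (hθ j hj _) (abs_nonneg _) (by positivity)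

theorem abs_taylor_two_le {f f' f'' : ℝ → ℝ} {B : ℝ} (hf : ∀ x, HasDerivAt f (f' x) x)
    (hf' : ∀ x, HasDerivAt f' (f'' x) x) (hB : ∀ x, |f'' x| ≤ B) (x h : ℝ) :
    |f (x + h) - f x - h * f' x| ≤ B * h ^ 2 := by
  have hB0 : 0 ≤ B := (abs_nonneg _).trans (hB 0)
  have hlip : ∀ y, |f' y - f' x| ≤ B * |y - x| := fun y =>
    convex_univ.norm_image_sub_le_of_norm_hasDerivWithin_le
      (fun z _ => (hf' z).hasDerivWithinAt) (fun z _ => hB z) (mem_univ x) (mem_univ y)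
  have hd : ∀ y, HasDerivAt (fun s => f s - s * f' x) (f' y - f' x) y := fun y => by
    simpa using (hf y).fun_sub ((hasDerivAt_id y).mul_const (f' x))
  have key := (convex_closedBall x |h|).norm_image_sub_le_of_norm_hasDerivWithin_le
    (C := B * |h|) (y := x + h)
    (fun y _ => (hd y).hasDerivWithinAt) (fun y hy => (hlip y).trans
      (mul_le_mul_of_nonneg_left (by simpa [Real.dist_eq] using hy) hB0))
    (Metric.mem_closedBall_self (abs_nonneg h)) (by simp)
  have e1 : f (x + h) - f x - h * f' x = f (x + h) - (x + h) * f' x - (f x - x * f' x) := by ring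
  have e2 : B * h ^ 2 = B * |h| * |x + h - x| := by
    rw [add_sub_cancel_left, mul_assoc, abs_mul_abs_self, pow_two]
  rw [e1, e2]
  exact key

theorem exists_bound_iteratedDeriv (ψ : LineTest) (N : ℕ) :
    ∃ C, 0 ≤ C ∧ ∀ j ≤ N, ∀ x, |iteratedDeriv j ψ x| ≤ C := by
  obtain ⟨C, hC, h⟩ := exists_bound_iteratedFDeriv ψ.contDiff ψ.hasCompactSupport N
  refine ⟨C, hC, fun j hj x => ?_⟩
  have := h j hj x
  rwa [norm_iteratedFDeriv_eq_norm_iteratedDeriv] at this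

theorem hasDerivAt_iteratedDeriv (ψ : LineTest) (j : ℕ) (x : ℝ) :
    HasDerivAt (iteratedDeriv j ψ) (iteratedDeriv (j + 1) ψ x) x := by
  rw [iteratedDeriv_succ]
  exact ((ψ.contDiff.differentiable_iteratedDeriv j (by exact_mod_cast WithTop.coe_lt_top _))
    x).hasDerivAt

theorem mollify_add (A : 𝓓'((⊤ : TopologicalSpace.Opens ℝ), F)) (ψ θ : LineTest) (ω t : ℝ) :
    mollify A (ψ + θ) ω t = mollify A ψ ω t + mollify A θ ω t := by
  rw [mollify, mollify, mollify, ← map_add]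
  congr 1
  ext τ
  simp [mollifierAt_apply, mul_add]

theorem mollify_smul (A : 𝓓'((⊤ : TopologicalSpace.Opens ℝ), F)) (c : ℝ) (ψ : LineTest) (ω t : ℝ) :
    mollify A (c • ψ) ω t = c • mollify A ψ ω t := by
  rw [mollify, mollify, ← map_smul]
  congr 1
  ext τ
  simp [mollifierAt_apply]
  ring

/-- A shift in time can be moved to the mollifier, which reduces the differentiability of a
mollification to Taylor's formula for the mollifier. -/
theorem mollify_add_time (A : 𝓓'((⊤ : TopologicalSpace.Opens ℝ), F)) (ψ : LineTest) {ω : ℝ}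
    (t h : ℝ) : mollify A ψ ω (t + h) = mollify A (translateTest (h / ω) ψ) ω t := by
  rw [mollify, mollify]
  congr 1
  ext τ
  simp only [mollifierAt_apply, translateTest_apply]
  congr 2
  ring

theorem hasDerivAt_mollify {T : ℝ} {A : 𝓓'((⊤ : TopologicalSpace.Opens ℝ), F)}
    (hA : dsupport A ⊆ Icc 0 T) (ψ : LineTest) {ω : ℝ} (hω : 0 < ω) (t : ℝ) :
    HasDerivAt (mollify A ψ ω) (ω⁻¹ • mollify A (derivTest ψ) ω t) t := by
  obtain ⟨C, N, hC, hb⟩ := exists_bound_mollify hA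
  obtain ⟨B, hB0, hB⟩ := exists_bound_iteratedDeriv ψ (N + 2)
  rw [hasDerivAt_iff_isLittleO_nhds_zero]
  set D := C * B * (ω⁻¹) ^ 2 * (ω⁻¹ + (ω⁻¹) ^ (N + 1)) with hD
  have key : ∀ h, ‖mollify A ψ ω (t + h) - mollify A ψ ω t -
      h • ω⁻¹ • mollify A (derivTest ψ) ω t‖ ≤ D * ‖h ^ 2‖ := by
    intro h
    set k := h / ω with hk
    set θ : LineTest := translateTest k ψ + ((-1 : ℝ) • ψ + (-k) • derivTest ψ) with hθ
    have e1 : mollify A ψ ω (t + h) - mollify A ψ ω t - h • ω⁻¹ • mollify A (derivTest ψ) ω t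
        = mollify A θ ω t := by
      rw [hθ, mollify_add, mollify_add, mollify_smul, mollify_smul, mollify_add_time, smul_smul,
        ← div_eq_mul_inv, ← hk]
      module
    have hψc : ∀ j : ℕ, ContDiff ℝ j ψ := fun j => ψ.contDiff.of_le (by exact_mod_cast le_top)
    have hψc' : ∀ j : ℕ, ContDiff ℝ j (derivTest ψ) := fun j =>
      (derivTest ψ).contDiff.of_le (by exact_mod_cast le_top)
    have e2 : ∀ j x, iteratedDeriv j θ x =
        iteratedDeriv j ψ (x + k) - iteratedDeriv j ψ x - k * iteratedDeriv (j + 1) ψ x := by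
      intro j x
      have e3 : (θ : ℝ → ℝ) = (fun x => ψ (x + k)) - (ψ + k • deriv ψ) := by
        funext x
        simp [hθ]
        ring
      have e4 : ContDiff ℝ j (deriv ψ) := hψc' j
      rw [e3, iteratedDeriv_sub, iteratedDeriv_add, iteratedDeriv_const_smul_field,
        iteratedDeriv_comp_add_const, iteratedDeriv_succ']
      · simp only [smul_eq_mul]; ring
      · exact (hψc j).contDiffAt
      · exact (e4.const_smul k).contDiffAt
      · exact ((hψc j).comp (contDiff_id.add contDiff_const)).contDiffAt
      · exact ((hψc j).add (e4.const_smul k)).contDiffAt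
    rw [e1]
    refine (hb θ (B * k ^ 2) ω t hω fun j hj x => ?_).trans_eq ?_
    · rw [e2]
      exact abs_taylor_two_le (hasDerivAt_iteratedDeriv ψ j) (hasDerivAt_iteratedDeriv ψ (j + 1))
        (fun y => hB (j + 2) (by omega) y) x k
    · rw [hD, hk, Real.norm_of_nonneg (sq_nonneg h), div_pow, div_eq_mul_inv, ← inv_pow]
      ring
  refine (Asymptotics.IsBigO.of_bound D (Filter.Eventually.of_forall key)).trans_isLittleO ?_
  simpa using Asymptotics.isLittleO_pow_id (𝕜 := ℝ) (n := 2) one_lt_two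

end Mollification

/-! ### Regularisation of the coefficients -/

/-- Half of the mass of an even mollifier lies on each side of the origin. -/
theorem exists_even_mollifier :
    ∃ ψ : LineTest, (∀ x, 0 ≤ ψ x) ∧ ∫ x, ψ x = 1 ∧ ∫ x in (0 : ℝ)..1, ψ x = 1 / 2 ∧
      ∫ x in (-1 : ℝ)..0, ψ x = 1 / 2 := by
  let β : ContDiffBump (0 : ℝ) := ⟨1 / 2, 1, by norm_num, by norm_num⟩
  let ψ : LineTest := ⟨β.normed volume, β.contDiff_normed, β.hasCompactSupport_normed,
    subset_univ _⟩
  have hψ : ∀ x, ψ x = β.normed volume x := fun _ => rfl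
  have heven : ∀ x, ψ (-x) = ψ x := fun x => β.normed_neg x
  have hint : ∀ a b, IntervalIntegrable ψ volume a b := fun a b =>
    ψ.continuous.intervalIntegrable a b
  have h1 : ∫ x, ψ x = 1 := β.integral_normed
  have h2 : ∫ x in (-1 : ℝ)..1, ψ x = 1 := by
    rw [intervalIntegral.integral_eq_integral_of_support_subset, h1]
    have : Function.support ψ = Metric.ball 0 1 := β.support_normed_eq
    rw [this, Real.ball_eq_Ioo]
    norm_num
    exact Ioo_subset_Ioc_self
  have h3 : ∫ x in (-1 : ℝ)..0, ψ x = ∫ x in (0 : ℝ)..1, ψ x := by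
    have := intervalIntegral.integral_comp_neg (fun x => ψ x) (a := (0 : ℝ)) (b := 1)
    simp only [heven, neg_zero] at this
    exact this.symm
  have h4 := intervalIntegral.integral_add_adjacent_intervals (hint (-1) 0) (hint 0 1)
  refine ⟨ψ, fun x => β.nonneg_normed x, h1, ?_, ?_⟩ <;> linarith

/-- A lower bound `a₀` on `[0, T]` becomes the lower bound `a₀ / 2` for a mollification, up to the end
points: at a scale `ω ≤ T / 2`, at least half of the unit mass of an even mollifier centred at
`t ∈ [0, T]` lies in `[0, T]`. -/
theorem half_le_mollify {T a₀ : ℝ} (ha₀ : 0 ≤ a₀)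
    {A : 𝓓'((⊤ : TopologicalSpace.Opens ℝ), ℝ)}
    (hA : ∀ φ : LineTest, (∀ t, 0 ≤ φ t) → a₀ * (∫ t in (0 : ℝ)..T, φ t) ≤ A φ)
    {ψ : LineTest} (hψ : ∀ x, 0 ≤ ψ x) (h₁ : ∫ x in (0 : ℝ)..1, ψ x = 1 / 2)
    (h₂ : ∫ x in (-1 : ℝ)..0, ψ x = 1 / 2) {ω : ℝ} (hω : 0 < ω) (hωT : ω ≤ T / 2)
    {t : ℝ} (ht : t ∈ Icc 0 T) : a₀ / 2 ≤ mollify A ψ ω t := by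
  have hω' : 0 ≤ ω⁻¹ := (inv_pos.2 hω).le
  refine le_trans ?_ (hA _ fun τ => ?_)
  swap
  · rw [mollifierAt_apply]
    exact mul_nonneg hω' (hψ _)
  have e1 : ∫ τ in (0 : ℝ)..T, mollifierAt ψ ω t τ = ∫ x in (t / ω - T / ω)..(t / ω), ψ x := by
    simp only [mollifierAt_apply, sub_div]
    rw [intervalIntegral.integral_const_mul,
      intervalIntegral.integral_comp_sub_div (fun x => ψ x) hω.ne' (t / ω)]
    simp [hω.ne']
  have hint : IntervalIntegrable ψ volume (t / ω - T / ω) (t / ω) :=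
    ψ.continuous.intervalIntegrable _ _
  have hmono : ∀ c d : ℝ, t / ω - T / ω ≤ c → c ≤ d → d ≤ t / ω →
      ∫ x in c..d, ψ x ≤ ∫ x in (t / ω - T / ω)..(t / ω), ψ x := fun c d hc hcd hd =>
    intervalIntegral.integral_mono_interval hc hcd hd (Filter.Eventually.of_forall hψ) hint
  have e2 : 1 / 2 ≤ ∫ x in (t / ω - T / ω)..(t / ω), ψ x := by
    rcases le_total (T / 2) t with h | h
    · rw [← h₁]
      refine hmono 0 1 ?_ zero_le_one ?_
      · rw [sub_nonpos]; exact div_le_div_of_nonneg_right ht.2 hω.le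
      · rw [le_div_iff₀ hω]; linarith
    · rw [← h₂]
      refine hmono (-1) 0 ?_ (by norm_num) (div_nonneg ht.1 hω.le)
      rw [← sub_div, div_le_iff₀ hω]; linarith
  rw [e1]
  nlinarith

theorem IsLinftyModerate.mono {m m' : ℕ} (h : m' ≤ m) {g : ℝ → ℝ → ℝ} (hg : IsLinftyModerate m g) :
    IsLinftyModerate m' g := by
  refine ⟨fun ε hε => ⟨fun j hj => (hg.1 ε hε).1 j (hj.trans_le h),
    fun j hj => (hg.1 ε hε).2 j (hj.trans h)⟩, fun K hK => ?_⟩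
  obtain ⟨N, c, hc, hb⟩ := hg.2 K hK
  exact ⟨N, c, hc, fun j hj => hb j (hj.trans h)⟩

theorem isLinftyModerate_one_of_bound {g : ℝ → ℝ → ℝ} {C : ℝ} (hC : 0 ≤ C)
    (hd : ∀ ε ∈ Ioc (0 : ℝ) 1, Differentiable ℝ (g ε))
    (hb : ∀ ε ∈ Ioc (0 : ℝ) 1, ∀ t, |g ε t| ≤ C * ε⁻¹ ∧ |deriv (g ε) t| ≤ C * ε⁻¹) :
    IsLinftyModerate 1 g := by
  have hj : ∀ ε ∈ Ioc (0 : ℝ) 1, ∀ j ≤ 1, ∀ t, ‖iteratedDeriv j (g ε) t‖ ≤ C * ε⁻¹ := by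
    intro ε hε j hj t
    interval_cases j
    · simpa using (hb ε hε t).1
    · simpa [iteratedDeriv_one] using (hb ε hε t).2
  refine ⟨fun ε hε => ⟨fun j hj => ?_, fun j hj1 => ?_⟩, fun K _ => ⟨1, C + 1, by linarith, ?_⟩⟩
  · obtain rfl : j = 0 := by omega
    simpa using hd ε hε
  · refine memLp_top_of_bound ?_ (C * ε⁻¹) (Filter.Eventually.of_forall (hj ε hε j hj1))
    interval_cases j
    · simpa using (hd ε hε).continuous.aestronglyMeasurable
    · rw [iteratedDeriv_one]
      exact (measurable_deriv _).aestronglyMeasurable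
  · intro j hj1 ε hε
    rw [eLpNorm_exponent_top]
    refine eLpNormEssSup_le_of_ae_bound (Filter.Eventually.of_forall fun t => ?_)
    refine (hj ε hε j hj1 t).trans ?_
    have h1 : ε⁻¹ ≤ (ε ^ (1 + j))⁻¹ := by
      refine inv_anti₀ (pow_pos hε.1 _) ?_
      exact pow_le_of_le_one hε.1.le hε.2 (by omega)
    have h2 : 0 ≤ ε⁻¹ := (inv_pos.2 hε.1).le
    nlinarith

/-- The rate `1 + log (1 / ε)` at which the regularised coefficients are allowed to grow. -/
noncomputable def logRate (ε : ℝ) : ℝ := 1 - Real.log ε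

theorem one_le_logRate {ε : ℝ} (hε : ε ∈ Ioc (0 : ℝ) 1) : 1 ≤ logRate ε := by
  have := Real.log_nonpos hε.1.le hε.2
  rw [logRate]; linarith

theorem logRate_le_inv {ε : ℝ} (hε : ε ∈ Ioc (0 : ℝ) 1) : logRate ε ≤ ε⁻¹ := by
  have := Real.log_le_sub_one_of_pos (inv_pos.2 hε.1)
  rw [Real.log_inv] at this
  rw [logRate]; linarith

/-- There is a scale tending to `0` so slowly that its inverse to the power `m` grows
logarithmically. -/
theorem exists_slow_scale {ω₀ : ℝ} (hω₀ : 0 < ω₀) {m : ℕ} (hm : m ≠ 0) :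
    ∃ ω : ℝ → ℝ, Filter.Tendsto ω (nhdsWithin 0 (Ioi 0)) (nhds 0) ∧
      ∀ ε ∈ Ioc (0 : ℝ) 1, 0 < ω ε ∧ ω ε ≤ ω₀ ∧ (ω ε)⁻¹ ^ m = ω₀⁻¹ ^ m * logRate ε := by
  refine ⟨fun ε => ω₀ * (logRate ε) ^ (-(m : ℝ)⁻¹), ?_, fun ε hε => ⟨?_, ?_, ?_⟩⟩
  · have h1 : Filter.Tendsto logRate (nhdsWithin 0 (Ioi 0)) Filter.atTop := by
      have := Filter.tendsto_atTop_add_const_left _ (1 : ℝ)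
        (Filter.tendsto_neg_atBot_atTop.comp Real.tendsto_log_nhdsGT_zero)
      exact this
    have h2 := (tendsto_rpow_neg_atTop (y := (m : ℝ)⁻¹) (by positivity)).comp h1
    simpa using h2.const_mul ω₀
  · have := one_le_logRate hε
    positivity
  · exact mul_le_of_le_one_right hω₀.le
      (Real.rpow_le_one_of_one_le_of_nonpos (one_le_logRate hε) (by simp))
  · have h := one_le_logRate hε
    have h0 : 0 ≤ logRate ε := by linarith
    rw [mul_inv, Real.rpow_neg h0, inv_inv, mul_pow, Real.rpow_inv_natCast_pow h0 hm]

/-- Every distribution supported in `[0, T]` has a regularisation that grows only logarithmically,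
together with its first derivative. The positivity of the distribution is preserved with half of the
lower bound. -/
theorem exists_coefficient_regularisation {T : ℝ} (hT : 0 < T)
    {A : 𝓓'((⊤ : TopologicalSpace.Opens ℝ), ℝ)} (hA : dsupport A ⊆ Icc 0 T) :
    ∃ g : ℝ → ℝ → ℝ, IsRegularisation A g ∧ IsLinftyModerate 1 g ∧
      (∀ ε ∈ Ioc (0 : ℝ) 1, Differentiable ℝ (g ε)) ∧
      (∃ C, 0 ≤ C ∧ ∀ ε ∈ Ioc (0 : ℝ) 1, ∀ t,
        |g ε t| ≤ C * logRate ε ∧ |deriv (g ε) t| ≤ C * logRate ε) ∧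
      ∀ a₀, 0 ≤ a₀ →
        (∀ φ : LineTest, (∀ t, 0 ≤ φ t) → a₀ * (∫ t in (0 : ℝ)..T, φ t) ≤ A φ) →
        ∀ ε ∈ Ioc (0 : ℝ) 1, ∀ t ∈ Icc 0 T, a₀ / 2 ≤ g ε t := by
  obtain ⟨ψ, hψ0, hψ1, hψ2, hψ3⟩ := exists_even_mollifier
  obtain ⟨C, N, hC, hb⟩ := exists_bound_mollify hA
  obtain ⟨B, hB0, hB⟩ := exists_bound_iteratedDeriv ψ N
  obtain ⟨B', hB0', hB'⟩ := exists_bound_iteratedDeriv (derivTest ψ) N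
  set ω₀ : ℝ := min 1 (T / 2) with hω₀
  have hω₀p : 0 < ω₀ := lt_min one_pos (by linarith)
  obtain ⟨ω, hωt, hω⟩ := exists_slow_scale hω₀p (m := N + 2) (by omega)
  set g : ℝ → ℝ → ℝ := fun ε => mollify A ψ (ω ε) with hg
  have hder : ∀ ε ∈ Ioc (0 : ℝ) 1, ∀ t,
      HasDerivAt (g ε) ((ω ε)⁻¹ • mollify A (derivTest ψ) (ω ε) t) t := fun ε hε t =>
    hasDerivAt_mollify hA ψ (hω ε hε).1 t
  have hd : ∀ ε ∈ Ioc (0 : ℝ) 1, Differentiable ℝ (g ε) := fun ε hε t =>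
    (hder ε hε t).differentiableAt
  set D := 2 * C * (B + B') * ω₀⁻¹ ^ (N + 2) with hD
  have hD0 : 0 ≤ D := by positivity
  have hbound : ∀ ε ∈ Ioc (0 : ℝ) 1, ∀ t,
      |g ε t| ≤ D * logRate ε ∧ |deriv (g ε) t| ≤ D * logRate ε := by
    intro ε hε t
    obtain ⟨hp, hle, hpow⟩ := hω ε hε
    have h1 := hb ψ B (ω ε) t hp hB
    have h2 := hb (derivTest ψ) B' (ω ε) t hp hB'
    rw [(hder ε hε t).deriv, hD, mul_assoc, ← hpow]
    rw [Real.norm_eq_abs] at h1 h2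
    have hx : 1 ≤ (ω ε)⁻¹ := (one_le_inv₀ hp).2 (hle.trans (min_le_left _ _))
    set x := (ω ε)⁻¹
    have hx1 : x ≤ x ^ (N + 1) := le_self_pow₀ hx (by omega)
    have hx2 : x ^ (N + 2) = x * x ^ (N + 1) := by ring
    have hx3 : x ^ (N + 1) ≤ x ^ (N + 2) := pow_le_pow_right₀ hx (by omega)
    have hCB : 0 ≤ C * B := mul_nonneg hC hB0
    have hCB' : 0 ≤ C * B' := mul_nonneg hC hB0'
    have hx0 : 0 ≤ x ^ (N + 2) := by positivity
    constructor
    · refine h1.trans ?_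
      nlinarith [mul_le_mul_of_nonneg_left (hx1.trans hx3) hCB, mul_le_mul_of_nonneg_left hx3 hCB,
        mul_nonneg hCB' hx0]
    · rw [smul_eq_mul, abs_mul, abs_of_nonneg (by linarith)]
      have h3 : C * B' * (x + x ^ (N + 1)) ≤ C * B' * (2 * x ^ (N + 1)) :=
        mul_le_mul_of_nonneg_left (by linarith) hCB'
      refine (mul_le_mul_of_nonneg_left (h2.trans h3) (by linarith)).trans ?_
      rw [show x * (C * B' * (2 * x ^ (N + 1))) = 2 * (C * B') * x ^ (N + 2) by rw [hx2]; ring]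
      nlinarith [mul_nonneg hCB hx0]
  refine ⟨g, ⟨ψ, hψ0, hψ1, ω, fun ε hε => (hω ε hε).1, hωt, fun ε _ t => rfl⟩,
    isLinftyModerate_one_of_bound hD0 hd fun ε hε t => ?_, hd, ⟨D, hD0, hbound⟩, ?_⟩
  · have := mul_le_mul_of_nonneg_left (logRate_le_inv hε) hD0
    exact ⟨(hbound ε hε t).1.trans this, (hbound ε hε t).2.trans this⟩
  · intro a₀ ha₀ hpos ε hε t ht
    exact half_le_mollify ha₀ hpos hψ0 hψ2 hψ3 (hω ε hε).1
      ((hω ε hε).2.1.trans (min_le_right _ _)) ht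

variable {n : ℕ} {S : ConfiningSchrodinger n}

/-! ### Eigenfunction expansion of test functions -/

/-- The kinetic part `-ħ⁻² L` of the Schrödinger operator, as a bounded operator on `ℓ²`. -/
noncomputable def kineticOp (S : ConfiningSchrodinger n) : Ell2 n →L[ℂ] Ell2 n :=
  (-((S.hbar : ℂ) ^ 2)⁻¹) • ((∑ j : Fin n, (reindexOp (Equiv.addRight (Pi.single j 1)) +
    reindexOp (Equiv.addRight (Pi.single j 1)).symm)) -
      (2 * (n : ℂ)) • ContinuousLinearMap.id ℂ (Ell2 n))

theorem kineticOp_apply (f : Ell2 n) (k : Fin n → ℤ) :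
    kineticOp S f k + (S.V k : ℂ) * f k = hamiltonian S f k := by
  have h1 : kineticOp S f k = -((S.hbar : ℂ) ^ 2)⁻¹ *
      ((∑ j : Fin n, (f (k + Pi.single j 1) + f (k - Pi.single j 1))) - 2 * (n : ℂ) * f k) := by
    simp only [kineticOp, smul_apply, sub_apply, sum_apply, lp.coeFn_smul, lp.coeFn_sub,
      lp.coeFn_sum, Pi.smul_apply, Pi.sub_apply, Finset.sum_apply, smul_eq_mul,
      ContinuousLinearMap.id_apply, add_apply, lp.coeFn_add, Pi.add_apply, reindexOp_apply]
    rfl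
  rw [h1]
  rfl

theorem inner_kineticOp (f g : Ell2 n) : ⟪kineticOp S f, g⟫_ℂ = ⟪f, kineticOp S g⟫_ℂ := by
  simp only [kineticOp, smul_apply, sub_apply, sum_apply, add_apply, ContinuousLinearMap.id_apply,
    inner_smul_left, inner_smul_right, inner_sub_left, inner_sub_right, sum_inner, inner_sum,
    inner_add_left, inner_add_right]
  have hsum : ∑ j : Fin n, (⟪reindexOp (Equiv.addRight (Pi.single j 1)) f, g⟫_ℂ +
      ⟪reindexOp (Equiv.addRight (Pi.single j 1)).symm f, g⟫_ℂ) =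
      ∑ j : Fin n, (⟪f, reindexOp (Equiv.addRight (Pi.single j 1)) g⟫_ℂ +
      ⟪f, reindexOp (Equiv.addRight (Pi.single j 1)).symm g⟫_ℂ) := by
    refine Finset.sum_congr rfl fun j _ => ?_
    rw [inner_reindexOp, inner_reindexOp, Equiv.symm_symm, add_comm]
  rw [hsum]
  simp [Complex.conj_ofReal, Complex.conj_ofNat]

/-- The Schrödinger operator is symmetric on its maximal domain, because it is the sum of a bounded
symmetric operator and a multiplication operator. -/
theorem inner_hamiltonian {f g f' g' : Ell2 n} (hf : (f' : (Fin n → ℤ) → ℂ) = hamiltonian S f)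
    (hg : (g' : (Fin n → ℤ) → ℂ) = hamiltonian S g) : ⟪f', g⟫_ℂ = ⟪f, g'⟫_ℂ := by
  have h1 : ∀ {f f' : Ell2 n}, (f' : (Fin n → ℤ) → ℂ) = hamiltonian S f → ∀ k,
      (f' - kineticOp S f) k = (S.V k : ℂ) * f k := by
    intro f f' hf k
    rw [lp.coeFn_sub, Pi.sub_apply, hf, ← kineticOp_apply]
    ring
  have h2 : ⟪f' - kineticOp S f, g⟫_ℂ = ⟪f, g' - kineticOp S g⟫_ℂ := by
    rw [lp.inner_eq_tsum, lp.inner_eq_tsum]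
    refine tsum_congr fun k => ?_
    rw [h1 hf, h1 hg]
    simp
    ring
  rw [inner_sub_left, inner_sub_right, inner_kineticOp] at h2
  exact sub_left_injective h2

/-- Here `H f ∈ ℓ²` is the hypothesis that `f` lies in the maximal domain of `H`. -/
theorem inner_eigenbasis_hamiltonian {f g : Ell2 n} (hg : (g : (Fin n → ℤ) → ℂ) = hamiltonian S f)
    (i : EigenIndex S) :
    ⟪eigenbasis S i, g⟫_ℂ = (eigenvalue S i : ℂ) * ⟪eigenbasis S i, f⟫_ℂ := by
  have h : (((eigenvalue S i : ℂ) • eigenbasis S i : Ell2 n) : (Fin n → ℤ) → ℂ) =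
      hamiltonian S (eigenbasis S i) := by
    rw [hamiltonian_eigenbasis]; rfl
  rw [← inner_hamiltonian h hg, inner_smul_left, Complex.conj_ofReal]

/-- The function `(I + H)^j φ`, as an element of `ℓ²`. -/
noncomputable def shiftPow (S : ConfiningSchrodinger n) (j : ℕ) : testSpace S →ₗ[ℂ] Ell2 n where
  toFun φ := ⟨((1 + hamiltonian S) ^ j) (φ : (Fin n → ℤ) → ℂ), φ.2 j⟩
  map_add' φ χ := by
    ext k
    simp only [Submodule.coe_add, map_add]
    rfl
  map_smul' c φ := by
    ext k
    simp

theorem coe_shiftPow (j : ℕ) (φ : testSpace S) : (shiftPow S j φ : (Fin n → ℤ) → ℂ) =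
    ((1 + hamiltonian S) ^ j) (φ : (Fin n → ℤ) → ℂ) := rfl

theorem shiftPow_zero_apply (φ : testSpace S) (k : Fin n → ℤ) :
    shiftPow S 0 φ k = (φ : (Fin n → ℤ) → ℂ) k := by
  rw [coe_shiftPow, pow_zero, Module.End.one_apply]

theorem norm_shiftPow_le_testNorm {j m : ℕ} (hj : j ≤ m) (φ : testSpace S) :
    ‖shiftPow S j φ‖ ≤ testNorm S m φ :=
  le_ciSup (f := fun j : Fin (m + 1) => ‖shiftPow S j φ‖) (Set.finite_range _).bddAbove
    ⟨j, Nat.lt_succ_of_le hj⟩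

theorem testNorm_le_sum (m : ℕ) (φ : testSpace S) :
    testNorm S m φ ≤ ∑ j ∈ Finset.range (m + 1), ‖shiftPow S j φ‖ :=
  ciSup_le fun j => Finset.single_le_sum (f := fun j : ℕ => ‖shiftPow S j φ‖)
    (fun _ _ => norm_nonneg _) (Finset.mem_range.2 j.2)

/-- The coefficient `⟨u_ξ, φ⟩` of a test function in the eigenbasis. -/
noncomputable def coeff (φ : testSpace S) (i : EigenIndex S) : ℂ :=
  ⟪eigenbasis S i, shiftPow S 0 φ⟫_ℂ

theorem inner_shiftPow (j : ℕ) (φ : testSpace S) (i : EigenIndex S) :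
    ⟪eigenbasis S i, shiftPow S j φ⟫_ℂ = (1 + eigenvalue S i : ℂ) ^ j * coeff φ i := by
  induction j with
  | zero => simp [coeff]
  | succ j ih =>
    have h : ((shiftPow S (j + 1) φ - shiftPow S j φ : Ell2 n) : (Fin n → ℤ) → ℂ) =
        hamiltonian S (shiftPow S j φ) := by
      rw [lp.coeFn_sub, coe_shiftPow, coe_shiftPow, pow_succ', Module.End.mul_apply,
        LinearMap.add_apply, Module.End.one_apply]
      simp
    have h2 := inner_eigenbasis_hamiltonian h i
    rw [inner_sub_right, ih] at h2
    rw [pow_succ]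
    linear_combination h2

theorem coeff_hamiltonianTest (φ : testSpace S) (i : EigenIndex S) :
    coeff (hamiltonianTest S φ) i = (eigenvalue S i : ℂ) * coeff φ i := by
  refine inner_eigenbasis_hamiltonian ?_ i
  rw [coe_shiftPow, coe_shiftPow, pow_zero, Module.End.one_apply, Module.End.one_apply]
  rfl

theorem shiftPow_eigenTest (j : ℕ) (i : EigenIndex S) :
    shiftPow S j (eigenTest S i) = (1 + eigenvalue S i : ℂ) ^ j • eigenbasis S i := by
  induction j with
  | zero =>
    ext k
    rw [shiftPow_zero_apply]
    simp [eigenTest]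
  | succ j ih =>
    ext k
    rw [coe_shiftPow, pow_succ', Module.End.mul_apply, ← coe_shiftPow, ih, lp.coeFn_smul, map_smul,
      LinearMap.add_apply, hamiltonian_eigenbasis, lp.coeFn_smul, pow_succ]
    simp only [Module.End.one_apply, Pi.smul_apply, Pi.add_apply, smul_eq_mul]
    ring

theorem hasSum_shiftPow_sq (j : ℕ) (φ : testSpace S) :
    HasSum (fun i => ((1 + eigenvalue S i) ^ j * ‖coeff φ i‖) ^ 2) (‖shiftPow S j φ‖ ^ 2) := by
  have h := Complex.hasSum_re
    ((eigenbasis S).hasSum_inner_mul_inner (shiftPow S j φ) (shiftPow S j φ))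
  have e1 : (⟪shiftPow S j φ, shiftPow S j φ⟫_ℂ).re = ‖shiftPow S j φ‖ ^ 2 :=
    inner_self_eq_norm_sq (𝕜 := ℂ) _
  rw [e1] at h
  convert h using 2 with i
  have h0 : (0 : ℝ) ≤ 1 + eigenvalue S i := by linarith [eigenvalue_nonneg S i]
  have h1 : ‖(1 + eigenvalue S i : ℂ)‖ = 1 + eigenvalue S i := by
    rw [← Complex.ofReal_one, ← Complex.ofReal_add, Complex.norm_real, Real.norm_of_nonneg h0]
  rw [← inner_conj_symm, Complex.conj_mul', ← Complex.ofReal_pow, Complex.ofReal_re, inner_shiftPow,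
    norm_mul, norm_pow, h1]

/-! ### Eigenfunction expansion of distributions -/

theorem one_le_one_add_eigenvalue (i : EigenIndex S) : 1 ≤ 1 + eigenvalue S i := by
  linarith [eigenvalue_nonneg S i]

theorem rpow_le_natPow {x : ℝ} (hx : 1 ≤ x) {r : ℝ} {m : ℕ} (h : r ≤ m) : x ^ r ≤ x ^ m := by
  rw [← Real.rpow_natCast]
  exact Real.rpow_le_rpow_of_exponent_le hx h

/-- The coefficients of a test function decay faster than every power of `1 + λ`. -/
theorem summable_rpow_mul_coeff_sq (r : ℝ) (φ : testSpace S) :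
    Summable fun i => (1 + eigenvalue S i) ^ r * ‖coeff φ i‖ ^ 2 := by
  refine Summable.of_nonneg_of_le (fun i => ?_) (fun i => ?_)
    (hasSum_shiftPow_sq ⌈|r|⌉₊ φ).summable
  · have := one_le_one_add_eigenvalue i
    positivity
  · have h1 := one_le_one_add_eigenvalue i
    rw [mul_pow]
    refine mul_le_mul_of_nonneg_right ?_ (sq_nonneg _)
    refine (rpow_le_natPow h1 ((le_abs_self r).trans (Nat.le_ceil _))).trans ?_
    exact le_self_pow₀ (one_le_pow₀ h1) two_ne_zero

theorem rpow_mul_mul_le_add {x : ℝ} (hx : 1 ≤ x) (s p r : ℝ) :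
    p * r ≤ x ^ s * p ^ 2 + x ^ (-s) * r ^ 2 := by
  have h3 : 0 < x ^ s := Real.rpow_pos_of_pos (by linarith) _
  rw [Real.rpow_neg (by linarith)]
  set y := x ^ s
  have h5 : y * (y * p ^ 2 + y⁻¹ * r ^ 2 - p * r) = (y * p) ^ 2 + r ^ 2 - (y * p) * r := by
    field_simp
  have h6 : 0 ≤ (y * p) ^ 2 + r ^ 2 - (y * p) * r := by
    nlinarith [sq_nonneg (y * p - r), sq_nonneg (y * p), sq_nonneg r]
  rw [← h5] at h6
  linarith [nonneg_of_mul_nonneg_right h6 h3]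

theorem summable_mul_coeff {s : ℝ} {c : EigenIndex S → ℝ}
    (hc : Summable fun i => (1 + eigenvalue S i) ^ s * c i ^ 2) (φ : testSpace S) :
    Summable fun i => |c i| * ‖coeff φ i‖ := by
  refine Summable.of_nonneg_of_le (fun i => by positivity) (fun i => ?_)
    (hc.add (summable_rpow_mul_coeff_sq (-s) φ))
  rw [← sq_abs (c i)]
  exact rpow_mul_mul_le_add (one_le_one_add_eigenvalue i) s _ _

/-- A distribution is the sum of its eigenfunction expansion, because the eigenfunction expansion
of a test function converges in every test norm. -/
theorem hasSum_eigenTest (w : HDistribution S) (φ : testSpace S) :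
    HasSum (fun i => w (eigenTest S i) * (starRingEnd ℂ) (coeff φ i)) (w φ) := by
  obtain ⟨C, m, hw⟩ := w.bound
  set P : Finset (EigenIndex S) → testSpace S := fun s => ∑ i ∈ s, coeff φ i • eigenTest S i
    with hP
  have hC : ∀ χ : testSpace S, ‖w χ‖ ≤ |C| * ∑ j ∈ Finset.range (m + 1), ‖shiftPow S j χ‖ := by
    intro χ
    have h0 : 0 ≤ testNorm S m χ := (norm_nonneg _).trans (norm_shiftPow_le_testNorm le_rfl χ)
    exact (hw χ).trans ((mul_le_mul_of_nonneg_right (le_abs_self C) h0).trans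
      (mul_le_mul_of_nonneg_left (testNorm_le_sum m χ) (abs_nonneg C)))
  have hj : ∀ j, Filter.Tendsto (fun s => ‖shiftPow S j (P s - φ)‖) Filter.atTop (nhds 0) := by
    intro j
    have h := (eigenbasis S).hasSum_repr (shiftPow S j φ)
    have h2 := tendsto_iff_norm_sub_tendsto_zero.1 h
    refine h2.congr fun s => ?_
    rw [map_sub, hP, map_sum]
    congr 2
    refine Finset.sum_congr rfl fun i _ => ?_
    refine (congrArg (· • eigenbasis S i)
      ((eigenbasis S).repr_apply_apply (shiftPow S j φ) i)).trans ?_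
    simp only [map_smul, shiftPow_eigenTest, inner_shiftPow, smul_smul, mul_comm]
  have hsum : Filter.Tendsto
      (fun s => |C| * ∑ j ∈ Finset.range (m + 1), ‖shiftPow S j (P s - φ)‖)
      Filter.atTop (nhds 0) := by
    have := (tendsto_finsetSum (Finset.range (m + 1)) fun j _ => hj j).const_mul |C|
    simpa using this
  have hPw : ∀ s, w (P s) = ∑ i ∈ s, w (eigenTest S i) * (starRingEnd ℂ) (coeff φ i) := by
    intro s
    rw [hP, map_sum]
    refine Finset.sum_congr rfl fun i _ => ?_
    rw [w.toFun.map_smulₛₗ, smul_eq_mul, mul_comm]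
  rw [HasSum, tendsto_iff_norm_sub_tendsto_zero]
  refine squeeze_zero (fun _ => norm_nonneg _) (fun s => ?_) hsum
  rw [← hPw]
  have := hC (P s - φ)
  rwa [map_sub] at this

theorem HDistribution.ext_of_eigenTest {w w' : HDistribution S}
    (h : ∀ i, w (eigenTest S i) = w' (eigenTest S i)) : w = w' := by
  have h1 : w.toFun = w'.toFun := by
    ext φ
    refine (hasSum_eigenTest w φ).unique ?_
    simp only [h]
    exact hasSum_eigenTest w' φ
  cases w; cases w'; simp_all

/-- A family of coefficients with a finite Sobolev norm of some order defines a distribution. -/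
theorem exists_distribution_of_coeff {s : ℝ} {c : EigenIndex S → ℂ}
    (hc : Summable fun i => (1 + eigenvalue S i) ^ s * ‖c i‖ ^ 2) :
    ∃ w : HDistribution S, ∀ i, w (eigenTest S i) = c i := by
  set m : ℕ := ⌈|s|⌉₊ with hm
  have hx := fun i => one_le_one_add_eigenvalue (S := S) i
  have hpos : ∀ i, 0 < (1 + eigenvalue S i) ^ m := fun i => pow_pos (by linarith [hx i]) _
  have hmem : Memℓp (fun i => (((1 + eigenvalue S i) ^ m)⁻¹ : ℝ) * c i) 2 := by
    refine memℓp_gen (Summable.of_nonneg_of_le (fun i => by positivity) (fun i => ?_) hc)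
    have h1 : (((1 + eigenvalue S i) ^ m)⁻¹) ^ 2 ≤ (1 + eigenvalue S i) ^ s := by
      have h2 : ((1 + eigenvalue S i) ^ m)⁻¹ ≤ (1 + eigenvalue S i) ^ s := by
        rw [← Real.rpow_natCast, ← Real.rpow_neg (by linarith [hx i])]
        refine Real.rpow_le_rpow_of_exponent_le (hx i) ?_
        have := Nat.le_ceil |s|
        have := neg_abs_le s
        linarith
      refine le_trans ?_ h2
      exact pow_le_of_le_one (inv_pos.2 (hpos i)).le
        (inv_le_one_of_one_le₀ (one_le_pow₀ (hx i))) two_ne_zero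
    simp only [ENNReal.toReal_ofNat, Real.rpow_ofNat]
    rw [norm_mul, Complex.norm_real, Real.norm_of_nonneg (inv_pos.2 (hpos i)).le, mul_pow]
    exact mul_le_mul_of_nonneg_right h1 (sq_nonneg _)
  set e : Ell2 n := (eigenbasis S).repr.symm ⟨_, hmem⟩ with he
  have hei : ∀ i, ⟪eigenbasis S i, e⟫_ℂ = (((1 + eigenvalue S i) ^ m)⁻¹ : ℝ) * c i := by
    intro i
    rw [← HilbertBasis.repr_apply_apply, he, LinearIsometryEquiv.apply_symm_apply]
  refine ⟨⟨{ toFun := fun φ => ⟪shiftPow S m φ, e⟫_ℂ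
             map_add' := fun φ χ => by rw [map_add, inner_add_left]
             map_smul' := fun c φ => by rw [map_smul, inner_smul_left, smul_eq_mul] },
    ‖e‖, m, fun φ => ?_⟩, fun i => ?_⟩
  · refine (norm_inner_le_norm (𝕜 := ℂ) (shiftPow S m φ) e).trans ?_
    rw [mul_comm]
    exact mul_le_mul_of_nonneg_left (norm_shiftPow_le_testNorm le_rfl φ) (norm_nonneg _)
  · change ⟪shiftPow S m (eigenTest S i), e⟫_ℂ = c i
    rw [shiftPow_eigenTest, inner_smul_left, hei, ← mul_assoc]
    have h1 : (starRingEnd ℂ) ((1 + eigenvalue S i : ℂ) ^ m) =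
        (((1 + eigenvalue S i) ^ m : ℝ) : ℂ) := by
      simp
    rw [h1, ← Complex.ofReal_mul, mul_inv_cancel₀ (hpos i).ne']
    simp

theorem shiftPow_zero_delta (k : Fin n → ℤ) :
    shiftPow S 0 (delta S k) = lp.single 2 k (1 : ℂ) := by
  ext l
  rw [shiftPow_zero_apply, lp.single_apply]
  simp [delta]

theorem coeff_delta (k : Fin n → ℤ) (i : EigenIndex S) :
    coeff (delta S k) i = (starRingEnd ℂ) (eigenbasis S i k) := by
  classical
  rw [coeff, shiftPow_zero_delta, lp.inner_single_right]
  simp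

/-- The eigenbasis is countable, since at each lattice point only countably many eigenfunctions
are nonzero. -/
instance countable_eigenIndex : Countable (EigenIndex S) := by
  have h1 : ∀ k, {i : EigenIndex S | eigenbasis S i k ≠ 0}.Countable := by
    intro k
    refine (hasSum_shiftPow_sq 0 (delta S k)).summable.countable_support.mono fun i hi => ?_
    simpa [coeff_delta] using hi
  refine Set.countable_univ_iff.1 ((Set.countable_iUnion h1).mono fun i _ => ?_)
  rw [mem_iUnion]
  by_contra h
  push Not at h
  have h0 : eigenbasis S i = 0 := by
    ext k
    simpa using h k
  have := (eigenbasis S).orthonormal.1 i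
  rw [h0, norm_zero] at this
  exact zero_ne_one this

theorem hamiltonianTest_delta (k : Fin n → ℤ) : hamiltonianTest S (delta S k) =
    (-((S.hbar ^ 2 : ℝ) : ℂ)⁻¹) • ((∑ j : Fin n, (delta S (k + Pi.single j 1) +
      delta S (k - Pi.single j 1))) - ((2 * n : ℝ) : ℂ) • delta S k) +
      ((S.V k : ℝ) : ℂ) • delta S k := by
  ext l
  have hs : ∀ v : Fin n → ℤ, (Pi.single k 1 : (Fin n → ℤ) → ℂ) (l + v) =
      (Pi.single (k - v) 1 : (Fin n → ℤ) → ℂ) l := fun v => by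
    simp only [Pi.single_apply]
    congr 1
    rw [eq_sub_iff_add_eq]
  have hs' : ∀ v : Fin n → ℤ, (Pi.single k 1 : (Fin n → ℤ) → ℂ) (l - v) =
      (Pi.single (k + v) 1 : (Fin n → ℤ) → ℂ) l := fun v => by
    simp only [Pi.single_apply]
    congr 1
    rw [sub_eq_iff_eq_add]
  have hV : (S.V l : ℂ) * (Pi.single k 1 : (Fin n → ℤ) → ℂ) l =
      (S.V k : ℂ) * (Pi.single k 1 : (Fin n → ℤ) → ℂ) l := by
    by_cases h : l = k
    · rw [h]
    · simp [Pi.single_eq_of_ne h]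
  simp only [hamiltonianTest, hamiltonian, delta, LinearMap.coe_mk, AddHom.coe_mk, hs, hs', hV,
    Submodule.coe_add, Submodule.coe_smul, Submodule.coe_sub, Submodule.coe_sum, Pi.add_apply,
    Pi.smul_apply, Pi.sub_apply, Finset.sum_apply, smul_eq_mul]
  push_cast
  simp only [Finset.sum_add_distrib]
  ring

theorem hamiltonian_value (w : HDistribution S) (k : Fin n → ℤ) :
    hamiltonian S w.value k = w (hamiltonianTest S (delta S k)) := by
  rw [hamiltonianTest_delta]
  simp only [map_add, map_sub, map_sum, w.toFun.map_smulₛₗ, map_neg, map_inv₀, Complex.conj_ofReal,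
    smul_eq_mul]
  simp only [hamiltonian, LinearMap.coe_mk, AddHom.coe_mk, HDistribution.value]
  push_cast
  rfl

theorem sobolevNorm_sq (s : ℝ) (w : HDistribution S) : sobolevNorm s w ^ 2 =
    ∑' i, ENNReal.ofReal ((1 + eigenvalue S i) ^ s) * ‖w (eigenTest S i)‖ₑ ^ 2 := by
  rw [sobolevNorm, ← ENNReal.rpow_natCast, ← ENNReal.rpow_mul]
  norm_num

theorem l2SobolevNorm_sq (T s : ℝ) (u : ℝ → HDistribution S) : l2SobolevNorm T s u ^ 2 =
    ∫⁻ t in Icc 0 T, sobolevNorm s (u t) ^ 2 := by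
  rw [l2SobolevNorm, ← ENNReal.rpow_natCast, ← ENNReal.rpow_mul]
  norm_num

theorem ofReal_rpow_mul_enorm_sq (s : ℝ) (i : EigenIndex S) (z : ℂ) :
    ENNReal.ofReal ((1 + eigenvalue S i) ^ s) * ‖z‖ₑ ^ 2 =
      ENNReal.ofReal ((1 + eigenvalue S i) ^ s * ‖z‖ ^ 2) := by
  have := one_le_one_add_eigenvalue i
  rw [ENNReal.ofReal_mul (by positivity), ENNReal.ofReal_pow (norm_nonneg _), ofReal_norm]

theorem summable_of_memSobolev {s : ℝ} {w : HDistribution S} (hw : MemSobolev s w) :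
    Summable (fun i => (1 + eigenvalue S i) ^ s * ‖w (eigenTest S i)‖ ^ 2) := by
  have h : sobolevNorm s w ^ 2 ≠ ∞ := ENNReal.pow_ne_top hw.ne
  rw [sobolevNorm_sq] at h
  simp only [ofReal_rpow_mul_enorm_sq] at h
  have := ENNReal.summable_toReal h
  refine this.congr fun i => ?_
  have := one_le_one_add_eigenvalue i
  exact ENNReal.toReal_ofReal (by positivity)

/-! ### Regularisation of the source -/

/-- An element of `ℓ²`, as a distribution of the Schrödinger operator. -/
noncomputable def ofEll2 (S : ConfiningSchrodinger n) (g : Ell2 n) : HDistribution S where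
  toFun :=
    { toFun := fun φ => ⟪shiftPow S 0 φ, g⟫_ℂ
      map_add' := fun φ χ => by rw [map_add, inner_add_left]
      map_smul' := fun c φ => by rw [map_smul, inner_smul_left, smul_eq_mul] }
  bound := ⟨‖g‖, 0, fun φ => by
    refine (norm_inner_le_norm (𝕜 := ℂ) (shiftPow S 0 φ) g).trans ?_
    rw [mul_comm]
    exact mul_le_mul_of_nonneg_left (norm_shiftPow_le_testNorm le_rfl φ) (norm_nonneg _)⟩

theorem ofEll2_apply (g : Ell2 n) (φ : testSpace S) : ofEll2 S g φ = ⟪shiftPow S 0 φ, g⟫_ℂ := rfl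

theorem ofEll2_value (g : Ell2 n) (k : Fin n → ℤ) : (ofEll2 S g).value k = g k := by
  classical
  rw [HDistribution.value, ofEll2_apply, shiftPow_zero_delta, lp.inner_single_left]
  simp

theorem ofEll2_eigenTest (g : Ell2 n) (i : EigenIndex S) :
    ofEll2 S g (eigenTest S i) = ⟪eigenbasis S i, g⟫_ℂ := by
  rw [ofEll2_apply, shiftPow_eigenTest, pow_zero, one_smul]

/-- The squared Sobolev norm of the point mass at `k`. -/
noncomputable def deltaSobolevSq (S : ConfiningSchrodinger n) (s : ℝ) (k : Fin n → ℤ) : ℝ :=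
  ∑' i, (1 + eigenvalue S i) ^ s * ‖coeff (delta S k) i‖ ^ 2

theorem deltaSobolevSq_nonneg (s : ℝ) (k : Fin n → ℤ) : 0 ≤ deltaSobolevSq S s k :=
  tsum_nonneg fun i => by
    have := one_le_one_add_eigenvalue i
    positivity

theorem norm_inner_eigenbasis_sq_le {g : Ell2 n} {W : (Fin n → ℤ) → ℝ} (hg : ∀ k, ‖g k‖ ≤ W k)
    (hW : Summable W) (i : EigenIndex S) :
    (Summable fun k => W k * ‖coeff (delta S k) i‖ ^ 2) ∧
    ‖⟪eigenbasis S i, g⟫_ℂ‖ ^ 2 ≤ (∑' k, W k) * ∑' k, W k * ‖coeff (delta S k) i‖ ^ 2 := by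
  have hW0 : ∀ k, 0 ≤ W k := fun k => (norm_nonneg _).trans (hg k)
  have hle : ∀ k, ‖coeff (delta S k) i‖ ≤ 1 := fun k => by
    rw [coeff_delta, RCLike.norm_conj]
    refine (lp.norm_apply_le_norm two_ne_zero (eigenbasis S i) k).trans ?_
    rw [(eigenbasis S).orthonormal.1 i]
  have hsum : Summable fun k => W k * ‖coeff (delta S k) i‖ ^ 2 :=
    Summable.of_nonneg_of_le (fun k => mul_nonneg (hW0 k) (sq_nonneg _))
      (fun k => mul_le_of_le_one_right (hW0 k) (pow_le_one₀ (norm_nonneg _) (hle k))) hW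
  refine ⟨hsum, ?_⟩
  have e1 : ∀ k, (√(W k)) ^ (2 : ℝ) = W k := fun k => by
    rw [Real.rpow_two, Real.sq_sqrt (hW0 k)]
  have e2 : ∀ k, (√(W k) * ‖coeff (delta S k) i‖) ^ (2 : ℝ) = W k * ‖coeff (delta S k) i‖ ^ 2 :=
    fun k => by rw [Real.rpow_two, mul_pow, Real.sq_sqrt (hW0 k)]
  have hcs := Real.summable_and_inner_le_Lp_mul_Lq_tsum_of_nonneg
    (f := fun k => √(W k)) (g := fun k => √(W k) * ‖coeff (delta S k) i‖)
    Real.HolderConjugate.two_two (fun k => Real.sqrt_nonneg _) (fun k => by positivity)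
    (by simpa only [e1] using hW) (by simpa only [e2] using hsum)
  simp only [e1, e2, ← mul_assoc, Real.mul_self_sqrt (hW0 _), ← Real.sqrt_eq_rpow] at hcs
  have hin : ‖⟪eigenbasis S i, g⟫_ℂ‖ ≤ ∑' k, W k * ‖coeff (delta S k) i‖ := by
    rw [lp.inner_eq_tsum]
    refine tsum_of_norm_bounded hcs.1.hasSum fun k => ?_
    rw [coeff_delta, RCLike.norm_conj, mul_comm]
    refine (norm_inner_le_norm (𝕜 := ℂ) _ _).trans ?_
    exact mul_le_mul_of_nonneg_left (hg k) (norm_nonneg _)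
  have h3 := pow_le_pow_left₀ (norm_nonneg _) (hin.trans hcs.2) 2
  rwa [mul_pow, Real.sq_sqrt (tsum_nonneg hW0),
    Real.sq_sqrt (tsum_nonneg fun k => mul_nonneg (hW0 k) (sq_nonneg _))] at h3

/-- A function on the lattice with sufficiently fast decay lies in every given Sobolev space. -/
theorem sobolevNorm_ofEll2_sq_le {g : Ell2 n} {W : (Fin n → ℤ) → ℝ} (hg : ∀ k, ‖g k‖ ≤ W k)
    (hW : Summable W) {s : ℝ} (hWs : Summable fun k => W k * deltaSobolevSq S s k) :
    sobolevNorm s (ofEll2 S g) ^ 2 ≤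
      ENNReal.ofReal ((∑' k, W k) * ∑' k, W k * deltaSobolevSq S s k) := by
  have hW0 : ∀ k, 0 ≤ W k := fun k => (norm_nonneg _).trans (hg k)
  have hx : ∀ i, 0 ≤ (1 + eigenvalue S i) ^ s := fun i => by
    have := one_le_one_add_eigenvalue i
    positivity
  rw [sobolevNorm_sq]
  calc ∑' i, ENNReal.ofReal ((1 + eigenvalue S i) ^ s) * ‖ofEll2 S g (eigenTest S i)‖ₑ ^ 2
      ≤ ∑' i, ENNReal.ofReal (∑' k, W k) *
          ∑' k, ENNReal.ofReal (W k * ((1 + eigenvalue S i) ^ s * ‖coeff (delta S k) i‖ ^ 2)) := by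
        refine ENNReal.tsum_le_tsum fun i => ?_
        obtain ⟨h1, h2⟩ := norm_inner_eigenbasis_sq_le hg hW i
        have h3 : ∀ k, W k * ((1 + eigenvalue S i) ^ s * ‖coeff (delta S k) i‖ ^ 2) =
            (1 + eigenvalue S i) ^ s * (W k * ‖coeff (delta S k) i‖ ^ 2) := fun k => by ring
        simp only [h3]
        rw [ofReal_rpow_mul_enorm_sq, ofEll2_eigenTest,
          ← ENNReal.ofReal_tsum_of_nonneg
            (fun k => mul_nonneg (hx i) (mul_nonneg (hW0 k) (sq_nonneg _))) (h1.mul_left _),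
          tsum_mul_left, ← ENNReal.ofReal_mul (tsum_nonneg hW0)]
        refine ENNReal.ofReal_le_ofReal ?_
        rw [mul_left_comm]
        exact mul_le_mul_of_nonneg_left h2 (hx i)
    _ = ENNReal.ofReal ((∑' k, W k) * ∑' k, W k * deltaSobolevSq S s k) := by
        rw [ENNReal.tsum_mul_left, ENNReal.tsum_comm, ENNReal.ofReal_mul (tsum_nonneg hW0),
          ENNReal.ofReal_tsum_of_nonneg
            (fun k => mul_nonneg (hW0 k) (deltaSobolevSq_nonneg s k)) hWs]
        congr 2
        funext k
        rw [← ENNReal.ofReal_tsum_of_nonneg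
          (fun i => mul_nonneg (hW0 k) (mul_nonneg (hx i) (sq_nonneg _)))
          ((summable_rpow_mul_coeff_sq s (delta S k)).mul_left _), tsum_mul_left]
        rfl

/-- Mollification at a sufficiently slow scale, given by a power of `ε`, grows at most like a
prescribed multiple of `ε⁻¹`. -/
theorem exists_scale_mollify_le {T : ℝ} {A : 𝓓'((⊤ : TopologicalSpace.Opens ℝ), ℂ)}
    (hA : dsupport A ⊆ Icc 0 T) (ψ : LineTest) {w : ℝ} (hw : 0 < w) :
    ∃ ω : ℝ → ℝ, (∀ ε ∈ Ioc (0 : ℝ) 1, 0 < ω ε) ∧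
      Filter.Tendsto ω (nhdsWithin 0 (Ioi 0)) (nhds 0) ∧
      ∀ ε ∈ Ioc (0 : ℝ) 1, ∀ t, ‖mollify A ψ (ω ε) t‖ ≤ w * ε⁻¹ := by
  obtain ⟨C, N, hC, h⟩ := exists_bound_mollify hA
  obtain ⟨P, hP, hψ⟩ := exists_bound_iteratedDeriv ψ N
  set D := max 1 (2 * (C * P) / w) with hD
  have hD1 : 1 ≤ D := le_max_left _ _
  have hN : (0 : ℝ) < N + 1 := by positivity
  have hpos : ∀ ε ∈ Ioc (0 : ℝ) 1, 0 < D * ε ^ ((N : ℝ) + 1)⁻¹ := fun ε hε => by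
    have := hε.1
    positivity
  refine ⟨fun ε => D * ε ^ ((N : ℝ) + 1)⁻¹, hpos, ?_, fun ε hε t => ?_⟩
  · have h1 : Filter.Tendsto (fun ε : ℝ => D * ε ^ ((N : ℝ) + 1)⁻¹) (nhds 0)
        (nhds (D * 0 ^ ((N : ℝ) + 1)⁻¹)) :=
      ((Real.continuousAt_rpow_const 0 _ (Or.inr (by positivity))).const_mul D)
    rw [Real.zero_rpow (by positivity), mul_zero] at h1
    exact h1.mono_left nhdsWithin_le_nhds
  · have hε0 := hε.1
    set ω := D * ε ^ ((N : ℝ) + 1)⁻¹ with hω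
    have hω0 : 0 < ω := hpos ε hε
    set r := ε ^ ((N : ℝ) + 1)⁻¹ with hr
    have hr0 : 0 < r := Real.rpow_pos_of_pos hε0 _
    have hr1 : r ≤ 1 := Real.rpow_le_one hε0.le hε.2 (by positivity)
    have hrN : r ^ (N + 1) = ε := by
      rw [hr, ← Real.rpow_natCast, ← Real.rpow_mul hε0.le]
      push_cast
      rw [inv_mul_cancel₀ hN.ne', Real.rpow_one]
    have hrε : ε ≤ r := by
      rw [← hrN]
      exact pow_le_of_le_one hr0.le hr1 (Nat.succ_ne_zero N)
    have hDi : D⁻¹ ≤ 1 := inv_le_one_of_one_le₀ hD1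
    have hDi0 : 0 ≤ D⁻¹ := by positivity
    have b1 : ω⁻¹ ≤ D⁻¹ * ε⁻¹ := by
      rw [hω, mul_inv]
      exact mul_le_mul_of_nonneg_left (inv_anti₀ hε0 hrε) hDi0
    have b2 : (ω⁻¹) ^ (N + 1) ≤ D⁻¹ * ε⁻¹ := by
      rw [hω, mul_inv, mul_pow, inv_pow r, hrN]
      exact mul_le_mul_of_nonneg_right (pow_le_of_le_one hDi0 hDi (Nat.succ_ne_zero N))
        (inv_nonneg.2 hε0.le)
    have b3 : 2 * (C * P) * D⁻¹ ≤ w := by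
      rw [← div_eq_mul_inv, div_le_iff₀ (by positivity)]
      have := le_max_right 1 (2 * (C * P) / w)
      rw [div_le_iff₀ hw] at this
      linarith
    calc ‖mollify A ψ ω t‖ ≤ C * P * (ω⁻¹ + (ω⁻¹) ^ (N + 1)) := h ψ P ω t hω0 hψ
      _ ≤ C * P * (D⁻¹ * ε⁻¹ + D⁻¹ * ε⁻¹) :=
        mul_le_mul_of_nonneg_left (add_le_add b1 b2) (mul_nonneg hC hP)
      _ = 2 * (C * P) * D⁻¹ * ε⁻¹ := by ring
      _ ≤ w * ε⁻¹ := mul_le_mul_of_nonneg_right b3 (inv_nonneg.2 hε0.le)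

theorem continuous_ofEll2 {G : ℝ → Ell2 n} {W : (Fin n → ℤ) → ℝ} (hW : Summable W)
    (hG : ∀ t k, ‖G t k‖ ≤ W k) (hc : ∀ k, Continuous fun t => G t k) (φ : testSpace S) :
    Continuous fun t => ofEll2 S (G t) φ := by
  simp only [ofEll2_apply, lp.inner_eq_tsum]
  refine continuous_tsum (u := fun k => ‖shiftPow S 0 φ‖ * W k) (fun k => ?_) (hW.mul_left _)
    fun k t => ?_
  · exact continuous_const.inner (hc k)
  · refine (norm_inner_le_norm (𝕜 := ℂ) _ _).trans ?_
    exact mul_le_mul (lp.norm_apply_le_norm two_ne_zero _ k) (hG t k) (norm_nonneg _)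
      (norm_nonneg _)

/-- The mollification scale may depend on the lattice point. Choosing it slow enough, the
regularised source is of size `w k * ε⁻¹` at the point `k`, for summable weights `w` that also
compensate the Sobolev norms of the point masses. -/
theorem exists_source_regularisation {T : ℝ} (s : ℝ) (S : ConfiningSchrodinger n)
    {f : (Fin n → ℤ) → 𝓓'((⊤ : TopologicalSpace.Opens ℝ), ℂ)}
    (hf : ∀ k, dsupport (f k) ⊆ Icc 0 T) :
    ∃ fε : ℝ → ℝ → HDistribution S, IsModerateSourceRegularisation T s f fε := by
  classical
  obtain ⟨ψ, hψ0, hψ1, -⟩ := exists_even_mollifier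
  have : Encodable (Fin n → ℤ) := Encodable.ofCountable _
  obtain ⟨p, hp0, c, hpc, -⟩ := posSumOfEncodable one_pos (Fin n → ℤ)
  set w : (Fin n → ℤ) → ℝ := fun k => p k / (1 + deltaSobolevSq S s k) with hw
  have hD0 := fun k => deltaSobolevSq_nonneg (S := S) s k
  have hw0 : ∀ k, 0 < w k := fun k => div_pos (hp0 k) (by linarith [hD0 k])
  have hws : Summable w := Summable.of_nonneg_of_le (fun k => (hw0 k).le)
    (fun k => div_le_self (hp0 k).le (by linarith [hD0 k])) hpc.summable
  have hwD : Summable fun k => w k * deltaSobolevSq S s k :=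
    Summable.of_nonneg_of_le (fun k => mul_nonneg (hw0 k).le (hD0 k)) (fun k => by
      rw [hw, div_mul_eq_mul_div, div_le_iff₀ (by linarith [hD0 k])]
      exact mul_le_mul_of_nonneg_left (by linarith) (hp0 k).le) hpc.summable
  choose ω hω0 hωt hωb using fun k => exists_scale_mollify_le (hf k) ψ (hw0 k)
  set F : ℝ → ℝ → (Fin n → ℤ) → ℂ := fun ε t k => mollify (f k) ψ (ω k ε) t with hF
  have hFmem : ∀ ε ∈ Ioc (0 : ℝ) 1, ∀ t, Memℓp (F ε t) 2 := fun ε hε t => by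
    have h1 : Memℓp (F ε t) 1 := by
      refine memℓp_gen ?_
      simp only [ENNReal.toReal_one, Real.rpow_one]
      exact Summable.of_nonneg_of_le (fun k => norm_nonneg _) (fun k => hωb k ε hε t)
        (hws.mul_right _)
    exact h1.of_exponent_ge (by norm_num)
  set G : ℝ → ℝ → Ell2 n := fun ε t => if h : Memℓp (F ε t) 2 then ⟨F ε t, h⟩ else 0 with hG
  have hGF : ∀ ε ∈ Ioc (0 : ℝ) 1, ∀ t k, G ε t k = mollify (f k) ψ (ω k ε) t := fun ε hε t k => by
    simp only [hG, dif_pos (hFmem ε hε t)]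
    rfl
  set K : ℝ := (∑' k, w k) * ∑' k, w k * deltaSobolevSq S s k with hK
  have hK0 : 0 ≤ K := mul_nonneg (tsum_nonneg fun k => (hw0 k).le)
    (tsum_nonneg fun k => mul_nonneg (hw0 k).le (hD0 k))
  have hsob : ∀ ε ∈ Ioc (0 : ℝ) 1, ∀ t,
      sobolevNorm s (ofEll2 S (G ε t)) ^ 2 ≤ ENNReal.ofReal (K * (ε⁻¹) ^ 2) := fun ε hε t => by
    have h := sobolevNorm_ofEll2_sq_le (S := S) (g := G ε t) (W := fun k => w k * ε⁻¹) (s := s)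
      (fun k => by rw [hGF ε hε]; exact hωb k ε hε t) (hws.mul_right _)
      ((hwD.mul_right ε⁻¹).congr fun k => by ring)
    refine h.trans_eq ?_
    have e : ∀ k, w k * ε⁻¹ * deltaSobolevSq S s k = w k * deltaSobolevSq S s k * ε⁻¹ :=
      fun k => by ring
    simp only [e, tsum_mul_right]
    congr 1
    rw [hK]
    ring
  have hbound : ∀ ε ∈ Ioc (0 : ℝ) 1, l2SobolevNorm T s (fun t => ofEll2 S (G ε t)) ≤
      ENNReal.ofReal ((√(|T| * K) + 1) * (ε ^ 1)⁻¹) := fun ε hε => by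
    have hε0 := hε.1
    rw [← ENNReal.pow_le_pow_left_iff two_ne_zero, l2SobolevNorm_sq]
    refine (setLIntegral_mono' measurableSet_Icc fun t _ => hsob ε hε t).trans ?_
    rw [setLIntegral_const, Real.volume_Icc, sub_zero, ← ENNReal.ofReal_mul (by positivity),
      ← ENNReal.ofReal_pow (by positivity)]
    refine ENNReal.ofReal_le_ofReal ?_
    rw [mul_pow, pow_one, mul_right_comm]
    refine mul_le_mul_of_nonneg_right ?_ (sq_nonneg _)
    have h1 : √(|T| * K) ^ 2 = |T| * K := Real.sq_sqrt (by positivity)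
    have h2 := Real.sqrt_nonneg (|T| * K)
    have h3 : K * T ≤ |T| * K := by
      rw [mul_comm]
      exact mul_le_mul_of_nonneg_right (le_abs_self T) hK0
    nlinarith
  refine ⟨fun ε t => ofEll2 S (G ε t), fun k => ⟨ψ, hψ0, hψ1, ω k, hω0 k, hωt k, fun ε hε t => ?_⟩,
    fun ε hε => ⟨fun φ => ?_, (hbound ε hε).trans_lt ENNReal.ofReal_lt_top⟩,
    1, √(|T| * K) + 1, by positivity, hbound⟩
  · exact (ofEll2_value _ k).trans (hGF ε hε t k)
  · refine (continuous_ofEll2 (W := fun k => w k * ε⁻¹) (hws.mul_right _) (fun t k => ?_)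
      (fun k => ?_) φ).aestronglyMeasurable
    · rw [hGF ε hε]; exact hωb k ε hε t
    · simp only [hGF ε hε]
      exact continuous_iff_continuousAt.2 fun t =>
        (hasDerivAt_mollify (hf k) ψ (hω0 k ε hε) t).continuousAt

/-! ### The Cauchy problem with regular coefficients -/

theorem hasDerivWithinAt_integral_of_continuousOn {T : ℝ} {h : ℝ → ℂ}
    (hh : ContinuousOn h (Icc 0 T)) {t : ℝ} (ht : t ∈ Icc 0 T) :
    HasDerivWithinAt (fun t => ∫ τ in (0 : ℝ)..t, h τ) (h t) (Icc 0 T) t := by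
  have hT : 0 ≤ T := ht.1.trans ht.2
  set g : ℝ → ℂ := IccExtend hT ((Icc 0 T).domRestrict h) with hg
  have hgc : Continuous g := hh.domRestrict.Icc_extend'
  have hgh : ∀ τ ∈ Icc 0 T, g τ = h τ := fun τ hτ => IccExtend_of_mem hT _ hτ
  have h1 := (intervalIntegral.integral_hasDerivAt_right (hgc.intervalIntegrable 0 t)
    hgc.stronglyMeasurable.stronglyMeasurableAtFilter hgc.continuousAt).hasDerivWithinAt
      (s := Icc 0 T)
  rw [hgh t ht] at h1
  have h2 : ∀ r ∈ Icc 0 T, ∫ τ in (0 : ℝ)..r, h τ = ∫ τ in (0 : ℝ)..r, g τ := fun r hr =>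
    intervalIntegral.integral_congr fun τ hτ => by
      rw [uIcc_of_le hr.1] at hτ
      exact (hgh τ ⟨hτ.1, hτ.2.trans hr.2⟩).symm
  exact h1.congr h2 (h2 t ht)

/-- Energy of the source, mode by mode. -/
theorem summable_energy_of_memL2Sobolev {T s : ℝ} (hT : 0 ≤ T) {f : ℝ → HDistribution S}
    (hf : MemL2Sobolev T s f) :
    (∀ i, MemLp (fun t => f t (eigenTest S i)) 2 (volume.restrict (Icc 0 T))) ∧
    ∑' i, ENNReal.ofReal ((1 + eigenvalue S i) ^ s *
      ∫ t in (0 : ℝ)..T, ‖f t (eigenTest S i)‖ ^ 2) = l2SobolevNorm T s f ^ 2 := by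
  have hmeas : ∀ i, AEMeasurable (fun t => ‖f t (eigenTest S i)‖ₑ ^ 2)
      (volume.restrict (Icc 0 T)) := fun i => (hf.1 (eigenTest S i)).enorm.pow_const 2
  have hx : ∀ i, 0 < (1 + eigenvalue S i) ^ s := fun i =>
    Real.rpow_pos_of_pos (by linarith [one_le_one_add_eigenvalue i]) _
  have hsum : l2SobolevNorm T s f ^ 2 = ∑' i, ENNReal.ofReal ((1 + eigenvalue S i) ^ s) *
      ∫⁻ t in Icc 0 T, ‖f t (eigenTest S i)‖ₑ ^ 2 := by
    rw [l2SobolevNorm_sq]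
    simp only [sobolevNorm_sq]
    rw [lintegral_tsum fun i => (hmeas i).const_mul _]
    exact tsum_congr fun i => lintegral_const_mul'' _ (hmeas i)
  have hfin : ∀ i, ∫⁻ t in Icc 0 T, ‖f t (eigenTest S i)‖ₑ ^ 2 < ∞ := fun i => by
    have h1 : ENNReal.ofReal ((1 + eigenvalue S i) ^ s) *
        ∫⁻ t in Icc 0 T, ‖f t (eigenTest S i)‖ₑ ^ 2 < ∞ :=
      lt_of_le_of_lt ((ENNReal.le_tsum i).trans_eq hsum.symm) (ENNReal.pow_lt_top hf.2)
    by_contra h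
    rw [not_lt_top_iff.1 h, ENNReal.mul_top (by simpa using hx i)] at h1
    exact lt_irrefl _ h1
  have hmem : ∀ i, MemLp (fun t => f t (eigenTest S i)) 2 (volume.restrict (Icc 0 T)) := fun i => by
    refine ⟨hf.1 _, ?_⟩
    rw [eLpNorm_lt_top_iff_lintegral_rpow_enorm_lt_top two_ne_zero ENNReal.ofNat_ne_top]
    simpa using hfin i
  refine ⟨hmem, ?_⟩
  rw [hsum]
  refine tsum_congr fun i => ?_
  rw [ENNReal.ofReal_mul (hx i).le, intervalIntegral.integral_of_le hT,
    ← integral_Icc_eq_integral_Ioc,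
    ofReal_integral_eq_lintegral_ofReal ((memLp_two_iff_integrable_sq_norm (hf.1 _)).1 (hmem i))
      (Filter.Eventually.of_forall fun t => sq_nonneg _)]
  congr 1
  refine lintegral_congr fun t => ?_
  rw [ENNReal.ofReal_pow (norm_nonneg _), ofReal_norm]

theorem continuousOn_apply_of_bound {s T : ℝ} {w : ℝ → HDistribution S} {c : EigenIndex S → ℝ}
    (hc : Summable fun i => (1 + eigenvalue S i) ^ s * c i ^ 2)
    (hw : ∀ t ∈ Icc 0 T, ∀ i, ‖w t (eigenTest S i)‖ ≤ |c i|)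
    (hwc : ∀ i, ContinuousOn (fun t => w t (eigenTest S i)) (Icc 0 T)) (φ : testSpace S) :
    ContinuousOn (fun t => w t φ) (Icc 0 T) := by
  have h : (fun t => w t φ) =
      fun t => ∑' i, w t (eigenTest S i) * (starRingEnd ℂ) (coeff φ i) :=
    funext fun t => (hasSum_eigenTest (w t) φ).tsum_eq.symm
  rw [h]
  refine continuousOn_tsum (fun i => (hwc i).mul continuousOn_const) (summable_mul_coeff hc φ)
    fun i t ht => ?_
  rw [norm_mul, RCLike.norm_conj]
  exact mul_le_mul_of_nonneg_right (hw t ht i) (norm_nonneg _)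

/-- Tested against `φ`, a distribution-valued function may be integrated in time mode by mode,
provided that its modes are dominated by summable energies. -/
theorem hasSum_integral_modes {T t : ℝ} (ht : t ∈ Icc 0 T) {F : EigenIndex S → ℝ → ℂ}
    {G : ℝ → ℂ} {B : EigenIndex S → ℝ → ℝ}
    (hF : ∀ i, IntervalIntegrable (F i) volume 0 T) (hB : ∀ i, IntervalIntegrable (B i) volume 0 T)
    (hFB : ∀ i, ∀ τ ∈ Icc 0 T, ‖F i τ‖ ≤ B i τ) (hBs : Summable fun i => ∫ τ in (0 : ℝ)..T, B i τ)
    (hG : ∀ τ ∈ Icc 0 T, HasSum (fun i => F i τ) (G τ)) :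
    HasSum (fun i => ∫ τ in (0 : ℝ)..t, F i τ) (∫ τ in (0 : ℝ)..t, G τ) := by
  have hT : 0 ≤ T := ht.1.trans ht.2
  have hsub : uIcc 0 t ⊆ uIcc 0 T := by
    rw [uIcc_of_le ht.1, uIcc_of_le hT]
    exact Icc_subset_Icc_right ht.2
  have hFt : ∀ i, IntervalIntegrable (F i) volume 0 t := fun i => (hF i).mono_set hsub
  have hBt : ∀ i, IntervalIntegrable (B i) volume 0 t := fun i => (hB i).mono_set hsub
  have hB0 : ∀ i, ∀ τ ∈ Icc 0 T, 0 ≤ B i τ := fun i τ hτ => (norm_nonneg _).trans (hFB i τ hτ)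
  have key := hasSum_integral_of_summable_integral_norm (μ := volume.restrict (Ioc 0 t)) (F := F)
    (fun i => (intervalIntegrable_iff_integrableOn_Ioc_of_le ht.1).1 (hFt i)) ?_
  · rw [setIntegral_congr_fun measurableSet_Ioc
      (g := G) fun τ hτ => (hG τ ⟨hτ.1.le, hτ.2.trans ht.2⟩).tsum_eq] at key
    simpa only [intervalIntegral.integral_of_le ht.1] using key
  · refine Summable.of_nonneg_of_le (fun i => integral_nonneg fun τ => norm_nonneg _) (fun i => ?_)
      hBs
    rw [← intervalIntegral.integral_of_le ht.1]
    calc ∫ τ in (0 : ℝ)..t, ‖F i τ‖ ≤ ∫ τ in (0 : ℝ)..t, B i τ :=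
          intervalIntegral.integral_mono_on ht.1 (hFt i).norm (hBt i)
            fun τ hτ => hFB i τ ⟨hτ.1, hτ.2.trans ht.2⟩
      _ ≤ ∫ τ in (0 : ℝ)..T, B i τ := by
          refine intervalIntegral.integral_mono_interval le_rfl ht.1 ht.2 ?_ (hB i)
          refine (ae_restrict_iff' measurableSet_Ioc).2 (Filter.Eventually.of_forall fun τ hτ => ?_)
          exact hB0 i τ ⟨hτ.1.le, hτ.2⟩

/-- The Cauchy problem with regular coefficients is solved mode by mode: the energy estimates of the
modes, summed with the weights `(1 + λ) ^ s`, show that the modes are the coefficients of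
distributions in `H^(1 + s)` and `H^s`. -/
theorem exists_solution {T α M s : ℝ} (hT : 0 < T) (hα : 0 < α) {a a' q : ℝ → ℝ}
    (ha : ∀ t, HasDerivAt a (a' t) t) (hq : Continuous q) (haα : ∀ t ∈ Icc 0 T, α ≤ a t)
    (haq : ∀ t ∈ Icc 0 T, |a t - q t| ≤ M) (ha' : ∀ t ∈ Icc 0 T, |a' t| ≤ M)
    {f : ℝ → HDistribution S} (hf : MemL2Sobolev T s f)
    (hfc : ∀ k, Continuous fun t => (f t).value k)
    {u₀ u₁ : HDistribution S} (hu₀ : MemSobolev (1 + s) u₀) (hu₁ : MemSobolev s u₁) :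
    ∃ u, IsSolution T a q f u₀ u₁ u ∧ (∀ φ, ContinuousOn (fun t => u t φ) (Icc 0 T)) ∧
      ∀ t ∈ Icc 0 T, sobolevNorm (1 + s) (u t) ^ 2 ≤
        ENNReal.ofReal (Real.exp ((1 + M + 2 * M / α) * T) / α) *
          (sobolevNorm s u₁ ^ 2 + ENNReal.ofReal (a 0) * sobolevNorm (1 + s) u₀ ^ 2 +
            l2SobolevNorm T s f ^ 2) := by
  have h0T : (0 : ℝ) ∈ Icc 0 T := ⟨le_rfl, hT.le⟩
  have hac : Continuous a := continuous_iff_continuousAt.2 fun t => (ha t).continuousAt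
  have ha0 : 0 < a 0 := hα.trans_le (haα 0 h0T)
  have hx1 := fun i : EigenIndex S => one_le_one_add_eigenvalue i
  have hx0 : ∀ i : EigenIndex S, 0 < 1 + eigenvalue S i := fun i => by linarith [hx1 i]
  have hxs : ∀ r : ℝ, ∀ i : EigenIndex S, 0 < (1 + eigenvalue S i) ^ r :=
    fun r i => Real.rpow_pos_of_pos (hx0 i) _
  have hxx : ∀ i : EigenIndex S,
      (1 + eigenvalue S i) ^ (1 + s) = (1 + eigenvalue S i) * (1 + eigenvalue S i) ^ s :=
    fun i => by rw [Real.rpow_add (hx0 i), Real.rpow_one]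
  obtain ⟨hgm, hE⟩ := summable_energy_of_memL2Sobolev hT.le hf
  set g : EigenIndex S → ℝ → ℂ := fun i t => f t (eigenTest S i) with hg
  have hgi := fun i => intervalIntegrable_of_memLp_two hT.le (hgm i)
  set E : EigenIndex S → ℝ := fun i => ∫ t in (0 : ℝ)..T, ‖g i t‖ ^ 2 with hEdef
  have hE0 : ∀ i, 0 ≤ E i := fun i =>
    intervalIntegral.integral_nonneg hT.le fun t _ => sq_nonneg _
  have hEs : Summable fun i => (1 + eigenvalue S i) ^ s * E i := by
    have h1 : ∑' i, ENNReal.ofReal ((1 + eigenvalue S i) ^ s * E i) ≠ ∞ := by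
      rw [hE]; exact ENNReal.pow_ne_top hf.2.ne
    exact (ENNReal.summable_toReal h1).congr fun i =>
      ENNReal.toReal_ofReal (mul_nonneg (hxs s i).le (hE0 i))
  choose y v hy0 hv0 hvc hyd hvi hen using fun i : EigenIndex S =>
    exists_mode hT hα (eigenvalue_nonneg S i) ha hq haα haq ha' (hgm i)
      (u₀ (eigenTest S i)) (u₁ (eigenTest S i))
  set K := Real.exp ((1 + M + 2 * M / α) * T) with hK
  have hKpos : 0 < K := Real.exp_pos _
  set R : EigenIndex S → ℝ := fun i => ‖u₁ (eigenTest S i)‖ ^ 2 +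
    a 0 * (1 + eigenvalue S i) * ‖u₀ (eigenTest S i)‖ ^ 2 + E i with hR
  have hR0 : ∀ i, 0 ≤ R i := fun i => by
    have := hE0 i
    have := hx0 i
    positivity
  have hRs : ∀ i, (1 + eigenvalue S i) ^ s * R i =
      (1 + eigenvalue S i) ^ s * ‖u₁ (eigenTest S i)‖ ^ 2 +
        a 0 * ((1 + eigenvalue S i) ^ (1 + s) * ‖u₀ (eigenTest S i)‖ ^ 2) +
        (1 + eigenvalue S i) ^ s * E i := fun i => by rw [hxx, hR]; ring
  have hRsum : Summable fun i => (1 + eigenvalue S i) ^ s * R i := by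
    simp only [hRs]
    exact ((summable_of_memSobolev hu₁).add ((summable_of_memSobolev hu₀).mul_left _)).add hEs
  have hvb : ∀ i, ∀ t ∈ Icc 0 T, ‖v i t‖ ^ 2 ≤ K * R i := fun i t ht => by
    have h1 := hen i t ht
    have h2 : 0 ≤ a t * (1 + eigenvalue S i) * ‖y i t‖ ^ 2 := by
      have := hα.trans_le (haα t ht)
      have := hx0 i
      positivity
    linarith
  have hyb : ∀ i, ∀ t ∈ Icc 0 T, ‖y i t‖ ^ 2 ≤ K / α * R i / (1 + eigenvalue S i) :=
    fun i t ht => by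
    have h1 := hen i t ht
    have h2 : α * (1 + eigenvalue S i) * ‖y i t‖ ^ 2 ≤
        a t * (1 + eigenvalue S i) * ‖y i t‖ ^ 2 :=
      mul_le_mul_of_nonneg_right (mul_le_mul_of_nonneg_right (haα t ht) (hx0 i).le) (sq_nonneg _)
    rw [le_div_iff₀ (hx0 i), div_mul_eq_mul_div, le_div_iff₀ hα]
    have h3 := sq_nonneg ‖v i t‖
    linarith
  set c : EigenIndex S → ℝ := fun i => √(K * R i) with hc
  set d : EigenIndex S → ℝ := fun i => √(K / α * R i / (1 + eigenvalue S i)) with hd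
  have hc2 : ∀ i, c i ^ 2 = K * R i := fun i => Real.sq_sqrt (mul_nonneg hKpos.le (hR0 i))
  have hd2 : ∀ i, d i ^ 2 = K / α * R i / (1 + eigenvalue S i) := fun i =>
    Real.sq_sqrt (div_nonneg (mul_nonneg (div_pos hKpos hα).le (hR0 i)) (hx0 i).le)
  have hcs : Summable fun i => (1 + eigenvalue S i) ^ s * c i ^ 2 := by
    refine (hRsum.mul_left K).congr fun i => ?_
    rw [hc2]; ring
  have hds' : ∀ i, (1 + eigenvalue S i) ^ (1 + s) * d i ^ 2 =
      K / α * ((1 + eigenvalue S i) ^ s * R i) := fun i => by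
    rw [hd2, hxx]
    have := (hx0 i).ne'
    field_simp
  have hds : Summable fun i => (1 + eigenvalue S i) ^ (1 + s) * d i ^ 2 := by
    simp only [hds']
    exact hRsum.mul_left _
  have hvc' : ∀ i, ∀ t ∈ Icc 0 T, ‖v i t‖ ≤ |c i| := fun i t ht => by
    rw [← Real.sqrt_sq (norm_nonneg (v i t)), abs_of_nonneg (Real.sqrt_nonneg _)]
    exact Real.sqrt_le_sqrt (hvb i t ht)
  have hyd' : ∀ i, ∀ t ∈ Icc 0 T, ‖y i t‖ ≤ |d i| := fun i t ht => by
    rw [← Real.sqrt_sq (norm_nonneg (y i t)), abs_of_nonneg (Real.sqrt_nonneg _)]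
    exact Real.sqrt_le_sqrt (hyb i t ht)
  have hyc : ∀ i, ContinuousOn (y i) (Icc 0 T) := fun i t ht => (hyd i t ht).continuousWithinAt
  -- off `[0, T]` the functions `U` and `V` are irrelevant, and take arbitrary values
  have hVex : ∀ t, ∃ w : HDistribution S, t ∈ Icc 0 T → ∀ i, w (eigenTest S i) = v i t := by
    intro t
    by_cases ht : t ∈ Icc 0 T
    · obtain ⟨w, hw⟩ := exists_distribution_of_coeff (s := s) (c := fun i => v i t)
        (Summable.of_nonneg_of_le (fun i => mul_nonneg (hxs s i).le (sq_nonneg _)) (fun i => by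
          rw [hc2 i]; exact mul_le_mul_of_nonneg_left (hvb i t ht) (hxs s i).le) hcs)
      exact ⟨w, fun _ => hw⟩
    · exact ⟨u₁, fun h => absurd h ht⟩
  have hUex : ∀ t, ∃ w : HDistribution S, t ∈ Icc 0 T → ∀ i, w (eigenTest S i) = y i t := by
    intro t
    by_cases ht : t ∈ Icc 0 T
    · obtain ⟨w, hw⟩ := exists_distribution_of_coeff (s := 1 + s) (c := fun i => y i t)
        (Summable.of_nonneg_of_le (fun i => mul_nonneg (hxs _ i).le (sq_nonneg _)) (fun i => by
          rw [hd2 i]; exact mul_le_mul_of_nonneg_left (hyb i t ht) (hxs _ i).le) hds)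
      exact ⟨w, fun _ => hw⟩
    · exact ⟨u₀, fun h => absurd h ht⟩
  choose V hV using hVex
  choose U hU using hUex
  have hU0 : U 0 = u₀ := HDistribution.ext_of_eigenTest fun i => by rw [hU 0 h0T, hy0]
  have hV0 : V 0 = u₁ := HDistribution.ext_of_eigenTest fun i => by rw [hV 0 h0T, hv0]
  have hUc : ∀ φ, ContinuousOn (fun t => U t φ) (Icc 0 T) :=
    continuousOn_apply_of_bound hds (fun t ht i => by rw [hU t ht]; exact hyd' i t ht)
      fun i => (hyc i).congr fun t ht => hU t ht i
  have hVc : ∀ φ, ContinuousOn (fun t => V t φ) (Icc 0 T) :=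
    continuousOn_apply_of_bound hcs (fun t ht i => by rw [hV t ht]; exact hvc' i t ht)
      fun i => (hvc i).congr fun t ht => hV t ht i
  have hUi : ∀ φ, ∀ t ∈ Icc 0 T, U t φ = u₀ φ + ∫ τ in (0 : ℝ)..t, V τ φ := by
    intro φ t ht
    have h1 := hasSum_integral_modes ht (F := fun i τ => v i τ * (starRingEnd ℂ) (coeff φ i))
      (G := fun τ => V τ φ) (B := fun i _ => |c i| * ‖coeff φ i‖)
      (fun i => ContinuousOn.intervalIntegrable
        (by rw [uIcc_of_le hT.le]; exact (hvc i).mul continuousOn_const))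
      (fun i => intervalIntegrable_const)
      (fun i τ hτ => by
        rw [norm_mul, RCLike.norm_conj]
        exact mul_le_mul_of_nonneg_right (hvc' i τ hτ) (norm_nonneg _))
      (by simpa only [intervalIntegral.integral_const] using
        (summable_mul_coeff hcs φ).const_smul (T - 0))
      (fun τ hτ => by simpa only [hV τ hτ] using hasSum_eigenTest (V τ) φ)
    refine (hasSum_eigenTest (U t) φ).unique ?_
    convert (hasSum_eigenTest u₀ φ).add h1 using 2 with i
    rw [intervalIntegral.integral_mul_const, ← add_mul, hU t ht]
    congr 1
    have h2 := intervalIntegral.integral_eq_sub_of_hasDerivAt_of_le ht.1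
      ((hyc i).mono (Icc_subset_Icc_right ht.2))
      (fun τ hτ => (hyd i τ ⟨hτ.1.le, hτ.2.le.trans ht.2⟩).hasDerivAt
        (Icc_mem_nhds hτ.1 (hτ.2.trans_le ht.2)))
      (ContinuousOn.intervalIntegrable
        (by rw [uIcc_of_le ht.1]; exact (hvc i).mono (Icc_subset_Icc_right ht.2)))
    rw [h2, hy0]
    ring
  have hVi : ∀ φ, ∀ t ∈ Icc 0 T, V t φ = u₁ φ +
      ∫ τ in (0 : ℝ)..t, (f τ φ - a τ * U τ (hamiltonianTest S φ) - q τ * U τ φ) := by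
    intro φ t ht
    obtain ⟨A, hA⟩ := isCompact_Icc.exists_bound_of_continuousOn (hac.continuousOn (s := Icc 0 T))
    obtain ⟨Q, hQ⟩ := isCompact_Icc.exists_bound_of_continuousOn (hq.continuousOn (s := Icc 0 T))
    have hsum : ∀ τ ∈ Icc 0 T, HasSum (fun i => g i τ * (starRingEnd ℂ) (coeff φ i) -
        a τ * (y i τ * (starRingEnd ℂ) (coeff (hamiltonianTest S φ) i)) -
        q τ * (y i τ * (starRingEnd ℂ) (coeff φ i)))
        (f τ φ - a τ * U τ (hamiltonianTest S φ) - q τ * U τ φ) := by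
      intro τ hτ
      have h1 := hasSum_eigenTest (f τ) φ
      have h2 := hasSum_eigenTest (U τ) (hamiltonianTest S φ)
      have h3 := hasSum_eigenTest (U τ) φ
      simp only [hU τ hτ] at h2 h3
      exact (h1.sub (h2.mul_left _)).sub (h3.mul_left _)
    have hcont : ∀ (b : ℝ → ℝ), Continuous b → ∀ i (z : ℂ),
        IntervalIntegrable (fun τ => (b τ : ℂ) * (y i τ * z)) volume 0 T := fun b hb i z => by
      refine ContinuousOn.intervalIntegrable ?_
      rw [uIcc_of_le hT.le]
      exact (Complex.continuous_ofReal.comp hb).continuousOn.mul ((hyc i).mul continuousOn_const)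
    have h1 := hasSum_integral_modes ht
      (B := fun i τ => ((1 + eigenvalue S i) ^ s * ‖g i τ‖ ^ 2 +
        (1 + eigenvalue S i) ^ (-s) * ‖coeff φ i‖ ^ 2) +
        (A * (|d i| * ‖coeff (hamiltonianTest S φ) i‖) + Q * (|d i| * ‖coeff φ i‖)))
      (fun i => (((hgi i).1.mul_const _).sub (hcont a hac i _)).sub (hcont q hq i _))
      (fun i => (((hgi i).2.const_mul _).add intervalIntegrable_const).add
        intervalIntegrable_const)
      (fun i τ hτ => ?_) ?_ hsum
    · refine (hasSum_eigenTest (V t) φ).unique ?_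
      convert (hasSum_eigenTest u₁ φ).add h1 using 2 with i
      rw [hV t ht, hvi i t ht, add_mul, ← intervalIntegral.integral_mul_const]
      congr 2
      funext τ
      rw [coeff_hamiltonianTest, map_mul, Complex.conj_ofReal]
      ring
    -- the source is only square integrable in time, hence the splitting of its product with the
    -- test function into squares
    · have e1 : ‖g i τ * (starRingEnd ℂ) (coeff φ i)‖ ≤ (1 + eigenvalue S i) ^ s * ‖g i τ‖ ^ 2 +
          (1 + eigenvalue S i) ^ (-s) * ‖coeff φ i‖ ^ 2 := by
        rw [norm_mul, RCLike.norm_conj]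
        exact rpow_mul_mul_le_add (hx1 i) s _ _
      have e2 : ∀ (b : ℝ) (B : ℝ) (z : ℂ), ‖b‖ ≤ B →
          ‖(b : ℂ) * (y i τ * (starRingEnd ℂ) z)‖ ≤ B * (|d i| * ‖z‖) := fun b B z hb => by
        rw [norm_mul, norm_mul, RCLike.norm_conj, Complex.norm_real]
        exact mul_le_mul hb (mul_le_mul_of_nonneg_right (hyd' i τ hτ) (norm_nonneg _))
          (by positivity) ((norm_nonneg _).trans hb)
      have e3 := e2 (a τ) A (coeff (hamiltonianTest S φ) i) (hA τ hτ)
      have e4 := e2 (q τ) Q (coeff φ i) (hQ τ hτ)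
      refine (norm_sub_le _ _).trans ?_
      refine (add_le_add (norm_sub_le _ _) le_rfl).trans ?_
      linarith
    · have e : ∀ i, ∫ τ in (0 : ℝ)..T, (((1 + eigenvalue S i) ^ s * ‖g i τ‖ ^ 2 +
          (1 + eigenvalue S i) ^ (-s) * ‖coeff φ i‖ ^ 2) +
          (A * (|d i| * ‖coeff (hamiltonianTest S φ) i‖) + Q * (|d i| * ‖coeff φ i‖))) =
          (1 + eigenvalue S i) ^ s * E i +
          T * ((1 + eigenvalue S i) ^ (-s) * ‖coeff φ i‖ ^ 2) +
          T * (A * (|d i| * ‖coeff (hamiltonianTest S φ) i‖) + Q * (|d i| * ‖coeff φ i‖)) := by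
        intro i
        rw [intervalIntegral.integral_add
          (((hgi i).2.const_mul _).add intervalIntegrable_const) intervalIntegrable_const,
          intervalIntegral.integral_add ((hgi i).2.const_mul _) intervalIntegrable_const,
          intervalIntegral.integral_const_mul, intervalIntegral.integral_const,
          intervalIntegral.integral_const, sub_zero, smul_eq_mul, smul_eq_mul]
      simp only [e]
      exact (hEs.add ((summable_rpow_mul_coeff_sq (-s) φ).mul_left T)).add
        ((((summable_mul_coeff hds _).mul_left A).add
          ((summable_mul_coeff hds φ).mul_left Q)).mul_left T)
  refine ⟨U, ⟨hU0, V, hV0, fun φ t ht => ?_, fun k t ht => ?_, hVi⟩, hUc, fun t ht => ?_⟩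
  · exact ((hasDerivWithinAt_integral_of_continuousOn (hVc φ) ht).const_add (u₀ φ)).congr
      (hUi φ) (hUi φ t ht)
  · have ht' : t ∈ Icc 0 T := ⟨ht.1.le, ht.2⟩
    have hcont : ContinuousOn (fun τ => f τ (delta S k) -
        a τ * U τ (hamiltonianTest S (delta S k)) - q τ * U τ (delta S k)) (Icc 0 T) :=
      ((hfc k).continuousOn.sub ((Complex.continuous_ofReal.comp hac).continuousOn.mul
        (hUc _))).sub ((Complex.continuous_ofReal.comp hq).continuousOn.mul (hUc _))
    have h := ((hasDerivWithinAt_integral_of_continuousOn hcont ht').const_add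
      (u₁ (delta S k))).congr (hVi (delta S k)) (hVi (delta S k) t ht')
    rw [hamiltonian_value]
    exact h
  · calc sobolevNorm (1 + s) (U t) ^ 2
        ≤ ∑' i, ENNReal.ofReal (K / α * ((1 + eigenvalue S i) ^ s * R i)) := by
          rw [sobolevNorm_sq]
          refine ENNReal.tsum_le_tsum fun i => ?_
          rw [ofReal_rpow_mul_enorm_sq, hU t ht, ← hds', hd2]
          exact ENNReal.ofReal_le_ofReal (mul_le_mul_of_nonneg_left (hyb i t ht) (hxs _ i).le)
      _ = ENNReal.ofReal (K / α) * (sobolevNorm s u₁ ^ 2 +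
          ENNReal.ofReal (a 0) * sobolevNorm (1 + s) u₀ ^ 2 + l2SobolevNorm T s f ^ 2) := by
          rw [← hE, sobolevNorm_sq, sobolevNorm_sq, ← ENNReal.tsum_mul_left, ← ENNReal.tsum_add,
            ← ENNReal.tsum_add, ← ENNReal.tsum_mul_left]
          refine tsum_congr fun i => ?_
          rw [ENNReal.ofReal_mul (div_pos hKpos hα).le, hRs, ofReal_rpow_mul_enorm_sq,
            ofReal_rpow_mul_enorm_sq, ← ENNReal.ofReal_mul ha0.le]
          have p1 := mul_nonneg (hxs s i).le (sq_nonneg ‖u₁ (eigenTest S i)‖)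
          have p2 := mul_nonneg ha0.le
            (mul_nonneg (hxs (1 + s) i).le (sq_nonneg ‖u₀ (eigenTest S i)‖))
          rw [ENNReal.ofReal_add (add_nonneg p1 p2) (mul_nonneg (hxs s i).le (hE0 i)),
            ENNReal.ofReal_add p1 p2]

/-! ### Very weak solutions -/

theorem exp_logRate_le {ε : ℝ} (hε : ε ∈ Ioc (0 : ℝ) 1) (T c : ℝ) :
    Real.exp (T + c * logRate ε) ≤ Real.exp (T + ⌈c⌉₊) * (ε⁻¹) ^ ⌈c⌉₊ := by
  have h1 : c * logRate ε ≤ ⌈c⌉₊ * logRate ε :=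
    mul_le_mul_of_nonneg_right (Nat.le_ceil c) (by linarith [one_le_logRate hε])
  have h2 : (ε⁻¹) ^ ⌈c⌉₊ = Real.exp (⌈c⌉₊ * -Real.log ε) := by
    rw [Real.exp_nat_mul, Real.exp_neg, Real.exp_log hε.1]
  rw [h2, ← Real.exp_add]
  refine Real.exp_le_exp.2 ?_
  rw [logRate] at *
  linarith

/-- A bound on the squared Sobolev norm, uniform in time and of the size of a power of `ε⁻¹`, gives
moderateness. -/
theorem isL2Moderate_of_sobolevNorm_sq_le {T r : ℝ} (hT : 0 ≤ T) {u : ℝ → ℝ → HDistribution S}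
    (hu : ∀ ε ∈ Ioc (0 : ℝ) 1, ∀ φ, ContinuousOn (fun t => u ε t φ) (Icc 0 T)) {D : ℝ} (hD : 0 ≤ D)
    {N : ℕ} (h : ∀ ε ∈ Ioc (0 : ℝ) 1, ∀ t ∈ Icc 0 T,
      sobolevNorm r (u ε t) ^ 2 ≤ ENNReal.ofReal (D * (ε⁻¹) ^ N)) : IsL2Moderate T r u := by
  have hb : ∀ ε ∈ Ioc (0 : ℝ) 1,
      l2SobolevNorm T r (u ε) ≤ ENNReal.ofReal ((T * D + 1) * (ε ^ N)⁻¹) := fun ε hε => by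
    have hε0 := hε.1
    rw [← ENNReal.pow_le_pow_left_iff two_ne_zero, l2SobolevNorm_sq]
    refine (setLIntegral_mono' measurableSet_Icc (h ε hε)).trans ?_
    rw [setLIntegral_const, Real.volume_Icc, sub_zero, ← ENNReal.ofReal_mul (by positivity),
      ← ENNReal.ofReal_pow (by positivity)]
    refine ENNReal.ofReal_le_ofReal ?_
    rw [inv_pow]
    have h1 : 1 ≤ (ε ^ N)⁻¹ := (one_le_inv₀ (pow_pos hε0 N)).2 (pow_le_one₀ hε0.le hε.2)
    have h2 : 0 ≤ T * D := mul_nonneg hT hD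
    set x := (ε ^ N)⁻¹
    have h3 : T * D * x ≤ (T * D + 1) * x := by nlinarith
    have h4 : 1 ≤ (T * D + 1) * x := by nlinarith
    nlinarith
  exact ⟨fun ε hε => ⟨fun φ => (hu ε hε φ).aestronglyMeasurable measurableSet_Icc,
    (hb ε hε).trans_lt ENNReal.ofReal_lt_top⟩, N, T * D + 1, by positivity, hb⟩

/-- For every moderate regularisation of the source there is a very weak solution. The coefficients
grow like `log (1 / ε)`, and the exponential of that rate, which the energy estimate produces, is a
power of `ε⁻¹`. -/
theorem exists_veryWeakSolutionWith {T : ℝ} (hT : 0 < T)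
    {a q : 𝓓'((⊤ : TopologicalSpace.Opens ℝ), ℝ)}
    {f : (Fin n → ℤ) → 𝓓'((⊤ : TopologicalSpace.Opens ℝ), ℂ)}
    (ha : Distribution.dsupport a ⊆ Icc 0 T) (hq : Distribution.dsupport q ⊆ Icc 0 T)
    (hf : ∀ k, Distribution.dsupport (f k) ⊆ Icc 0 T) {a₀ : ℝ} (ha₀ : 0 < a₀)
    (haa₀ : ∀ φ : LineTest, (∀ t, 0 ≤ φ t) → a₀ * (∫ t in (0 : ℝ)..T, φ t) ≤ a φ)
    {s : ℝ} {u₀ u₁ : HDistribution S} (hu₀ : MemSobolev (1 + s) u₀) (hu₁ : MemSobolev s u₁)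
    {fε : ℝ → ℝ → HDistribution S} (hfε : IsModerateSourceRegularisation T s f fε) :
    ∃ u, IsVeryWeakSolutionWith T s a q fε u₀ u₁ u := by
  obtain ⟨aε, hra, hma, hda, ⟨A, hA0, hA⟩, hpos⟩ := exists_coefficient_regularisation hT ha
  obtain ⟨qε, hrq, hmq, hdq, ⟨Q, hQ0, hQ⟩, -⟩ := exists_coefficient_regularisation hT hq
  obtain ⟨hfr, hfm, Nf, cf, hcf, hfb⟩ := hfε
  have h0T : (0 : ℝ) ∈ Icc 0 T := ⟨le_rfl, hT.le⟩
  set α := a₀ / 2 with hα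
  have hα0 : 0 < α := half_pos ha₀
  have hfc : ∀ ε ∈ Ioc (0 : ℝ) 1, ∀ k, Continuous fun t => (fε ε t).value k := fun ε hε k => by
    obtain ⟨ψ, -, -, ω, hω0, -, hω⟩ := hfr k
    simp only [hω ε hε]
    exact continuous_iff_continuousAt.2 fun t =>
      (hasDerivAt_mollify (hf k) ψ (hω0 ε hε) t).continuousAt
  have hex : ∀ ε, ∃ u, ε ∈ Ioc (0 : ℝ) 1 → IsSolution T (aε ε) (qε ε) (fε ε) u₀ u₁ u ∧
      (∀ φ, ContinuousOn (fun t => u t φ) (Icc 0 T)) ∧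
      ∀ t ∈ Icc 0 T, sobolevNorm (1 + s) (u t) ^ 2 ≤
        ENNReal.ofReal (Real.exp ((1 + (A + Q) * logRate ε + 2 * ((A + Q) * logRate ε) / α) * T) /
          α) * (sobolevNorm s u₁ ^ 2 + ENNReal.ofReal (aε ε 0) * sobolevNorm (1 + s) u₀ ^ 2 +
            l2SobolevNorm T s (fε ε) ^ 2) := by
    intro ε
    by_cases hε : ε ∈ Ioc (0 : ℝ) 1
    · have hL := one_le_logRate hε
      obtain ⟨u, hu⟩ := exists_solution (M := (A + Q) * logRate ε) hT hα0
        (fun t => (hda ε hε t).hasDerivAt) (hdq ε hε).continuous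
        (hpos a₀ ha₀.le haa₀ ε hε)
        (fun t _ => (abs_sub _ _).trans (by
          rw [add_mul]
          exact add_le_add (hA ε hε t).1 (hQ ε hε t).1))
        (fun t _ => (hA ε hε t).2.trans
          (mul_le_mul_of_nonneg_right (by linarith) (by linarith)))
        (hfm ε hε) (hfc ε hε) hu₀ hu₁
      exact ⟨u, fun _ => hu⟩
    · exact ⟨fun _ => u₀, fun h => absurd h hε⟩
  choose u hu using hex
  refine ⟨u, aε, qε, ⟨hra, hma⟩, ⟨hrq, hmq.mono (Nat.zero_le 1)⟩, fun ε hε => (hu ε hε).1, ?_⟩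
  -- moderateness, since the exponent of the energy bound grows logarithmically
  set c := (A + Q) * (1 + 2 / α) * T with hc
  set x₁ := (sobolevNorm s u₁).toReal with hx₁
  set x₀ := (sobolevNorm (1 + s) u₀).toReal with hx₀
  have ex₁ : sobolevNorm s u₁ = ENNReal.ofReal x₁ := (ENNReal.ofReal_toReal hu₁.ne).symm
  have ex₀ : sobolevNorm (1 + s) u₀ = ENNReal.ofReal x₀ := (ENNReal.ofReal_toReal hu₀.ne).symm
  have hx₁0 : 0 ≤ x₁ := ENNReal.toReal_nonneg
  have hx₀0 : 0 ≤ x₀ := ENNReal.toReal_nonneg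
  set D := Real.exp (T + ⌈c⌉₊) / α * (x₁ ^ 2 + A * x₀ ^ 2 + cf ^ 2) with hD
  refine isL2Moderate_of_sobolevNorm_sq_le hT.le (fun ε hε => (hu ε hε).2.1) (D := D)
    (by positivity) (N := ⌈c⌉₊ + (1 + Nf * 2)) fun ε hε t ht => ?_
  refine ((hu ε hε).2.2 t ht).trans ?_
  have hε0 := hε.1
  have hr1 : 1 ≤ ε⁻¹ := (one_le_inv₀ hε0).2 hε.2
  have hexp : Real.exp ((1 + (A + Q) * logRate ε + 2 * ((A + Q) * logRate ε) / α) * T) / α ≤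
      Real.exp (T + ⌈c⌉₊) / α * (ε⁻¹) ^ ⌈c⌉₊ := by
    rw [div_mul_eq_mul_div]
    refine div_le_div_of_nonneg_right ?_ hα0.le
    refine le_trans (le_of_eq ?_) (exp_logRate_le hε T c)
    congr 1
    rw [hc]
    ring
  have hin : sobolevNorm s u₁ ^ 2 + ENNReal.ofReal (aε ε 0) * sobolevNorm (1 + s) u₀ ^ 2 +
      l2SobolevNorm T s (fε ε) ^ 2 ≤
      ENNReal.ofReal ((x₁ ^ 2 + A * x₀ ^ 2 + cf ^ 2) * (ε⁻¹) ^ (1 + Nf * 2)) := by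
    have ha0 : aε ε 0 ≤ A * ε⁻¹ := (le_abs_self _).trans ((hA ε hε 0).1.trans
      (mul_le_mul_of_nonneg_left (logRate_le_inv hε) hA0))
    have p1 : 1 ≤ (ε⁻¹) ^ (1 + Nf * 2) := one_le_pow₀ hr1
    have p2 : ε⁻¹ ≤ (ε⁻¹) ^ (1 + Nf * 2) := le_self_pow₀ hr1 (by omega)
    have p3 : ((ε ^ Nf)⁻¹) ^ 2 ≤ (ε⁻¹) ^ (1 + Nf * 2) := by
      rw [← inv_pow, ← pow_mul]
      exact pow_le_pow_right₀ hr1 (by omega)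
    rw [ex₁, ex₀, ← ENNReal.ofReal_pow hx₁0, ← ENNReal.ofReal_pow hx₀0, add_mul, add_mul,
      ENNReal.ofReal_add (by positivity) (by positivity),
      ENNReal.ofReal_add (by positivity) (by positivity)]
    refine add_le_add (add_le_add (ENNReal.ofReal_le_ofReal ?_) ?_) ?_
    · exact le_mul_of_one_le_right (sq_nonneg _) p1
    · rw [← ENNReal.ofReal_mul' (sq_nonneg x₀)]
      refine ENNReal.ofReal_le_ofReal ?_
      rw [mul_right_comm]
      exact mul_le_mul_of_nonneg_right (ha0.trans (mul_le_mul_of_nonneg_left p2 hA0)) (sq_nonneg _)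
    · refine (pow_le_pow_left' (hfb ε hε) 2).trans ?_
      rw [← ENNReal.ofReal_pow (by positivity), mul_pow]
      exact ENNReal.ofReal_le_ofReal (mul_le_mul_of_nonneg_left p3 (sq_nonneg _))
  refine (mul_le_mul' (ENNReal.ofReal_le_ofReal hexp) hin).trans_eq ?_
  rw [← ENNReal.ofReal_mul (by positivity), hD, pow_add]
  congr 1
  ring

end LatticeWave

theorem theorem2p4 (n : ℕ) (S : LatticeWave.ConfiningSchrodinger n) (T : ℝ) (hT : 0 < T)
    (a q : 𝓓'((⊤ : TopologicalSpace.Opens ℝ), ℝ))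
    (f : (Fin n → ℤ) → 𝓓'((⊤ : TopologicalSpace.Opens ℝ), ℂ))
    (ha : Distribution.dsupport a ⊆ Set.Icc 0 T)
    (hq : Distribution.dsupport q ⊆ Set.Icc 0 T)
    (hf : ∀ k, Distribution.dsupport (f k) ⊆ Set.Icc 0 T)
    (a₀ : ℝ) (ha₀ : 0 < a₀)
    (haa₀ : ∀ φ : 𝓓((⊤ : TopologicalSpace.Opens ℝ), ℝ), (∀ t, 0 ≤ φ t) →
      a₀ * (∫ t in (0 : ℝ)..T, φ t) ≤ a φ)
    (s : ℝ) (u₀ u₁ : LatticeWave.HDistribution S)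
    (hu₀ : LatticeWave.MemSobolev (1 + s) u₀) (hu₁ : LatticeWave.MemSobolev s u₁) :
    (∃ u : ℝ → ℝ → LatticeWave.HDistribution S,
      LatticeWave.IsVeryWeakSolution T s a q f u₀ u₁ u) ∧
    ∀ fε : ℝ → ℝ → LatticeWave.HDistribution S,
      LatticeWave.IsModerateSourceRegularisation T s f fε →
      ∃ u : ℝ → ℝ → LatticeWave.HDistribution S,
        LatticeWave.IsVeryWeakSolutionWith T s a q fε u₀ u₁ u := by
  refine ⟨?_, fun fε hfε =>
    LatticeWave.exists_veryWeakSolutionWith hT ha hq hf ha₀ haa₀ hu₀ hu₁ hfε⟩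
  obtain ⟨fε, hfε⟩ := LatticeWave.exists_source_regularisation s S hf
  obtain ⟨u, hu⟩ :=
    LatticeWave.exists_veryWeakSolutionWith hT ha hq hf ha₀ haa₀ hu₀ hu₁ hfε
  exact ⟨u, fε, hfε, hu⟩
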